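/- Let $G$ be a Lie group with semisimple Lie algebra $\mathfrak g$, let $\mathfrak g=\mathfrak g_{-1}\oplus\mathfrak g_0\oplus\mathfrak g_1$ be a grading ($[\mathfrak g_i,\mathfrak g_j]\subset\mathfrak g_{i+j}$), and let $P\subset G$ be a Lie subgroup with Lie algebra $\mathfrak p=\mathfrak g_0\oplus\mathfrak g_1$ whose adjoint action preserves the filtration $\mathfrak g\supset\mathfrak p\supset\mathfrak g_1$. Assume that $(G,P)$ is infinitesimally effective, i.e. $\mathfrak p$ contains no nonzero ideal of $\mathfrak g$. Let $G_0\subset P$ be the subgroup of elements whose adjoint action preserves the grading, and $P_+=\exp\mathfrak g_1$. Let $(\mathcal G\to M,\omega)$ be a $|1|$-graded parabolic geometry of type $(G,P)$, i.e. a smooth principal $P$-bundle with a Cartan connection $\omega\in\Omega^1(\mathcal G,\mathfrak g)$, and let $K=d\omega+\frac12[\omega,\omega]$ be its curvature, with curvature function $\kappa(u)(X,Y)=K(\omega_u^{-1}X,\omega_u^{-1}Y)$, $X,Y\in\mathfrak g_{-1}\cong\mathfrak g/\mathfrak p$. Put $\mathcal G_0=\mathcal G/P_+$. A Weyl structure is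 a smooth $G_0$-equivariant section $\sigma:\mathcal G_0\to\mathcal G$ of $\mathcal G\to\mathcal G_0$. Its Weyl connection $\nabla$ is the connection induced by the principal connection $\gamma=\sigma^*\omega_0$ on $\mathcal G_0\to M$ (the $\mathfrak g_0$-component of $\sigma^*\omega$); the $\mathfrak g_{-1}$-component $\theta=\sigma^*\omega_{-1}$ is the soldering form. Write $\kappa\circ\sigma=T+W+Y$ according to the values in $\mathfrak g_{-1}\oplus\mathfrak g_0\oplus\mathfrak g_1$; $W$ is called the Weyl curvature. A symmetry centered at $x\in M$ is a diffeomorphism $s_x$ of $M$ with $s_x(x)=x$ and $T_xs_x=-\mathrm{id}$ that is covered by an automorphism $\varphi$ of $(\mathcal G\to M,\omega)$; let $\varphi_0$ be the map induced by $\varphi$ on $\mathcal G_0$. A Weyl structure $\sigma$ is $s_x$-invariant in the fiber over $x$ if, for such a $\varphi$, $\varphi(\sigma(u_0))=\sigma(\varphi_0(u_0))$ for all $u_0\in\mathcal G_0$ over $x$. A system $S$ of symmetries is a choice of a symmetry $s_x$ at every $x\in M$ (no smoothness in $x$ is required). It admits a fiberwise invariant Weyl structure $\hat\sigma$ if the map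 $\hat\sigma:\mathcal G_0\to\mathcal G$, which over each $x\in M$ agrees with a Weyl structure that is $s_x$-invariant in the fiber over $x$, is smooth. Proposition. Suppose that the system $S$ of symmetries admits a fiberwise invariant Weyl structure $\hat\sigma$. Then $T=0$, the corresponding Weyl connection $\nabla$ is torsion-free (its torsion form $d\theta+[\gamma,\theta]$ vanishes), and its Weyl curvature is parallel: $\nabla W=0$. -/

import Mathlib

open scoped Manifold ContDiff

noncomputable section

namespace OneGraded

instance instLEInftyMinSmoothness : ENat.LEInfty (minSmoothness ℝ 3) := by
  rw [minSmoothness_of_isRCLikeNormedField]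
  infer_instance

/-! ### The model data: `P ⊂ G` and the grading of `𝔤` -/

section LieGroups

variable {EG : Type*} [NormedAddCommGroup EG] [NormedSpace ℝ EG]
  (G : Type*) [TopologicalSpace G] [ChartedSpace EG G] [Group G]

/-- The Lie algebra of a Lie group (tangent space at `1` with the bracket of left-invariant
vector fields). -/
abbrev Lie𝔤 : Type _ := GroupLieAlgebra 𝓘(ℝ, EG) G

variable {G}

/-- A Lie algebra element as a vector of the model normed space (the identity map); derivatives of
`𝔤`-valued functions are taken in this normed space. -/
def toVec (X : Lie𝔤 (EG := EG) G) : EG := X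

/-- The inverse of `toVec` (the identity map). -/
def ofVec (X : EG) : Lie𝔤 (EG := EG) G := X

/-- The adjoint action: the derivative at `1` of the conjugation `h ↦ g h g⁻¹`. -/
def Ad (g : G) (X : Lie𝔤 (EG := EG) G) : Lie𝔤 (EG := EG) G :=
  mfderiv 𝓘(ℝ, EG) 𝓘(ℝ, EG) (fun h : G => g * h * g⁻¹) 1 X

end LieGroups

/-- The type `(G, P)` of a `|1|`-graded parabolic geometry: a Lie group `G` with semisimple Lie
algebra `𝔤`, a grading `𝔤 = 𝔤₋₁ ⊕ 𝔤₀ ⊕ 𝔤₁`, and a Lie subgroup `P` of `G` (given by an injective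
immersive homomorphism of Lie groups) that preserves the filtration of `𝔤` induced by the grading
and whose Lie algebra is `𝔭 = 𝔤₀ ⊕ 𝔤₁`. -/
structure ParabolicType
    (EG : Type*) [NormedAddCommGroup EG] [NormedSpace ℝ EG] [FiniteDimensional ℝ EG]
    (G : Type*) [TopologicalSpace G] [ChartedSpace EG G] [Group G] [LieGroup 𝓘(ℝ, EG) ∞ G]
    (EP : Type*) [NormedAddCommGroup EP] [NormedSpace ℝ EP] [FiniteDimensional ℝ EP]
    (P : Type*) [TopologicalSpace P] [ChartedSpace EP P] [Group P] [LieGroup 𝓘(ℝ, EP) ∞ P] where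
  semisimple : LieAlgebra.IsSemisimple ℝ (Lie𝔤 (EG := EG) G)
  /-- the graded pieces `𝔤ᵢ` -/
  gr : ℤ → Submodule ℝ (Lie𝔤 (EG := EG) G)
  graded : GradedLieAlgebra gr
  gr_eq_bot : ∀ i : ℤ, 1 < |i| → gr i = ⊥
  /-- the inclusion `P → G` -/
  incl : P →* G
  incl_smooth : ContMDiff 𝓘(ℝ, EP) 𝓘(ℝ, EG) ∞ incl
  incl_injective : Function.Injective incl
  incl_immersion : Function.Injective (mfderiv 𝓘(ℝ, EP) 𝓘(ℝ, EG) incl 1)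
  lie_range : ∀ X : Lie𝔤 (EG := EG) G,
    (∃ A : Lie𝔤 (EG := EP) P, mfderiv 𝓘(ℝ, EP) 𝓘(ℝ, EG) incl 1 A = X) ↔ X ∈ gr 0 ⊔ gr 1
  filtration : ∀ (p : P) (i : ℤ), ∀ X ∈ ⨆ j ≥ i, gr j, Ad (incl p) X ∈ ⨆ j ≥ i, gr j

namespace ParabolicType

variable {EG : Type*} [NormedAddCommGroup EG] [NormedSpace ℝ EG] [FiniteDimensional ℝ EG]
  {G : Type*} [TopologicalSpace G] [ChartedSpace EG G] [Group G] [LieGroup 𝓘(ℝ, EG) ∞ G]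
  {EP : Type*} [NormedAddCommGroup EP] [NormedSpace ℝ EP] [FiniteDimensional ℝ EP]
  {P : Type*} [TopologicalSpace P] [ChartedSpace EP P] [Group P] [LieGroup 𝓘(ℝ, EP) ∞ P]
  (T : ParabolicType EG G EP P)

/-- The component of `X ∈ 𝔤` in `𝔤ᵢ`. -/
def comp (i : ℤ) (X : Lie𝔤 (EG := EG) G) : Lie𝔤 (EG := EG) G :=
  letI := T.graded
  (DirectSum.decompose T.gr X i : T.gr i)

/-- The derivative `Lie P → 𝔤` of the inclusion. -/
def lieIncl (A : Lie𝔤 (EG := EP) P) : Lie𝔤 (EG := EG) G :=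
  mfderiv 𝓘(ℝ, EP) 𝓘(ℝ, EG) T.incl 1 A

/-- Infinitesimal effectivity: `𝔭` contains no nonzero ideal of `𝔤`. -/
def InfinitesimallyEffective : Prop :=
  ∀ J : LieIdeal ℝ (Lie𝔤 (EG := EG) G), (∀ X ∈ J, X ∈ T.gr 0 ⊔ T.gr 1) → J = ⊥

/-- The Levi subgroup `G₀`: the elements of `P` whose adjoint action preserves the grading. -/
def G₀ : Set P := {p | ∀ i : ℤ, ∀ X ∈ T.gr i, Ad (T.incl p) X ∈ T.gr i}

/-- `exp 𝔤₁`: the values at time one of the one-parameter subgroups of `P` with velocity in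
`𝔤₁`. -/
def expG₁ : Set P :=
  {p | ∃ c : ℝ → P, ContMDiff 𝓘(ℝ, ℝ) 𝓘(ℝ, EP) ∞ c ∧ (∀ s t, c (s + t) = c s * c t) ∧
    T.lieIncl (mfderiv 𝓘(ℝ, ℝ) 𝓘(ℝ, EP) c 0 (1 : ℝ)) ∈ T.gr 1 ∧ c 1 = p}

/-- The subgroup `P₊ = exp 𝔤₁` (the set `exp 𝔤₁` is already a subgroup as `𝔤₁` is abelian). -/
def Pplus : Subgroup P := Subgroup.closure T.expG₁

end ParabolicType

/-! ### Exterior derivative of vector valued one-forms -/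

section Forms

variable {EB : Type*} [NormedAddCommGroup EB] [NormedSpace ℝ EB]
  {B : Type*} [TopologicalSpace B] [ChartedSpace EB B]
  {V : Type*} [NormedAddCommGroup V] [NormedSpace ℝ V]

/-- The coefficient `y ↦ α_y(w)` of a one-form in the preferred chart at `u`, for a constant
vector `w` of the chart. -/
def coeffInChart (α : ∀ u : B, TangentSpace 𝓘(ℝ, EB) u → V) (u : B) (w : EB) (y : EB) : V :=
  α ((extChartAt 𝓘(ℝ, EB) u).symm y)
    (mfderiv 𝓘(ℝ, EB) 𝓘(ℝ, EB) (extChartAt 𝓘(ℝ, EB) u).symm y w)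

/-- The exterior derivative `dα(v, w) = D_v(α(w)) - D_w(α(v))`, computed in the preferred chart
at `u`, through which `TangentSpace` at `u` is identified with the model space. -/
def extD (α : ∀ u : B, TangentSpace 𝓘(ℝ, EB) u → V) (u : B) (v w : TangentSpace 𝓘(ℝ, EB) u) : V :=
  fderiv ℝ (coeffInChart α u w) (extChartAt 𝓘(ℝ, EB) u u) v
    - fderiv ℝ (coeffInChart α u v) (extChartAt 𝓘(ℝ, EB) u u) w

end Forms

/-! ### Cartan geometries -/

/-- A `|1|`-graded parabolic geometry of type `(G, P)`: a principal `P`-bundle `proj : B → M` with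
right action `act`, and a Cartan connection `ω` (the field `conn`) on it. -/
structure Geometry
    {EG : Type*} [NormedAddCommGroup EG] [NormedSpace ℝ EG] [FiniteDimensional ℝ EG]
    {G : Type*} [TopologicalSpace G] [ChartedSpace EG G] [Group G] [LieGroup 𝓘(ℝ, EG) ∞ G]
    {EP : Type*} [NormedAddCommGroup EP] [NormedSpace ℝ EP] [FiniteDimensional ℝ EP]
    {P : Type*} [TopologicalSpace P] [ChartedSpace EP P] [Group P] [LieGroup 𝓘(ℝ, EP) ∞ P]
    (T : ParabolicType EG G EP P)
    (EB : Type*) [NormedAddCommGroup EB] [NormedSpace ℝ EB] [FiniteDimensional ℝ EB]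
    (B : Type*) [TopologicalSpace B] [ChartedSpace EB B] [IsManifold 𝓘(ℝ, EB) ∞ B]
    (EM : Type*) [NormedAddCommGroup EM] [NormedSpace ℝ EM] [FiniteDimensional ℝ EM]
    (M : Type*) [TopologicalSpace M] [ChartedSpace EM M] [IsManifold 𝓘(ℝ, EM) ∞ M] where
  proj : B → M
  proj_smooth : ContMDiff 𝓘(ℝ, EB) 𝓘(ℝ, EM) ∞ proj
  act : B → P → B
  act_one : ∀ u, act u 1 = u
  act_mul : ∀ u p q, act u (p * q) = act (act u p) q
  act_smooth : ContMDiff (𝓘(ℝ, EB).prod 𝓘(ℝ, EP)) 𝓘(ℝ, EB) ∞ (fun z : B × P => act z.1 z.2)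
  act_free : ∀ u p, act u p = u → p = 1
  proj_act : ∀ u p, proj (act u p) = proj u
  /-- Local triviality: over an open `U ∋ x` there is a smooth section `s`, and
  `u ↦ (proj u, h u)` is the smooth inverse of the bijection `(y, p) ↦ s(y)·p`. -/
  locally_trivial : ∀ x : M, ∃ U : Set M, IsOpen U ∧ x ∈ U ∧
    ∃ (s : M → B) (h : B → P),
      ContMDiffOn 𝓘(ℝ, EM) 𝓘(ℝ, EB) ∞ s U ∧
      ContMDiffOn 𝓘(ℝ, EB) 𝓘(ℝ, EP) ∞ h (proj ⁻¹' U) ∧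
      (∀ y ∈ U, proj (s y) = y) ∧
      (∀ u ∈ proj ⁻¹' U, act (s (proj u)) (h u) = u)
  /-- the Cartan connection, a linear isomorphism on each tangent space -/
  conn : ∀ u : B, TangentSpace 𝓘(ℝ, EB) u ≃L[ℝ] Lie𝔤 (EG := EG) G
  conn_smooth : ContMDiff 𝓘(ℝ, EB).tangent 𝓘(ℝ, EG) ∞
    (fun z : TangentBundle 𝓘(ℝ, EB) B => toVec (conn z.proj z.snd))
  conn_equivariant : ∀ (u : B) (p : P) (v : TangentSpace 𝓘(ℝ, EB) u),
    conn (act u p) (mfderiv 𝓘(ℝ, EB) 𝓘(ℝ, EB) (fun b => act b p) u v) = Ad (T.incl p⁻¹) (conn u v)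
  /-- `ω` reproduces the generators of the fundamental vector fields -/
  conn_fundamental : ∀ (u : B) (A : Lie𝔤 (EG := EP) P),
    (conn u : EB → EG) (mfderiv 𝓘(ℝ, EP) 𝓘(ℝ, EB) (fun p => act u p) 1 A) = T.lieIncl A

namespace Geometry

variable
  {EG : Type*} [NormedAddCommGroup EG] [NormedSpace ℝ EG] [FiniteDimensional ℝ EG]
  {G : Type*} [TopologicalSpace G] [ChartedSpace EG G] [Group G] [LieGroup 𝓘(ℝ, EG) ∞ G]
  {EP : Type*} [NormedAddCommGroup EP] [NormedSpace ℝ EP] [FiniteDimensional ℝ EP]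
  {P : Type*} [TopologicalSpace P] [ChartedSpace EP P] [Group P] [LieGroup 𝓘(ℝ, EP) ∞ P]
  {T : ParabolicType EG G EP P}
  {EB : Type*} [NormedAddCommGroup EB] [NormedSpace ℝ EB] [FiniteDimensional ℝ EB]
  {B : Type*} [TopologicalSpace B] [ChartedSpace EB B] [IsManifold 𝓘(ℝ, EB) ∞ B]
  {EM : Type*} [NormedAddCommGroup EM] [NormedSpace ℝ EM] [FiniteDimensional ℝ EM]
  {M : Type*} [TopologicalSpace M] [ChartedSpace EM M] [IsManifold 𝓘(ℝ, EM) ∞ M]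
  (C : Geometry T EB B EM M)

/-- The curvature form `K = dω + ½[ω, ω]`, that is `K(v, w) = dω(v, w) + [ω(v), ω(w)]`. -/
def curvatureForm (u : B) (v w : TangentSpace 𝓘(ℝ, EB) u) : Lie𝔤 (EG := EG) G :=
  ofVec (extD (fun b z => toVec (C.conn b z)) u v w) + ⁅C.conn u v, C.conn u w⁆

/-- The curvature function `κ(u)(X, Y) = K(ω_u⁻¹ X, ω_u⁻¹ Y)`; it is used for `X, Y ∈ 𝔤₋₁ ≅ 𝔤/𝔭`. -/
def curvature (u : B) (X Y : Lie𝔤 (EG := EG) G) : Lie𝔤 (EG := EG) G :=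
  C.curvatureForm u ((C.conn u).symm X) ((C.conn u).symm Y)

/-- Being in the same orbit of `P₊`. -/
def orbitSetoid : Setoid B where
  r u v := ∃ q ∈ T.Pplus, C.act u q = v
  iseqv :=
    { refl := fun u => ⟨1, T.Pplus.one_mem, C.act_one u⟩
      symm := by
        rintro u v ⟨q, hq, rfl⟩
        exact ⟨q⁻¹, T.Pplus.inv_mem hq, by rw [← C.act_mul, mul_inv_cancel, C.act_one]⟩
      trans := by
        rintro u v w ⟨q, hq, rfl⟩ ⟨r, hr, rfl⟩
        exact ⟨q * r, T.Pplus.mul_mem hq hr, C.act_mul u q r⟩ }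

/-- The orbit space `B₀ = B / P₊`. Its smooth structure is the one for which the projection
`π : B → B₀` is a submersion, so that a map on `B₀` is smooth iff its composite with `π` is, and
pulling back by `π` is injective on functions and differential forms. Below, forms and functions
on `B₀` are written through their pull-backs to `B`. -/
def B₀ : Type _ := Quotient C.orbitSetoid

/-- The projection `π : B → B₀`. -/
def toB₀ (u : B) : C.B₀ := Quotient.mk C.orbitSetoid u

/-- A Weyl structure: a smooth section `σ` of `π : B → B₀` that is equivariant for `G₀`, which
acts on `B₀` by `π(u)·g = π(u·g)`. -/
structure IsWeylStructure (σ : C.B₀ → B) : Prop where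
  smooth : ContMDiff 𝓘(ℝ, EB) 𝓘(ℝ, EB) ∞ (fun u => σ (C.toB₀ u))
  isSection : ∀ q : C.B₀, C.toB₀ (σ q) = q
  equivariant : ∀ (u : B), ∀ g ∈ T.G₀, σ (C.toB₀ (C.act u g)) = C.act (σ (C.toB₀ u)) g

/-! ### Symmetries -/

/-- Automorphisms of the geometry: principal bundle automorphisms `φ` with `φ^*ω = ω`. -/
structure Automorphism where
  toDiffeo : B ≃ₘ⟮𝓘(ℝ, EB), 𝓘(ℝ, EB)⟯ B
  map_act : ∀ u p, toDiffeo (C.act u p) = C.act (toDiffeo u) p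
  pullback_conn : ∀ (u : B) (v : TangentSpace 𝓘(ℝ, EB) u),
    C.conn (toDiffeo u) (mfderiv 𝓘(ℝ, EB) 𝓘(ℝ, EB) toDiffeo u v) = C.conn u v

/-- `φ` covers the map `s` of the base. -/
def Automorphism.Covers {C : Geometry T EB B EM M} (φ : C.Automorphism) (s : M → M) : Prop :=
  ∀ u, C.proj (φ.toDiffeo u) = s (C.proj u)

/-- The morphism `φ₀` of `B₀` underlying `φ`. -/
def Automorphism.underlying {C : Geometry T EB B EM M} (φ : C.Automorphism) : C.B₀ → C.B₀ :=
  Quotient.map φ.toDiffeo (by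
    rintro u v ⟨q, hq, rfl⟩
    exact ⟨q, hq, (φ.map_act u q).symm⟩)

/-- A symmetry centered at `x`: a diffeomorphism `s` of `M` with `s(x) = x` and `T_x s = -id` that
is covered by an automorphism of the geometry. -/
structure IsSymmetryAt (x : M) (s : M ≃ₘ⟮𝓘(ℝ, EM), 𝓘(ℝ, EM)⟯ M) : Prop where
  fixes : s x = x
  tangent : ∀ v : EM, (mfderiv 𝓘(ℝ, EM) 𝓘(ℝ, EM) s x : EM → EM) v = -v
  covered : ∃ φ : C.Automorphism, φ.Covers s

/-- A system of symmetries: a symmetry `s_x` chosen at each point `x`; no smoothness in `x` is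
required. -/
structure SymmetrySystem where
  s : M → (M ≃ₘ⟮𝓘(ℝ, EM), 𝓘(ℝ, EM)⟯ M)
  isSymmetry : ∀ x, C.IsSymmetryAt x (s x)

/-- `σ` is `s`-invariant in the fiber over `x`: for a covering `φ` of `s` (unique if the geometry
is effective), `φ(σ(u₀)) = σ(φ₀(u₀))` for all `u₀ ∈ B₀` over `x`. -/
def InvariantAt (s : M → M) (σ : C.B₀ → B) (x : M) : Prop :=
  ∃ φ : C.Automorphism, φ.Covers s ∧
    ∀ u : B, C.proj u = x → φ.toDiffeo (σ (C.toB₀ u)) = σ (φ.underlying (C.toB₀ u))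

/-- `σ` is the fiberwise invariant Weyl structure of the system `S`: in the fiber over each `x` it
agrees with a Weyl structure that is `s_x`-invariant in the fiber over `x`, and it is smooth. -/
structure IsFiberwiseInvariantWeylStructure (S : C.SymmetrySystem) (σ : C.B₀ → B) : Prop where
  fiberwise : ∀ x : M, ∃ τ : C.B₀ → B, C.IsWeylStructure τ ∧ C.InvariantAt (S.s x) τ x ∧
    ∀ u : B, C.proj u = x → σ (C.toB₀ u) = τ (C.toB₀ u)
  smooth : ContMDiff 𝓘(ℝ, EB) 𝓘(ℝ, EB) ∞ (fun u => σ (C.toB₀ u))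

/-! ### The Weyl connection of a Weyl structure, its torsion and Weyl curvature -/

/-- The one-form `σ^*ω` on `B₀`, pulled back to `B`: the pull-back of `ω` by `σ ∘ π`. -/
def weylForm (σ : C.B₀ → B) (u : B) (v : TangentSpace 𝓘(ℝ, EB) u) : Lie𝔤 (EG := EG) G :=
  C.conn (σ (C.toB₀ u)) (mfderiv 𝓘(ℝ, EB) 𝓘(ℝ, EB) (fun b => σ (C.toB₀ b)) u v)

/-- The soldering form `θ = σ^*ω₋₁`. -/
def soldering (σ : C.B₀ → B) (u : B) (v : TangentSpace 𝓘(ℝ, EB) u) : Lie𝔤 (EG := EG) G :=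
  T.comp (-1) (C.weylForm σ u v)

/-- The Weyl connection `γ = σ^*ω₀`, a principal connection form on `B₀ → M`. -/
def weylConnection (σ : C.B₀ → B) (u : B) (v : TangentSpace 𝓘(ℝ, EB) u) : Lie𝔤 (EG := EG) G :=
  T.comp 0 (C.weylForm σ u v)

/-- The torsion form of the Weyl connection,
`Θ(v, w) = dθ(v, w) + [γ(v), θ(w)] - [γ(w), θ(v)]`. -/
def weylTorsionForm (σ : C.B₀ → B) (u : B) (v w : TangentSpace 𝓘(ℝ, EB) u) :
    Lie𝔤 (EG := EG) G :=
  ofVec (extD (fun b z => toVec (C.soldering σ b z)) u v w)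
    + ⁅C.weylConnection σ u v, C.soldering σ u w⁆ - ⁅C.weylConnection σ u w, C.soldering σ u v⁆

/-- The component `T` of `σ^*κ = T + W + Y` with values in `𝔤₋₁`. -/
def torsionPart (σ : C.B₀ → B) (u : B) (X Y : Lie𝔤 (EG := EG) G) : Lie𝔤 (EG := EG) G :=
  T.comp (-1) (C.curvature (σ (C.toB₀ u)) X Y)

/-- The Weyl curvature `W`: the component of `σ^*κ = T + W + Y` with values in `𝔤₀`. For each
`u` it is a skew bilinear map on `𝔤₋₁` with values in `𝔤₀`. -/
def weylCurvature (σ : C.B₀ → B) (u : B) (X Y : Lie𝔤 (EG := EG) G) : Lie𝔤 (EG := EG) G :=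
  T.comp 0 (C.curvature (σ (C.toB₀ u)) X Y)

/-- The covariant derivative of the Weyl curvature (a section of the bundle associated with the
`G₀`-module `Λ²𝔤₋₁* ⊗ 𝔤₀`) for the connection induced by the Weyl connection `γ`, in frame form:
`(∇_v W)(X, Y) = (dW(v))(X, Y) + (γ(v)·W)(X, Y)`, with the action
`(A·W)(X, Y) = [A, W(X, Y)] - W([A, X], Y) - W(X, [A, Y])` of `A ∈ 𝔤₀`. -/
def nablaWeylCurvature (σ : C.B₀ → B) (u : B) (v : TangentSpace 𝓘(ℝ, EB) u)
    (X Y : Lie𝔤 (EG := EG) G) : Lie𝔤 (EG := EG) G :=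
  ofVec (EG := EG)
      (mfderiv 𝓘(ℝ, EB) 𝓘(ℝ, EG) (fun b => toVec (C.weylCurvature σ b X Y)) u v)
    + (⁅C.weylConnection σ u v, C.weylCurvature σ u X Y⁆
      - C.weylCurvature σ u ⁅C.weylConnection σ u v, X⁆ Y
      - C.weylCurvature σ u X ⁅C.weylConnection σ u v, Y⁆)

/-- The Weyl connection of `σ` is torsion-free. -/
def WeylTorsionFree (σ : C.B₀ → B) : Prop :=
  ∀ (u : B) (v w : TangentSpace 𝓘(ℝ, EB) u), C.weylTorsionForm σ u v w = 0

/-- The Weyl curvature is parallel: it is differentiable and `∇W = 0`. -/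
def WeylCurvatureParallel (σ : C.B₀ → B) : Prop :=
  ∀ X ∈ T.gr (-1), ∀ Y ∈ T.gr (-1),
    MDifferentiable 𝓘(ℝ, EB) 𝓘(ℝ, EG) (fun b => toVec (C.weylCurvature σ b X Y)) ∧
    ∀ (u : B) (v : TangentSpace 𝓘(ℝ, EB) u), C.nablaWeylCurvature σ u v X Y = 0

end Geometry

end OneGraded

end

/-! Each symmetry carries information only at its center, but the quantities in question are
determined pointwise by the Cartan geometry, so this suffices.

Let `u = σ(π(u))` lie over `x`, and let `φ` cover `s_x`. Then `φ(u)` lies in the fiber of `u`, so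
`φ(u) = u·p`. Writing `p = g q` with `g ∈ G₀`, `q ∈ P₊`, invariance and equivariance of the Weyl
structure force `φ(u) = u·g`. Comparing `Tφ` with right translation by `g`, the condition `T_x s_x =
-id` says that `Ad(g⁻¹)` is `-1` on `𝔤/𝔭` (`IsSymmetryAt.add_Ad_mem`). Since it preserves the
grading, it is `-1` on `𝔤₋₁`; infinitesimal effectivity makes `𝔤₀` act faithfully on `𝔤₋₁`, so it is
`1` on `𝔤₀`. This is `exists_reflectsAt`.

The curvature function is `φ`-invariant and `P`-equivariant. For `X, Y ∈ 𝔤₋₁` the two signs of the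
arguments cancel, whereas a value in `𝔤₋₁` changes sign: hence `T = -T`. With `T = 0`, the
`𝔤₋₁`-component of the pulled-back structure equation is the torsion-freeness of the Weyl
connection.

For `∇W`, the function `κ₀(X, Y)` on the total space, the `𝔤₀`-part of `κ(X, Y)`, is invariant under
both `φ` and right translation by `g`, while the tangent maps of the two send `ω_u⁻¹(Z)`, `Z ∈ 𝔤₋₁`,
to opposite vectors. So its derivative in that direction vanishes (`vecDeriv_kappaZero_eq_zero`).
Vertical derivatives are given by equivariance (`vecDeriv_kappa_fundamental`). Along a vector with
`𝔤₀`-component `A` they contribute `-A·W`; the `𝔤₁`-component contributes nothing because `κ` is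
horizontal and `T = 0`. Differentiating `W = κ₀ ∘ σ` therefore gives `∇W = 0`. No derivative of the
family of symmetries enters.

Two general ingredients have to be supplied. One is the calculus of one-forms (`extD_pullback`,
`extD_two_parameters`), which yields the Maurer-Cartan equation, the derivative of `Ad` and the
horizontality of the curvature. The other is the decomposition `P = G₀ P₊`
(`exists_mul_mem_G₀_Pplus`), proved with the grading element and one-parameter subgroups. -/

noncomputable section

namespace OneGraded

open Filter Topology

/-! ### One-forms in charts; the exterior derivative commutes with pull-back. -/

section PullBack

variable {EN : Type*} [NormedAddCommGroup EN] [NormedSpace ℝ EN]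
  {N : Type*} [TopologicalSpace N] [ChartedSpace EN N]
  {EB : Type*} [NormedAddCommGroup EB] [NormedSpace ℝ EB]
  {B : Type*} [TopologicalSpace B] [ChartedSpace EB B]
  {V : Type*} [NormedAddCommGroup V] [NormedSpace ℝ V]
  {V' : Type*} [NormedAddCommGroup V'] [NormedSpace ℝ V']

/-- The expression of a one-form in the preferred chart at `u`. -/
def chartForm (α : ∀ u : B, TangentSpace 𝓘(ℝ, EB) u →L[ℝ] V) (u : B) (y : EB) : EB →L[ℝ] V :=
  (α ((extChartAt 𝓘(ℝ, EB) u).symm y)).comp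
    (mfderiv 𝓘(ℝ, EB) 𝓘(ℝ, EB) (extChartAt 𝓘(ℝ, EB) u).symm y)

/-- The pull-back of a one-form. -/
def pullbackForm (f : N → B) (α : ∀ u : B, TangentSpace 𝓘(ℝ, EB) u →L[ℝ] V) (x : N) :
    TangentSpace 𝓘(ℝ, EN) x →L[ℝ] V :=
  (α (f x)).comp (mfderiv 𝓘(ℝ, EN) 𝓘(ℝ, EB) f x)

/-- Smoothness of a one-form at a point, in terms of its expression in the preferred chart. -/
def SmoothFormAt (α : ∀ u : B, TangentSpace 𝓘(ℝ, EB) u →L[ℝ] V) (u : B) : Prop :=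
  ContDiffAt ℝ ∞ (chartForm α u) (extChartAt 𝓘(ℝ, EB) u u)

theorem coeffInChart_eq (α : ∀ u : B, TangentSpace 𝓘(ℝ, EB) u →L[ℝ] V) (u : B) (w : EB) :
    coeffInChart (fun b z => α b z) u w = fun y => chartForm α u y w := rfl

theorem SmoothFormAt.differentiableAt {α : ∀ u : B, TangentSpace 𝓘(ℝ, EB) u →L[ℝ] V} {u : B}
    (h : SmoothFormAt α u) :
    DifferentiableAt ℝ (chartForm α u) (extChartAt 𝓘(ℝ, EB) u u) :=
  ContDiffAt.differentiableAt h (by simp)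

/-- Differentiating the operator-valued coefficient as a whole, and not vector by vector, makes
bilinearity visible and lets the product rule be applied to `α(f) ∘ Df`. -/
theorem extD_eq {α : ∀ u : B, TangentSpace 𝓘(ℝ, EB) u →L[ℝ] V} {u : B}
    (h : SmoothFormAt α u) (v w : EB) :
    extD (fun b z => α b z) u v w =
      fderiv ℝ (chartForm α u) (extChartAt 𝓘(ℝ, EB) u u) v w
        - fderiv ℝ (chartForm α u) (extChartAt 𝓘(ℝ, EB) u u) w v := by
  unfold extD
  rw [coeffInChart_eq, coeffInChart_eq]
  have h1 : ∀ w : EB, fderiv ℝ (fun y => chartForm α u y w) (extChartAt 𝓘(ℝ, EB) u u) =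
      (fderiv ℝ (chartForm α u) (extChartAt 𝓘(ℝ, EB) u u)).flip w := by
    intro w
    rw [fderiv_clm_apply h.differentiableAt (differentiableAt_const w)]
    ext z
    simp
  rw [h1, h1]
  rfl

/-- In the charts, the pull-back of `α` is `α(f)∘Df`. -/
theorem chartForm_pullbackForm [IsManifold 𝓘(ℝ, EN) ∞ N] [IsManifold 𝓘(ℝ, EB) ∞ B]
    (α : ∀ u : B, TangentSpace 𝓘(ℝ, EB) u →L[ℝ] V) {f : N → B}
    {x : N} (hf : ContMDiffAt 𝓘(ℝ, EN) 𝓘(ℝ, EB) ∞ f x) :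
    chartForm (pullbackForm f α) x =ᶠ[𝓝 (extChartAt 𝓘(ℝ, EN) x x)] fun y =>
      (chartForm α (f x) (writtenInExtChartAt 𝓘(ℝ, EN) 𝓘(ℝ, EB) x f y)).comp
        (fderiv ℝ (writtenInExtChartAt 𝓘(ℝ, EN) 𝓘(ℝ, EB) x f) y) := by
  have : IsManifold 𝓘(ℝ, EN) 1 N := .of_le (n := ∞) (by simp)
  have : IsManifold 𝓘(ℝ, EB) 1 B := .of_le (n := ∞) (by simp)
  set ψ := extChartAt 𝓘(ℝ, EN) x
  set χ := extChartAt 𝓘(ℝ, EB) (f x)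
  have hcont : ContinuousAt ψ.symm (ψ x) := continuousAt_extChartAt_symm x
  have hx : ψ.symm (ψ x) = x := extChartAt_to_inv x
  have e1 : ∀ᶠ y in 𝓝 (ψ x), y ∈ ψ.target := extChartAt_target_mem_nhds x
  have e2 : ∀ᶠ y in 𝓝 (ψ x), f (ψ.symm y) ∈ χ.source := by
    have : ContinuousAt (f ∘ ψ.symm) (ψ x) := by
      apply ContinuousAt.comp _ hcont
      rw [hx]; exact hf.continuousAt
    apply this.preimage_mem_nhds
    rw [Function.comp_apply, hx]
    exact extChartAt_source_mem_nhds (f x)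
  have e3 : ∀ᶠ y in 𝓝 (ψ x), ContMDiffAt 𝓘(ℝ, EN) 𝓘(ℝ, EB) 1 f (ψ.symm y) := by
    apply hcont.eventually
    rw [hx]
    exact (contMDiffAt_iff_contMDiffAt_nhds (by simp)).1 (hf.of_le (by simp))
  filter_upwards [e1.eventually_nhds, e2.eventually_nhds, e3] with y h1 h2 h3
  have hψ : MDifferentiableAt 𝓘(ℝ, EN) 𝓘(ℝ, EN) ψ.symm y :=
    ((contMDiffOn_extChartAt_symm (n := ∞) x).contMDiffAt
      (by exact h1)).mdifferentiableAt (by simp)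
  have hfd : MDifferentiableAt 𝓘(ℝ, EN) 𝓘(ℝ, EB) f (ψ.symm y) := h3.mdifferentiableAt (by simp)
  have hχt : χ (f (ψ.symm y)) ∈ χ.target := χ.map_source h2.self_of_nhds
  have hχ : MDifferentiableAt 𝓘(ℝ, EB) 𝓘(ℝ, EB) χ.symm (χ (f (ψ.symm y))) :=
    ((contMDiffOn_extChartAt_symm (n := ∞) (f x)).contMDiffAt
      ((isOpen_extChartAt_target (f x)).mem_nhds hχt)).mdifferentiableAt (by simp)
  have hχ' : MDifferentiableAt 𝓘(ℝ, EB) 𝓘(ℝ, EB) χ (f (ψ.symm y)) :=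
    mdifferentiableAt_extChartAt (by simpa [χ] using h2.self_of_nhds)
  have hw : MDifferentiableAt 𝓘(ℝ, EN) 𝓘(ℝ, EB)
      (writtenInExtChartAt 𝓘(ℝ, EN) 𝓘(ℝ, EB) x f) y := hχ'.comp y (hfd.comp y hψ)
  -- Both sides of this local identity are differentiated by the chain rule; this compares `Df ∘
  -- Dψ⁻¹` with `Dχ⁻¹ ∘ Dg`, where `g` is `f` written in charts.
  have heq : f ∘ ψ.symm =ᶠ[𝓝 y] χ.symm ∘ (writtenInExtChartAt 𝓘(ℝ, EN) 𝓘(ℝ, EB) x f) := by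
    filter_upwards [h2] with z hz
    exact (χ.left_inv hz).symm
  have hpt : f (ψ.symm y) = χ.symm (writtenInExtChartAt 𝓘(ℝ, EN) 𝓘(ℝ, EB) x f y) :=
    heq.self_of_nhds
  have hd := heq.mfderiv_eq (I := 𝓘(ℝ, EN)) (I' := 𝓘(ℝ, EB))
  rw [mfderiv_comp y hfd hψ, mfderiv_comp y hχ hw, mfderiv_eq_fderiv] at hd
  -- All tangent spaces are definitionally the model space, so the base point of `α` may be changed
  -- while the vector is kept.
  have h4 : ∀ b b' : B, b = b' → ∀ z : EB, (α b : EB →L[ℝ] V) z = (α b' : EB →L[ℝ] V) z := by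
    rintro b _ rfl _; rfl
  refine ContinuousLinearMap.ext fun v => ?_
  exact (h4 _ _ hpt _).trans (congrArg (fun z : EB => (α (χ.symm _) : EB →L[ℝ] V) z)
    (congrArg (fun L : EN →L[ℝ] EB => L v) hd))

theorem contDiffAt_writtenInExtChartAt {f : N → B} {x : N}
    (hf : ContMDiffAt 𝓘(ℝ, EN) 𝓘(ℝ, EB) ∞ f x) :
    ContDiffAt ℝ ∞ (writtenInExtChartAt 𝓘(ℝ, EN) 𝓘(ℝ, EB) x f) (extChartAt 𝓘(ℝ, EN) x x) := by
  have := (contMDiffAt_iff.1 hf).2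
  simp only [modelWithCornersSelf_coe, Set.range_id, contDiffWithinAt_univ] at this
  exact this

theorem writtenInExtChartAt_self (f : N → B) (x : N) :
    writtenInExtChartAt 𝓘(ℝ, EN) 𝓘(ℝ, EB) x f (extChartAt 𝓘(ℝ, EN) x x) =
      extChartAt 𝓘(ℝ, EB) (f x) (f x) := by
  simp [writtenInExtChartAt]

theorem mfderiv_eq_fderiv_written {f : N → B} {x : N}
    (hf : MDifferentiableAt 𝓘(ℝ, EN) 𝓘(ℝ, EB) f x) (v : EN) :
    (mfderiv 𝓘(ℝ, EN) 𝓘(ℝ, EB) f x : EN → EB) v =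
      fderiv ℝ (writtenInExtChartAt 𝓘(ℝ, EN) 𝓘(ℝ, EB) x f) (extChartAt 𝓘(ℝ, EN) x x) v := by
  rw [hf.mfderiv]
  simp only [modelWithCornersSelf_coe, Set.range_id, fderivWithin_univ]
  rfl

variable [IsManifold 𝓘(ℝ, EN) ∞ N] [IsManifold 𝓘(ℝ, EB) ∞ B]
  {α : ∀ u : B, TangentSpace 𝓘(ℝ, EB) u →L[ℝ] V}

theorem SmoothFormAt.pullback {f : N → B} {x : N} (hα : SmoothFormAt α (f x))
    (hf : ContMDiffAt 𝓘(ℝ, EN) 𝓘(ℝ, EB) ∞ f x) : SmoothFormAt (pullbackForm (EN := EN) f α) x := by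
  have h0 := chartForm_pullbackForm α hf
  refine ContDiffAt.congr_of_eventuallyEq ?_ h0
  have h1 := contDiffAt_writtenInExtChartAt hf
  have h2 : ContDiffAt ℝ ∞ (chartForm α (f x))
      (writtenInExtChartAt 𝓘(ℝ, EN) 𝓘(ℝ, EB) x f (extChartAt 𝓘(ℝ, EN) x x)) := by
    rw [writtenInExtChartAt_self]
    exact hα
  exact (h2.comp _ h1).clm_comp (h1.fderiv_right (by simp))

/-- The exterior derivative commutes with pull-backs. -/
theorem extD_pullback {f : N → B} {x : N} (hα : SmoothFormAt α (f x))
    (hf : ContMDiffAt 𝓘(ℝ, EN) 𝓘(ℝ, EB) ∞ f x) (v w : TangentSpace 𝓘(ℝ, EN) x) :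
    extD (fun y z => pullbackForm (EN := EN) f α y z) x v w =
      extD (fun b z => α b z) (f x) (mfderiv 𝓘(ℝ, EN) 𝓘(ℝ, EB) f x v)
        (mfderiv 𝓘(ℝ, EN) 𝓘(ℝ, EB) f x w) := by
  set g := writtenInExtChartAt 𝓘(ℝ, EN) 𝓘(ℝ, EB) x f with hgdef
  set y := extChartAt 𝓘(ℝ, EN) x x with hydef
  have hg : ContDiffAt ℝ ∞ g y := contDiffAt_writtenInExtChartAt hf
  have hgy : g y = extChartAt 𝓘(ℝ, EB) (f x) (f x) := writtenInExtChartAt_self f x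
  have hA : DifferentiableAt ℝ (chartForm α (f x)) (g y) := by
    rw [hgy]; exact hα.differentiableAt
  have hg1 : DifferentiableAt ℝ g y := hg.differentiableAt (by simp)
  have hg2 : DifferentiableAt ℝ (fderiv ℝ g) y :=
    (hg.fderiv_right (m := 1)
      (by rw [one_add_one_eq_two]; exact ENat.LEInfty.out)).differentiableAt (by simp)
  have hsym : IsSymmSndFDerivAt ℝ g y := hg.isSymmSndFDerivAt
    (by simpa using ENat.LEInfty.out)
  -- The product rule for `α(g) ∘ Dg` produces an extra term containing `D²g(v, w)`; it is symmetric
  -- and disappears on antisymmetrizing.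
  have key : ∀ v w : EN, fderiv ℝ (chartForm (pullbackForm f α) x) y v w =
      fderiv ℝ (chartForm α (f x)) (extChartAt 𝓘(ℝ, EB) (f x) (f x))
        (fderiv ℝ g y v) (fderiv ℝ g y w)
        + chartForm α (f x) (g y) (fderiv ℝ (fderiv ℝ g) y v w) := by
    intro v w
    have h1 : HasFDerivAt (fun y => chartForm α (f x) (g y)) _ y :=
      hA.hasFDerivAt.comp y hg1.hasFDerivAt
    rw [(chartForm_pullbackForm α hf).fderiv_eq, (h1.clm_comp hg2.hasFDerivAt).fderiv, hgy]
    simp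
    abel
  have hd := hf.mdifferentiableAt (by simp)
  refine (extD_eq (hα.pullback hf) v w).trans (Eq.trans ?_ ((extD_eq hα _ _).trans
    (congrArg₂ (fun a b : EB => fderiv ℝ (chartForm α (f x)) (extChartAt 𝓘(ℝ, EB) (f x) (f x)) a b
      - fderiv ℝ (chartForm α (f x)) (extChartAt 𝓘(ℝ, EB) (f x) (f x)) b a)
    (mfderiv_eq_fderiv_written hd v) (mfderiv_eq_fderiv_written hd w))).symm)
  have core : ∀ v w : EN, fderiv ℝ (chartForm (pullbackForm f α) x) y v w
      - fderiv ℝ (chartForm (pullbackForm f α) x) y w v =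
      fderiv ℝ (chartForm α (f x)) (extChartAt 𝓘(ℝ, EB) (f x) (f x))
        (fderiv ℝ g y v) (fderiv ℝ g y w) -
      fderiv ℝ (chartForm α (f x)) (extChartAt 𝓘(ℝ, EB) (f x) (f x))
        (fderiv ℝ g y w) (fderiv ℝ g y v) := by
    intro v w
    rw [key, key, hsym.eq v w]
    abel
  exact core v w

end PullBack

/-! ### Forms on vector spaces, linear operations, curves and two-parameter surfaces. -/

section VectorSpace

variable {E : Type*} [NormedAddCommGroup E] [NormedSpace ℝ E]
  {V : Type*} [NormedAddCommGroup V] [NormedSpace ℝ V]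

/-- A one-form as a function with values in the linear maps on the model space. -/
def formAt {B : Type*} [TopologicalSpace B] [ChartedSpace E B]
    (α : ∀ u : B, TangentSpace 𝓘(ℝ, E) u →L[ℝ] V) (u : B) : E →L[ℝ] V := α u

theorem chartForm_vectorSpace (β : ∀ x : E, TangentSpace 𝓘(ℝ, E) x →L[ℝ] V) (x : E) :
    chartForm β x = formAt β := by
  funext y
  refine ContinuousLinearMap.ext fun v => ?_
  have h0 : ((extChartAt 𝓘(ℝ, E) x).symm : E → E) = id := by
    simp only [extChartAt_model_space_eq_id, PartialEquiv.refl_symm, PartialEquiv.refl_coe]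
  have h : (mfderiv 𝓘(ℝ, E) 𝓘(ℝ, E) (extChartAt 𝓘(ℝ, E) x).symm y : E →L[ℝ] E) =
      ContinuousLinearMap.id ℝ E := by
    rw [h0]
    exact mfderiv_id
  exact congrArg (fun L : E →L[ℝ] E => (β y : E →L[ℝ] V) (L v)) h

theorem extD_vectorSpace {β : ∀ x : E, TangentSpace 𝓘(ℝ, E) x →L[ℝ] V} {x : E}
    (h : SmoothFormAt β x) (v w : E) :
    extD (fun b z => β b z) x v w =
      fderiv ℝ (formAt β) x v w - fderiv ℝ (formAt β) x w v := by
  have := extD_eq h v w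
  rw [chartForm_vectorSpace] at this
  exact this

theorem smoothFormAt_vectorSpace_iff {β : ∀ x : E, TangentSpace 𝓘(ℝ, E) x →L[ℝ] V} {x : E} :
    SmoothFormAt β x ↔ ContDiffAt ℝ ∞ (formAt β) x := by
  unfold SmoothFormAt
  rw [chartForm_vectorSpace]
  rfl

end VectorSpace

section Linear

variable {EB : Type*} [NormedAddCommGroup EB] [NormedSpace ℝ EB]
  {B : Type*} [TopologicalSpace B] [ChartedSpace EB B]
  {V : Type*} [NormedAddCommGroup V] [NormedSpace ℝ V]
  {V' : Type*} [NormedAddCommGroup V'] [NormedSpace ℝ V']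

theorem SmoothFormAt.clm_comp {α : ∀ u : B, TangentSpace 𝓘(ℝ, EB) u →L[ℝ] V} {u : B}
    (h : SmoothFormAt α u) (L : V →L[ℝ] V') : SmoothFormAt (fun b => L.comp (α b)) u :=
  ContDiffAt.clm_comp (g := fun _ => L) (f := chartForm α u) contDiffAt_const h

theorem extD_clm_comp {α : ∀ u : B, TangentSpace 𝓘(ℝ, EB) u →L[ℝ] V} {u : B}
    (h : SmoothFormAt α u) (L : V →L[ℝ] V') (v w : TangentSpace 𝓘(ℝ, EB) u) :
    extD (fun b z => L (α b z)) u v w = L (extD (fun b z => α b z) u v w) := by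
  have h1 : ∀ w : EB, fderiv ℝ (fun y => L (chartForm α u y w)) (extChartAt 𝓘(ℝ, EB) u u) =
      L.comp (fderiv ℝ (fun y => chartForm α u y w) (extChartAt 𝓘(ℝ, EB) u u)) := fun w =>
    (L.hasFDerivAt.comp _ (h.differentiableAt.clm_apply
      (differentiableAt_const w)).hasFDerivAt).fderiv
  have h2 : ∀ v w : EB, extD (fun b z => L (α b z)) u v w =
      L (extD (fun b z => α b z) u v w) := by
    intro v w
    refine (congrArg₂ (fun (a b : EB →L[ℝ] V') => a v - b w) (h1 w) (h1 v)).trans ?_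
    exact (map_sub L _ _).symm
  exact h2 v w

/-- The exterior derivative at a point as a bilinear map. -/
def extDLin (α : ∀ u : B, TangentSpace 𝓘(ℝ, EB) u →L[ℝ] V) (u : B) : EB →L[ℝ] EB →L[ℝ] V :=
  fderiv ℝ (chartForm α u) (extChartAt 𝓘(ℝ, EB) u u)
    - (fderiv ℝ (chartForm α u) (extChartAt 𝓘(ℝ, EB) u u)).flip

theorem extD_eq_extDLin {α : ∀ u : B, TangentSpace 𝓘(ℝ, EB) u →L[ℝ] V} {u : B}
    (h : SmoothFormAt α u) (v w : EB) : extD (fun b z => α b z) u v w = extDLin α u v w :=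
  extD_eq h v w

end Linear

section Curves

variable {EB : Type*} [NormedAddCommGroup EB] [NormedSpace ℝ EB]
  {B : Type*} [TopologicalSpace B] [ChartedSpace EB B] [IsManifold 𝓘(ℝ, EB) ∞ B]

/-- A straight line in the preferred chart at `u` works: that chart is the one identifying the
tangent space at `u` with the model space. -/
theorem exists_curve (u : B) (v : EB) :
    ∃ γ : ℝ → B, ContMDiffAt 𝓘(ℝ, ℝ) 𝓘(ℝ, EB) ∞ γ 0 ∧ γ 0 = u ∧
      (mfderiv 𝓘(ℝ, ℝ) 𝓘(ℝ, EB) γ 0 : ℝ → EB) 1 = v := by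
  set ψ := extChartAt 𝓘(ℝ, EB) u with hψ
  have h0 : ψ u + (0 : ℝ) • v = ψ u := by simp
  have hl : ContDiff ℝ ∞ (fun t : ℝ => ψ u + t • v) := by fun_prop
  have hs : ContMDiffAt 𝓘(ℝ, EB) 𝓘(ℝ, EB) ∞ ψ.symm (ψ u + (0 : ℝ) • v) := by
    rw [h0]
    exact (contMDiffOn_extChartAt_symm u).contMDiffAt (extChartAt_target_mem_nhds u)
  have hc : ContMDiffAt 𝓘(ℝ, ℝ) 𝓘(ℝ, EB) ∞ (fun t : ℝ => ψ.symm (ψ u + t • v)) 0 :=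
    hs.comp (0 : ℝ) hl.contMDiff.contMDiffAt
  have hu : ψ.symm (ψ u + (0 : ℝ) • v) = u := by rw [h0]; exact extChartAt_to_inv u
  refine ⟨fun t => ψ.symm (ψ u + t • v), hc, hu, ?_⟩
  refine (mfderiv_eq_fderiv_written (hc.mdifferentiableAt (by simp)) 1).trans ?_
  have he : writtenInExtChartAt 𝓘(ℝ, ℝ) 𝓘(ℝ, EB) 0 (fun t : ℝ => ψ.symm (ψ u + t • v)) =ᶠ[𝓝 0]
      fun t : ℝ => ψ u + t • v := by
    have : ∀ᶠ t : ℝ in 𝓝 0, ψ u + t • v ∈ ψ.target := by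
      apply hl.continuous.continuousAt.preimage_mem_nhds
      rw [h0]
      exact extChartAt_target_mem_nhds u
    filter_upwards [this] with t ht
    simp only [writtenInExtChartAt, hu, extChartAt_model_space_eq_id, PartialEquiv.refl_symm,
      PartialEquiv.refl_coe, Function.comp_apply, id]
    exact ψ.right_inv ht
  have h3 : extChartAt 𝓘(ℝ, ℝ) (0 : ℝ) 0 = 0 := by rw [extChartAt_model_space_eq_id]; rfl
  rw [h3, he.fderiv_eq]
  have : HasDerivAt (fun t : ℝ => ψ u + t • v) v 0 := by
    simpa using ((hasDerivAt_id (0 : ℝ)).smul_const v).const_add (ψ u)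
  exact this.deriv

end Curves

section TwoParameters

variable {E₁ : Type*} [NormedAddCommGroup E₁] [NormedSpace ℝ E₁]
  {B₁ : Type*} [TopologicalSpace B₁] [ChartedSpace E₁ B₁]
  {E₂ : Type*} [NormedAddCommGroup E₂] [NormedSpace ℝ E₂]
  {B₂ : Type*} [TopologicalSpace B₂] [ChartedSpace E₂ B₂]
  {EB : Type*} [NormedAddCommGroup EB] [NormedSpace ℝ EB]
  {B : Type*} [TopologicalSpace B] [ChartedSpace EB B] [IsManifold 𝓘(ℝ, EB) ∞ B]
  {V : Type*} [NormedAddCommGroup V] [NormedSpace ℝ V]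

/-- The exterior derivative evaluated on the partial derivatives of `F (γ s, c t)`. -/
theorem extD_two_parameters {F : B₁ → B₂ → B}
    (hF : ContMDiff (𝓘(ℝ, E₁).prod 𝓘(ℝ, E₂)) 𝓘(ℝ, EB) ∞ (fun z : B₁ × B₂ => F z.1 z.2))
    {α : ∀ u : B, TangentSpace 𝓘(ℝ, EB) u →L[ℝ] V} {γ : ℝ → B₁} {c : ℝ → B₂}
    (hα : SmoothFormAt α (F (γ 0) (c 0)))
    (hγ : ContMDiffAt 𝓘(ℝ, ℝ) 𝓘(ℝ, E₁) ∞ γ 0) (hc : ContMDiffAt 𝓘(ℝ, ℝ) 𝓘(ℝ, E₂) ∞ c 0) :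
    ∃ a b : V,
      HasDerivAt (fun s => α (F (γ s) (c 0)) (mfderiv 𝓘(ℝ, E₂) 𝓘(ℝ, EB) (fun q => F (γ s) q) (c 0)
        (mfderiv 𝓘(ℝ, ℝ) 𝓘(ℝ, E₂) c 0 (1 : ℝ)))) a 0 ∧
      HasDerivAt (fun t => α (F (γ 0) (c t)) (mfderiv 𝓘(ℝ, E₁) 𝓘(ℝ, EB) (fun q => F q (c t)) (γ 0)
        (mfderiv 𝓘(ℝ, ℝ) 𝓘(ℝ, E₁) γ 0 (1 : ℝ)))) b 0 ∧
      extD (fun b z => α b z) (F (γ 0) (c 0))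
        (mfderiv 𝓘(ℝ, E₁) 𝓘(ℝ, EB) (fun q => F q (c 0)) (γ 0)
          (mfderiv 𝓘(ℝ, ℝ) 𝓘(ℝ, E₁) γ 0 (1 : ℝ)))
        (mfderiv 𝓘(ℝ, E₂) 𝓘(ℝ, EB) (fun q => F (γ 0) q) (c 0)
          (mfderiv 𝓘(ℝ, ℝ) 𝓘(ℝ, E₂) c 0 (1 : ℝ))) = a - b := by
  set f : ℝ × ℝ → B := fun z => F (γ z.1) (c z.2) with hf_def
  have h1 : ContMDiff 𝓘(ℝ, ℝ × ℝ) 𝓘(ℝ, ℝ) ∞ (Prod.fst : ℝ × ℝ → ℝ) := contDiff_fst.contMDiff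
  have h2 : ContMDiff 𝓘(ℝ, ℝ × ℝ) 𝓘(ℝ, ℝ) ∞ (Prod.snd : ℝ × ℝ → ℝ) := contDiff_snd.contMDiff
  have hf : ContMDiffAt 𝓘(ℝ, ℝ × ℝ) 𝓘(ℝ, EB) ∞ f (0, 0) := by
    have e1 : ContMDiffAt 𝓘(ℝ, ℝ × ℝ) 𝓘(ℝ, E₁) ∞ (γ ∘ Prod.fst) ((0, 0) : ℝ × ℝ) :=
      ContMDiffAt.comp _ hγ h1.contMDiffAt
    have e2 : ContMDiffAt 𝓘(ℝ, ℝ × ℝ) 𝓘(ℝ, E₂) ∞ (c ∘ Prod.snd) ((0, 0) : ℝ × ℝ) :=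
      ContMDiffAt.comp _ hc h2.contMDiffAt
    exact hF.contMDiffAt.comp _ (e1.prodMk e2)
  have hev : ∀ᶠ z in 𝓝 ((0, 0) : ℝ × ℝ), MDifferentiableAt 𝓘(ℝ, ℝ × ℝ) 𝓘(ℝ, EB) f z := by
    have : IsManifold 𝓘(ℝ, EB) 1 B := .of_le (n := ∞) (by simp)
    filter_upwards [(contMDiffAt_iff_contMDiffAt_nhds (n := 1) (by simp)).1
      (hf.of_le (by simp))] with z hz
    exact hz.mdifferentiableAt (by simp)
  have hi1 : ∀ t : ℝ, HasMFDerivAt 𝓘(ℝ, ℝ) 𝓘(ℝ, ℝ × ℝ) (fun s : ℝ => (s, t)) 0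
      (ContinuousLinearMap.inl ℝ ℝ ℝ) := fun t => by
    exact (hasFDerivAt_prodMk_left (𝕜 := ℝ) (0 : ℝ) t).hasMFDerivAt
  have hi2 : ∀ s : ℝ, HasMFDerivAt 𝓘(ℝ, ℝ) 𝓘(ℝ, ℝ × ℝ) (fun t : ℝ => (s, t)) 0
      (ContinuousLinearMap.inr ℝ ℝ ℝ) := fun s => by
    exact (hasFDerivAt_prodMk_right (𝕜 := ℝ) s (0 : ℝ)).hasMFDerivAt
  have hF1 : ∀ q : B₂, MDifferentiable 𝓘(ℝ, E₁) 𝓘(ℝ, EB) (fun p => F p q) := fun q =>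
    (hF.comp (contMDiff_id.prodMk contMDiff_const)).mdifferentiable (by simp)
  have hF2 : ∀ p : B₁, MDifferentiable 𝓘(ℝ, E₂) 𝓘(ℝ, EB) (fun q => F p q) := fun p =>
    (hF.comp (contMDiff_const.prodMk contMDiff_id)).mdifferentiable (by simp)
  have d1 : ∀ t : ℝ, MDifferentiableAt 𝓘(ℝ, ℝ × ℝ) 𝓘(ℝ, EB) f (0, t) →
      (mfderiv 𝓘(ℝ, ℝ × ℝ) 𝓘(ℝ, EB) f (0, t) : ℝ × ℝ → EB) (1, 0) =
      (mfderiv 𝓘(ℝ, E₁) 𝓘(ℝ, EB) (fun q => F q (c t)) (γ 0)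
        (mfderiv 𝓘(ℝ, ℝ) 𝓘(ℝ, E₁) γ 0 (1 : ℝ)) : EB) := by
    intro t ht
    have e1 := HasMFDerivAt.comp (0 : ℝ) ht.hasMFDerivAt (hi1 t)
    have e2 := HasMFDerivAt.comp (0 : ℝ) (hF1 (c t) (γ 0)).hasMFDerivAt
      (hγ.mdifferentiableAt (by simp)).hasMFDerivAt
    exact congrArg (fun L : ℝ →L[ℝ] EB => L 1) (hasMFDerivAt_unique e1 e2)
  have d2 : ∀ s : ℝ, MDifferentiableAt 𝓘(ℝ, ℝ × ℝ) 𝓘(ℝ, EB) f (s, 0) →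
      (mfderiv 𝓘(ℝ, ℝ × ℝ) 𝓘(ℝ, EB) f (s, 0) : ℝ × ℝ → EB) (0, 1) =
      (mfderiv 𝓘(ℝ, E₂) 𝓘(ℝ, EB) (fun q => F (γ s) q) (c 0)
        (mfderiv 𝓘(ℝ, ℝ) 𝓘(ℝ, E₂) c 0 (1 : ℝ)) : EB) := by
    intro s hs
    have e1 := HasMFDerivAt.comp (0 : ℝ) hs.hasMFDerivAt (hi2 s)
    have e2 := HasMFDerivAt.comp (0 : ℝ) (hF2 (γ s) (c 0)).hasMFDerivAt
      (hc.mdifferentiableAt (by simp)).hasMFDerivAt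
    exact congrArg (fun L : ℝ →L[ℝ] EB => L 1) (hasMFDerivAt_unique e1 e2)
  -- On the plane, `dβ(∂ₛ, ∂ₜ) = ∂ₛ(β(∂ₜ)) - ∂ₜ(β(∂ₛ))`. The two derivatives are the numbers `a` and
  -- `b`, and naturality of `d` transports the identity to the manifold.
  set β := pullbackForm (EN := ℝ × ℝ) f α with hβ
  have hβs : SmoothFormAt β (0, 0) := SmoothFormAt.pullback hα hf
  have hβd : DifferentiableAt ℝ (formAt β) (0, 0) :=
    (smoothFormAt_vectorSpace_iff.1 hβs).differentiableAt (by simp)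
  set D := fderiv ℝ (formAt β) (0, 0) with hD
  have l1 : HasDerivAt (fun s : ℝ => ((s, 0) : ℝ × ℝ)) (1, 0) 0 := by
    simpa using (hasDerivAt_id (0 : ℝ)).prodMk (hasDerivAt_const (0 : ℝ) (0 : ℝ))
  have l2 : HasDerivAt (fun s : ℝ => ((0, s) : ℝ × ℝ)) (0, 1) 0 := by
    simpa using (hasDerivAt_const (0 : ℝ) (0 : ℝ)).prodMk (hasDerivAt_id (0 : ℝ))
  have a1 : HasDerivAt (fun s : ℝ => formAt β (s, 0) (0, 1)) (D (1, 0) (0, 1)) 0 := by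
    have := (HasFDerivAt.comp_hasDerivAt (f := fun s : ℝ => ((s, 0) : ℝ × ℝ)) (0 : ℝ)
      hβd.hasFDerivAt l1).clm_apply
      (hasDerivAt_const (0 : ℝ) ((0, 1) : ℝ × ℝ))
    simpa using this
  have a2 : HasDerivAt (fun t : ℝ => formAt β (0, t) (1, 0)) (D (0, 1) (1, 0)) 0 := by
    have := (HasFDerivAt.comp_hasDerivAt (f := fun s : ℝ => ((0, s) : ℝ × ℝ)) (0 : ℝ)
      hβd.hasFDerivAt l2).clm_apply
      (hasDerivAt_const (0 : ℝ) ((1, 0) : ℝ × ℝ))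
    simpa using this
  refine ⟨D (1, 0) (0, 1), D (0, 1) (1, 0), a1.congr_of_eventuallyEq ?_,
    a2.congr_of_eventuallyEq ?_, ?_⟩
  · filter_upwards [l1.continuousAt.eventually hev] with s hs
    exact congrArg (fun z : EB => (α (F (γ s) (c 0)) : EB →L[ℝ] V) z) (d2 s hs).symm
  · filter_upwards [l2.continuousAt.eventually hev] with s hs
    exact congrArg (fun z : EB => (α (F (γ 0) (c s)) : EB →L[ℝ] V) z) (d1 s hs).symm
  · have h4 := extD_vectorSpace hβs ((1, 0) : ℝ × ℝ) ((0, 1) : ℝ × ℝ)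
    rw [← hD] at h4
    rw [← h4]
    refine Eq.trans ?_ (extD_pullback (f := f) (x := ((0, 0) : ℝ × ℝ)) hα hf ((1, 0) : ℝ × ℝ)
      ((0, 1) : ℝ × ℝ)).symm
    have e : ∀ a b a' b' : EB, a = a' → b = b' →
        extD (fun b z => α b z) (F (γ 0) (c 0)) a b =
          extD (fun b z => α b z) (F (γ 0) (c 0)) a' b' := by
      rintro _ _ _ _ rfl rfl; rfl
    have hz : MDifferentiableAt 𝓘(ℝ, ℝ × ℝ) 𝓘(ℝ, EB) f (0, 0) := hev.self_of_nhds
    exact e _ _ _ _ (d1 0 hz).symm (d2 0 hz).symm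

end TwoParameters

/-! ### Brackets of vector fields read off from one-forms. -/

section LieBracket

variable {EB : Type*} [NormedAddCommGroup EB] [NormedSpace ℝ EB]
  {B : Type*} [TopologicalSpace B] [ChartedSpace EB B] [IsManifold 𝓘(ℝ, EB) ∞ B]
  {V : Type*} [NormedAddCommGroup V] [NormedSpace ℝ V]

theorem mfderiv_extChartAt_symm_self (u : B) (v : EB) :
    (mfderiv 𝓘(ℝ, EB) 𝓘(ℝ, EB) (extChartAt 𝓘(ℝ, EB) u).symm (extChartAt 𝓘(ℝ, EB) u u) :
      EB → EB) v = v := by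
  have : IsManifold 𝓘(ℝ, EB) 1 B := .of_le (n := ∞) (by simp)
  have h := mfderivWithin_range_extChartAt_symm (I := 𝓘(ℝ, EB)) (x := u)
  rw [modelWithCornersSelf_coe, Set.range_id, mfderivWithin_univ] at h
  exact congrArg (fun L : EB →L[ℝ] EB => L v) h

theorem chartForm_self (α : ∀ u : B, TangentSpace 𝓘(ℝ, EB) u →L[ℝ] V) (u : B) :
    chartForm α u (extChartAt 𝓘(ℝ, EB) u u) = formAt α u := by
  refine ContinuousLinearMap.ext fun v => ?_
  have h : ∀ b b' : B, b = b' → ∀ z z' : EB, z = z' → formAt α b z = formAt α b' z' := by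
    rintro b _ rfl z _ rfl; rfl
  exact h _ _ (extChartAt_to_inv u) _ _ (mfderiv_extChartAt_symm_self u v)

/-- A one-form that is constant on two vector fields evaluates on their bracket as minus its
exterior derivative. -/
theorem form_mlieBracket [CompleteSpace EB]
    {α : ∀ u : B, TangentSpace 𝓘(ℝ, EB) u →L[ℝ] V} {u : B}
    (hα : SmoothFormAt α u) {X Y : ∀ u : B, TangentSpace 𝓘(ℝ, EB) u} {a b : V}
    (hX : MDifferentiableAt 𝓘(ℝ, EB) 𝓘(ℝ, EB).tangent
      (fun x => (⟨x, X x⟩ : TangentBundle 𝓘(ℝ, EB) B)) u)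
    (hY : MDifferentiableAt 𝓘(ℝ, EB) 𝓘(ℝ, EB).tangent
      (fun x => (⟨x, Y x⟩ : TangentBundle 𝓘(ℝ, EB) B)) u)
    (ha : ∀ x, α x (X x) = a) (hb : ∀ x, α x (Y x) = b) :
    α u (VectorField.mlieBracket 𝓘(ℝ, EB) X Y u) = - extD (fun b z => α b z) u (X u) (Y u) := by
  have : IsManifold 𝓘(ℝ, EB) 1 B := .of_le (n := ∞) (by simp)
  have : IsManifold 𝓘(ℝ, EB) 2 B := .of_le (n := ∞) ENat.LEInfty.out
  set ψ := extChartAt 𝓘(ℝ, EB) u with hψ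
  set A := chartForm α u with hA
  let hat : (∀ u : B, TangentSpace 𝓘(ℝ, EB) u) → EB → EB := fun X =>
    VectorField.mpullbackWithin 𝓘(ℝ, EB) 𝓘(ℝ, EB) ψ.symm X (Set.range 𝓘(ℝ, EB))
  have hid : ∀ L : EB →L[ℝ] EB, L = ContinuousLinearMap.id ℝ EB → ∀ z, L.inverse z = z := by
    rintro _ rfl z
    rw [ContinuousLinearMap.inverse_id]
    rfl
  have hval : ∀ X, hat X (ψ u) = X u := by
    intro X
    have h1 := mfderivWithin_range_extChartAt_symm (I := 𝓘(ℝ, EB)) (x := u)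
    have h2 : ∀ b : B, b = u → (X b : EB) = X u := by rintro _ rfl; rfl
    exact (hid _ h1 _).trans (h2 _ (extChartAt_to_inv u))
  have hdiff : ∀ X : ∀ u : B, TangentSpace 𝓘(ℝ, EB) u, MDifferentiableAt 𝓘(ℝ, EB) 𝓘(ℝ, EB).tangent
      (fun x => (⟨x, X x⟩ : TangentBundle 𝓘(ℝ, EB) B)) u → DifferentiableAt ℝ (hat X) (ψ u) := by
    intro X hX
    have := (mdifferentiableWithinAt_univ.2 hX).differentiableWithinAt_mpullbackWithin_vectorField
    simp only [Set.preimage_univ, modelWithCornersSelf_coe, Set.range_id, Set.univ_inter] at this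
    simp only [hat, modelWithCornersSelf_coe, Set.range_id]
    exact this.differentiableAt Filter.univ_mem
  have hconst : ∀ (X : ∀ u : B, TangentSpace 𝓘(ℝ, EB) u) (a : V), (∀ x, α x (X x) = a) →
      (fun y => A y (hat X y)) =ᶠ[𝓝 (ψ u)] fun _ => a := by
    intro X a ha
    filter_upwards [extChartAt_target_mem_nhds (I := 𝓘(ℝ, EB)) u] with y hy
    have hinv := isInvertible_mfderivWithin_extChartAt_symm hy
    have h1 : (mfderivWithin 𝓘(ℝ, EB) 𝓘(ℝ, EB) ψ.symm (Set.range 𝓘(ℝ, EB)) y : EB → EB)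
      (hat X y) = X (ψ.symm y) := hinv.self_apply_inverse _
    rw [← ha (ψ.symm y)]
    have h2 : (mfderiv 𝓘(ℝ, EB) 𝓘(ℝ, EB) ψ.symm y : EB → EB)
      (hat X y) = X (ψ.symm y) := by
      rw [← h1, modelWithCornersSelf_coe, Set.range_id, mfderivWithin_univ]
    exact congrArg (formAt α (ψ.symm y)) h2
  -- Differentiating the constant function `A(hat X) = a` trades the derivative of the field for
  -- that of the form. Inserting this into `[X, Y] = DY(X) - DX(Y)` leaves exactly `-dα(X, Y)`.
  have key : ∀ (X : ∀ u : B, TangentSpace 𝓘(ℝ, EB) u) (a : V),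
      MDifferentiableAt 𝓘(ℝ, EB) 𝓘(ℝ, EB).tangent
      (fun x => (⟨x, X x⟩ : TangentBundle 𝓘(ℝ, EB) B)) u → (∀ x, α x (X x) = a) →
      ∀ v x : EB, x = X u → formAt α u (fderiv ℝ (hat X) (ψ u) v) = - fderiv ℝ A (ψ u) v x := by
    rintro X a hX ha v _ rfl
    have h1 := (hα.differentiableAt.hasFDerivAt.clm_apply (hdiff X hX).hasFDerivAt).fderiv
    rw [(hconst X a ha).fderiv_eq] at h1
    have h2 := congrArg (fun L : EB →L[ℝ] V => L v) h1
    simp only [fderiv_fun_const, Pi.zero_apply, zero_apply,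
      add_apply, ContinuousLinearMap.comp_apply,
      ContinuousLinearMap.flip_apply] at h2
    rw [← hψ, hval, ← hA, hA, chartForm_self] at h2
    rw [eq_neg_iff_add_eq_zero]
    exact h2.symm
  have hbr : (VectorField.mlieBracket 𝓘(ℝ, EB) X Y u : EB) =
      fderiv ℝ (hat Y) (ψ u) (X u) - fderiv ℝ (hat X) (ψ u) (Y u) := by
    rw [← VectorField.mlieBracketWithin_univ, VectorField.mlieBracketWithin_apply]
    refine (hid _ (mfderiv_extChartAt_self (I := 𝓘(ℝ, EB)) (x := u)) _).trans ?_
    have h2 : VectorField.lieBracketWithin ℝ (hat X) (hat Y)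
        (ψ.symm ⁻¹' Set.univ ∩ Set.range 𝓘(ℝ, EB)) (ψ u) =
        fderiv ℝ (hat Y) (ψ u) (hat X (ψ u)) - fderiv ℝ (hat X) (ψ u) (hat Y (ψ u)) := by
      rw [Set.preimage_univ, modelWithCornersSelf_coe, Set.range_id, Set.univ_inter,
        VectorField.lieBracketWithin_univ]
      rfl
    rw [hval, hval] at h2
    exact h2
  have fin : ∀ p q : EB, p = X u → q = Y u →
      formAt α u (fderiv ℝ (hat Y) (ψ u) p - fderiv ℝ (hat X) (ψ u) q) =
      - (fderiv ℝ A (ψ u) p q - fderiv ℝ A (ψ u) q p) := by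
    intro p q hp hq
    rw [map_sub, key Y b hY hb p q hq, key X a hX ha q p hp]
    abel
  exact (congrArg (formAt α u) hbr).trans
    ((fin _ _ rfl rfl).trans (congrArg Neg.neg (extD_eq hα _ _).symm))

end LieBracket

/-! ### The Maurer-Cartan form, the Lie bracket and the adjoint action. -/

section LieGroup

variable {EG : Type*} [NormedAddCommGroup EG] [NormedSpace ℝ EG]
  {G : Type*} [TopologicalSpace G] [ChartedSpace EG G] [Group G]

/-- The adjoint action as a continuous linear map of the model space. -/
def AdL (g : G) : EG →L[ℝ] EG :=
  mfderiv 𝓘(ℝ, EG) 𝓘(ℝ, EG) (fun h : G => g * h * g⁻¹) 1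

/-- The left Maurer-Cartan form. -/
def mcForm (g : G) : TangentSpace 𝓘(ℝ, EG) g →L[ℝ] EG :=
  mfderiv 𝓘(ℝ, EG) 𝓘(ℝ, EG) (fun h : G => g⁻¹ * h) g

theorem mfderiv_congr_point {EN : Type*} [NormedAddCommGroup EN] [NormedSpace ℝ EN]
    {N : Type*} [TopologicalSpace N] [ChartedSpace EN N]
    {EB : Type*} [NormedAddCommGroup EB] [NormedSpace ℝ EB]
    {B : Type*} [TopologicalSpace B] [ChartedSpace EB B] {f g : N → B} {x y : N} (hfg : f = g)
    (h : x = y) :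
    (mfderiv 𝓘(ℝ, EN) 𝓘(ℝ, EB) f x : EN →L[ℝ] EB) = mfderiv 𝓘(ℝ, EN) 𝓘(ℝ, EB) g y := by
  subst h hfg; rfl

theorem mfderiv_comp_vec {EN : Type*} [NormedAddCommGroup EN] [NormedSpace ℝ EN]
    {N : Type*} [TopologicalSpace N] [ChartedSpace EN N]
    {EB : Type*} [NormedAddCommGroup EB] [NormedSpace ℝ EB]
    {B : Type*} [TopologicalSpace B] [ChartedSpace EB B]
    {EC : Type*} [NormedAddCommGroup EC] [NormedSpace ℝ EC]
    {C : Type*} [TopologicalSpace C] [ChartedSpace EC C] {f : N → B} {g : B → C} {x : N} {y : B}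
    (hg : MDifferentiableAt 𝓘(ℝ, EB) 𝓘(ℝ, EC) g y)
    (hf : MDifferentiableAt 𝓘(ℝ, EN) 𝓘(ℝ, EB) f x) (hy : f x = y) (v : EN) :
    (mfderiv 𝓘(ℝ, EN) 𝓘(ℝ, EC) (fun z => g (f z)) x : EN → EC) v =
      (mfderiv 𝓘(ℝ, EB) 𝓘(ℝ, EC) g y : EB → EC)
        ((mfderiv 𝓘(ℝ, EN) 𝓘(ℝ, EB) f x : EN → EB) v) := by
  subst hy
  exact congrArg (fun L : EN →L[ℝ] EC => L v) (mfderiv_comp x hg hf)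

theorem AdL_one : AdL (1 : G) = ContinuousLinearMap.id ℝ EG := by
  have h : (fun h : G => (1 : G) * h * (1 : G)⁻¹) = id := by funext h; simp
  unfold AdL
  refine (mfderiv_congr_point h rfl).trans ?_
  exact mfderiv_id

theorem mcForm_one (v : EG) : formAt (E := EG) (mcForm (EG := EG) (G := G)) 1 v = v := by
  have h : (fun h : G => (1 : G)⁻¹ * h) = id := by funext h; simp
  have h1 : formAt (E := EG) (mcForm (EG := EG) (G := G)) 1 = ContinuousLinearMap.id ℝ EG :=
    (mfderiv_congr_point h rfl).trans mfderiv_id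
  rw [h1]; rfl

variable [LieGroup 𝓘(ℝ, EG) ∞ G]

theorem contMDiff_lmul (g : G) : ContMDiff 𝓘(ℝ, EG) 𝓘(ℝ, EG) ∞ (fun h : G => g * h) :=
  contMDiff_mul_left

theorem contMDiff_rmul (g : G) : ContMDiff 𝓘(ℝ, EG) 𝓘(ℝ, EG) ∞ (fun h : G => h * g) :=
  contMDiff_mul_right

theorem contMDiff_conj (g : G) : ContMDiff 𝓘(ℝ, EG) 𝓘(ℝ, EG) ∞ (fun h : G => g * h * g⁻¹) :=
  (contMDiff_rmul g⁻¹).comp (contMDiff_lmul g)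

theorem AdL_mul (g h : G) : AdL (EG := EG) (g * h) = (AdL g).comp (AdL h) := by
  refine ContinuousLinearMap.ext fun v => ?_
  have e : (fun k : G => g * h * k * (g * h)⁻¹) = fun k => g * (h * k * h⁻¹) * g⁻¹ := by
    funext k; group
  have h1 := mfderiv_comp_vec (EN := EG) (x := (1 : G)) (y := (1 : G))
    ((contMDiff_conj (EG := EG) g).mdifferentiable (by simp) _)
    ((contMDiff_conj (EG := EG) h).mdifferentiable (by simp) _) (by simp) v
  refine Eq.trans ?_ h1
  exact congrArg (fun L : EG →L[ℝ] EG => L v) (mfderiv_congr_point e rfl)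

theorem AdL_inv_apply_apply (g : G) (X : EG) : AdL g⁻¹ (AdL g X) = X := by
  have h := AdL_mul (EG := EG) g⁻¹ g
  rw [inv_mul_cancel, AdL_one] at h
  exact (congrArg (fun L : EG →L[ℝ] EG => L X) h).symm

theorem AdL_apply_inv_apply (g : G) (X : EG) : AdL (EG := EG) g (AdL g⁻¹ X) = X := by
  simpa using AdL_inv_apply_apply g⁻¹ X

section MaurerCartan

variable {EN : Type*} [NormedAddCommGroup EN] [NormedSpace ℝ EN]
  {N : Type*} [TopologicalSpace N] [ChartedSpace EN N]

/-- The curve or map is translated so as to pass through `1`; the behavior of the form under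
translations and conjugations then reduces to identities in the group. -/
theorem mcForm_mfderiv {f : N → G} {x : N}
    (hf : MDifferentiableAt 𝓘(ℝ, EN) 𝓘(ℝ, EG) f x) (v : EN) :
    formAt (E := EG) (mcForm (EG := EG)) (f x) ((mfderiv 𝓘(ℝ, EN) 𝓘(ℝ, EG) f x : EN → EG) v) =
      (mfderiv 𝓘(ℝ, EN) 𝓘(ℝ, EG) (fun y => (f x)⁻¹ * f y) x : EN → EG) v :=
  (mfderiv_comp_vec ((contMDiff_lmul (EG := EG) (f x)⁻¹).mdifferentiable (by simp) _) hf rfl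
    v).symm

theorem mcForm_lmul (g h : G) (v : EG) :
    formAt (E := EG) (mcForm (EG := EG)) (g * h)
        ((mfderiv 𝓘(ℝ, EG) 𝓘(ℝ, EG) (fun k : G => g * k) h : EG → EG) v) =
      formAt (E := EG) (mcForm (EG := EG)) h v := by
  rw [mcForm_mfderiv ((contMDiff_lmul (EG := EG) g).mdifferentiable (by simp) _)]
  have e : (fun y : G => (g * h)⁻¹ * (g * y)) = fun y => h⁻¹ * y := by
    funext y; group
  exact congrArg (fun L : EG →L[ℝ] EG => L v) (mfderiv_congr_point e rfl)

theorem mcForm_rmul (g h : G) (v : EG) :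
    formAt (E := EG) (mcForm (EG := EG)) (h * g)
        ((mfderiv 𝓘(ℝ, EG) 𝓘(ℝ, EG) (fun k : G => k * g) h : EG → EG) v) =
      AdL g⁻¹ (formAt (E := EG) (mcForm (EG := EG)) h v) := by
  rw [mcForm_mfderiv ((contMDiff_rmul (EG := EG) g).mdifferentiable (by simp) _)]
  have e : (fun y : G => (h * g)⁻¹ * (y * g)) = fun y => g⁻¹ * (h⁻¹ * y) * g⁻¹⁻¹ := by
    funext y; group
  refine (congrArg (fun L : EG →L[ℝ] EG => L v) (mfderiv_congr_point e rfl)).trans ?_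
  exact mfderiv_comp_vec (g := fun k : G => g⁻¹ * k * g⁻¹⁻¹)
    ((contMDiff_conj (EG := EG) g⁻¹).mdifferentiable (by simp) _)
    ((contMDiff_lmul (EG := EG) h⁻¹).mdifferentiable (by simp) _) (by simp) v

/-- In charts the form is the partial derivative of `(y, y') ↦ y⁻¹ y'` in the second variable, taken
on the diagonal; joint smoothness of this map gives the claim. -/
theorem smoothFormAt_mcForm (g : G) : SmoothFormAt (EB := EG) mcForm g := by
  set ψ := extChartAt 𝓘(ℝ, EG) g with hψ
  set χ := extChartAt 𝓘(ℝ, EG) (1 : G) with hχ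
  have hψs : ContMDiffAt 𝓘(ℝ, EG) 𝓘(ℝ, EG) ∞ ψ.symm (ψ g) :=
    (contMDiffOn_extChartAt_symm g).contMDiffAt (extChartAt_target_mem_nhds g)
  set Φ : EG → EG → EG := fun y y' => χ ((ψ.symm y)⁻¹ * ψ.symm y') with hΦ
  have hg : ψ.symm (ψ g) = g := extChartAt_to_inv g
  have h1 : ContDiffAt ℝ ∞ (Function.uncurry Φ) (ψ g, ψ g) := by
    have e1 : ContMDiffAt 𝓘(ℝ, EG × EG) 𝓘(ℝ, EG) ∞ (fun z : EG × EG => ψ.symm z.1) (ψ g, ψ g) :=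
      ContMDiffAt.comp (ψ g, ψ g) (g := ψ.symm) (f := Prod.fst) hψs
        contDiff_fst.contMDiff.contMDiffAt
    have e2 : ContMDiffAt 𝓘(ℝ, EG × EG) 𝓘(ℝ, EG) ∞ (fun z : EG × EG => ψ.symm z.2) (ψ g, ψ g) :=
      ContMDiffAt.comp (ψ g, ψ g) (g := ψ.symm) (f := Prod.snd) hψs
        contDiff_snd.contMDiff.contMDiffAt
    have e3 : ContMDiffAt 𝓘(ℝ, EG) 𝓘(ℝ, EG) ∞ χ ((ψ.symm (ψ g))⁻¹ * ψ.symm (ψ g)) := by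
      rw [inv_mul_cancel]
      exact contMDiffAt_extChartAt
    exact (ContMDiffAt.comp (ψ g, ψ g) (g := χ) e3 (e1.inv.mul e2)).contDiffAt
  have h2 : chartForm mcForm g =ᶠ[𝓝 (ψ g)] fun y => fderiv ℝ (Φ y) y := by
    filter_upwards [(extChartAt_target_mem_nhds (I := 𝓘(ℝ, EG)) g)] with y hy
    have hys : MDifferentiableAt 𝓘(ℝ, EG) 𝓘(ℝ, EG) ψ.symm y :=
      ((contMDiffOn_extChartAt_symm (n := ∞) g).contMDiffAt
        ((isOpen_extChartAt_target g).mem_nhds hy)).mdifferentiableAt (by simp)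
    refine ContinuousLinearMap.ext fun v => ?_
    refine (mcForm_mfderiv hys v).trans ?_
    have hm : MDifferentiableAt 𝓘(ℝ, EG) 𝓘(ℝ, EG) (fun y' => (ψ.symm y)⁻¹ * ψ.symm y') y :=
      ((contMDiff_lmul (EG := EG) (ψ.symm y)⁻¹).mdifferentiable (by simp) _).comp y hys
    refine (mfderiv_eq_fderiv_written hm v).trans ?_
    have e : writtenInExtChartAt 𝓘(ℝ, EG) 𝓘(ℝ, EG) y
        (fun y' => (ψ.symm y)⁻¹ * ψ.symm y') = Φ y := by
      funext y'
      simp only [writtenInExtChartAt, extChartAt_model_space_eq_id, PartialEquiv.refl_symm,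
        PartialEquiv.refl_coe, Function.comp_apply, id, inv_mul_cancel, hΦ, hχ]
    have e' : extChartAt 𝓘(ℝ, EG) y y = y := by rw [extChartAt_model_space_eq_id]; rfl
    rw [e, e']
  refine ContDiffAt.congr_of_eventuallyEq ?_ h2
  exact ContDiffAt.fderiv h1 contDiffAt_id (by simp)

end MaurerCartan

section Bracket

variable [CompleteSpace EG]

/-- The bracket of the Lie algebra is given by the Maurer-Cartan equation. -/
theorem lie_eq_neg_extD (X Y : Lie𝔤 (EG := EG) G) :
    (⁅X, Y⁆ : Lie𝔤 (EG := EG) G) =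
      (- extD (EB := EG) (fun g z => mcForm (EG := EG) (G := G) g z) 1 X Y : EG) := by
  -- The form is constant on left-invariant fields, which is what `form_mlieBracket` requires.
  have h0 : ∀ (X : Lie𝔤 (EG := EG) G) (g : G),
      mcForm (EG := EG) g (mulInvariantVectorField X g) = (X : EG) := by
    intro X g
    have h1 := mcForm_lmul (EG := EG) g (1 : G) (X : EG)
    have h2 : ∀ g' : G, g' = g → ∀ z : EG,
        formAt (E := EG) (mcForm (EG := EG)) g' z = formAt (E := EG) (mcForm (EG := EG)) g z := by
      rintro _ rfl _; rfl
    exact (h2 _ (mul_one g) _).symm.trans (h1.trans (mcForm_one (EG := EG) (G := G) _))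
  have h1 : ∀ X : Lie𝔤 (EG := EG) G, (mulInvariantVectorField X (1 : G) : EG) = X := by
    intro X
    have := h0 X 1
    exact (mcForm_one (EG := EG) (G := G) _).symm.trans this
  have h := form_mlieBracket (smoothFormAt_mcForm (EG := EG) (1 : G))
    (mdifferentiableAt_mulInvariantVectorField X) (mdifferentiableAt_mulInvariantVectorField Y)
    (h0 X) (h0 Y)
  refine (mcForm_one (EG := EG) (G := G) _).symm.trans (h.trans (congrArg Neg.neg ?_))
  have e : ∀ a b a' b' : EG, a = a' → b = b' →
      extD (EB := EG) (fun g z => mcForm (EG := EG) (G := G) g z) 1 a b =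
      extD (EB := EG) (fun g z => mcForm (EG := EG) (G := G) g z) 1 a' b' := by
    rintro _ _ _ _ rfl rfl; rfl
  exact e _ _ _ _ (h1 X) (h1 Y)

/-- The adjoint action preserves the bracket. -/
theorem Ad_lie (g : G) (X Y : Lie𝔤 (EG := EG) G) : Ad g ⁅X, Y⁆ = ⁅Ad g X, Ad g Y⁆ := by
  -- Conjugation by `g` pulls the Maurer-Cartan form back to `Ad g` applied to it. Taking `d` of
  -- this and using `lie_eq_neg_extD` on both sides gives the result.
  have h1 : ∀ h : G, ∀ v : EG,
      formAt (pullbackForm (EN := EG) (fun h : G => g * h * g⁻¹) mcForm) h v =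
      AdL (EG := EG) g (formAt (E := EG) (mcForm (EG := EG)) h v) := by
    intro h v
    refine (mcForm_mfderiv ((contMDiff_conj (EG := EG) g).mdifferentiable (by simp) _) v).trans ?_
    have e : (fun y : G => (g * h * g⁻¹)⁻¹ * (g * y * g⁻¹)) = fun y => g * (h⁻¹ * y) * g⁻¹ := by
      funext y; group
    refine (congrArg (fun L : EG →L[ℝ] EG => L v) (mfderiv_congr_point e rfl)).trans ?_
    exact mfderiv_comp_vec (g := fun k : G => g * k * g⁻¹)
      ((contMDiff_conj (EG := EG) g).mdifferentiable (by simp) _)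
      ((contMDiff_lmul (EG := EG) h⁻¹).mdifferentiable (by simp) _) (by simp) v
  have h2 : pullbackForm (EN := EG) (fun h : G => g * h * g⁻¹) mcForm =
      fun h => (AdL (EG := EG) g).comp (mcForm h) := by
    funext h
    exact ContinuousLinearMap.ext fun v => h1 h v
  have hm : g * 1 * g⁻¹ = 1 := by simp
  have h3 := extD_pullback (f := fun h : G => g * h * g⁻¹) (x := (1 : G))
    (smoothFormAt_mcForm (EG := EG) (g * 1 * g⁻¹)) (contMDiff_conj g).contMDiffAt X Y
  rw [h2] at h3
  have h4 := extD_clm_comp (smoothFormAt_mcForm (EG := EG) (1 : G)) (AdL (EG := EG) g) X Y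
  have h5 : ∀ (k : G), k = 1 → ∀ a b : EG,
      extD (EB := EG) (fun g z => mcForm (EG := EG) (G := G) g z) k a b =
      extD (EB := EG) (fun g z => mcForm (EG := EG) (G := G) g z) 1 a b := by
    rintro _ rfl _ _; rfl
  have h6 := (h4.symm.trans h3).trans (h5 _ hm _ _)
  have h7 : (Ad g ⁅X, Y⁆ : EG) = AdL (EG := EG) g
      (- extD (EB := EG) (fun g z => mcForm (EG := EG) (G := G) g z) 1 X Y : EG) :=
    congrArg (AdL (EG := EG) g) (lie_eq_neg_extD X Y)
  refine h7.trans ((map_neg _ _).trans ((congrArg Neg.neg h6).trans ?_))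
  exact (lie_eq_neg_extD (Ad g X) (Ad g Y)).symm

/-- The derivative of the adjoint action along a curve. -/
theorem hasDerivAt_AdL_inv {c : ℝ → G} (hc : ContMDiffAt 𝓘(ℝ, ℝ) 𝓘(ℝ, EG) ∞ c 0) (hc0 : c 0 = 1)
    {A : Lie𝔤 (EG := EG) G} (hA : (mfderiv 𝓘(ℝ, ℝ) 𝓘(ℝ, EG) c 0 : ℝ → EG) 1 = A)
    (X : Lie𝔤 (EG := EG) G) :
    HasDerivAt (fun t => AdL (EG := EG) (c t)⁻¹ (X : EG))
      (toVec (-⁅A, X⁆ : Lie𝔤 (EG := EG) G)) 0 := by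
  obtain ⟨γ, hγ, hγ0, hγ1⟩ := exists_curve (EB := EG) (1 : G) (X : EG)
  -- On the surface `γ(s) c(t)` the form has the constant value `A` on `∂ₜ` along `t = 0`, and the
  -- value `Ad(c(t)⁻¹) X` on `∂ₛ` along `s = 0`. So the required derivative is `b = -dμ(X, A) = [X,
  -- A]`.
  obtain ⟨a, b, ha, hb, hab⟩ := extD_two_parameters (F := fun g h : G => g * h)
    (contMDiff_mul 𝓘(ℝ, EG) ∞) (γ := γ) (c := c) (smoothFormAt_mcForm (EG := EG) (γ 0 * c 0)) hγ hc
  have hz : ∀ v : EG, formAt (E := EG) (mcForm (EG := EG)) (c 0) v = v := by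
    rw [hc0]; exact mcForm_one
  have ha' : HasDerivAt (fun _ : ℝ => toVec A) a 0 := by
    refine ha.congr_of_eventuallyEq (Eventually.of_forall fun s => ?_)
    exact ((mcForm_lmul (γ s) (c 0) _).trans ((hz _).trans hA)).symm
  have hb' : HasDerivAt (fun t => AdL (EG := EG) (c t)⁻¹ (X : EG)) b 0 := by
    refine hb.congr_of_eventuallyEq (Eventually.of_forall fun t => ?_)
    refine Eq.symm ((mcForm_rmul (c t) (γ 0) _).trans (congrArg (AdL (EG := EG) (c t)⁻¹) ?_))
    refine (congrArg _ hγ1).trans ?_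
    rw [hγ0]; exact mcForm_one (EG := EG) (G := G) _
  have ha0 : a = 0 := ha'.unique (hasDerivAt_const _ _)
  rw [ha0, zero_sub] at hab
  have hv1 : (mfderiv 𝓘(ℝ, EG) 𝓘(ℝ, EG) (fun q : G => q * c 0) (γ 0) : EG → EG)
      ((mfderiv 𝓘(ℝ, ℝ) 𝓘(ℝ, EG) γ 0 : ℝ → EG) (1 : ℝ)) = X := by
    refine (congrArg (mfderiv 𝓘(ℝ, EG) 𝓘(ℝ, EG) (fun q : G => q * c 0) (γ 0)) hγ1).trans ?_
    have e : (fun q : G => q * c 0) = id := by funext q; simp [hc0]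
    exact congrArg (fun L : EG →L[ℝ] EG => L X) ((mfderiv_congr_point e rfl).trans mfderiv_id)
  have hv2 : (mfderiv 𝓘(ℝ, EG) 𝓘(ℝ, EG) (fun q : G => γ 0 * q) (c 0) : EG → EG)
      ((mfderiv 𝓘(ℝ, ℝ) 𝓘(ℝ, EG) c 0 : ℝ → EG) (1 : ℝ)) = A := by
    refine (congrArg (mfderiv 𝓘(ℝ, EG) 𝓘(ℝ, EG) (fun q : G => γ 0 * q) (c 0)) hA).trans ?_
    have e : (fun q : G => γ 0 * q) = id := by funext q; simp [hγ0]
    exact congrArg (fun L : EG →L[ℝ] EG => L A) ((mfderiv_congr_point e rfl).trans mfderiv_id)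
  have h5 : ∀ (k : G), k = 1 → ∀ a b a' b' : EG, a = a' → b = b' →
      extD (EB := EG) (fun g z => mcForm (EG := EG) (G := G) g z) k a b =
      extD (EB := EG) (fun g z => mcForm (EG := EG) (G := G) g z) 1 a' b' := by
    rintro _ rfl _ _ _ _ rfl rfl; rfl
  have h6 := (h5 (γ 0 * c 0) (by simp [hγ0, hc0]) _ _ _ _ hv1 hv2).symm.trans hab
  have h7 : (-⁅A, X⁆ : Lie𝔤 (EG := EG) G) = b := by
    rw [lie_skew]
    exact (lie_eq_neg_extD X A).trans ((congrArg Neg.neg h6).trans (neg_neg b))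
  have h8 : toVec (-⁅A, X⁆ : Lie𝔤 (EG := EG) G) = b := h7
  rw [h8]
  exact hb'

end Bracket

end LieGroup

/-! ### Algebra of graded Lie algebras: grading element, filtration, faithfulness. -/

section GradedAlgebra

variable {L : Type*} [LieRing L] [LieAlgebra ℝ L] (gr : ℤ → Submodule ℝ L)

theorem mem_iSup_of_mem {i j : ℤ} {X : L} (hX : X ∈ gr j) (hij : i ≤ j) : X ∈ ⨆ k ≥ i, gr k :=
  (le_iSup₂_of_le (f := fun k (_ : k ≥ i) => gr k) j hij le_rfl) hX

/-- A grading element: it acts by the degree. -/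
def IsGradingElement (E : L) : Prop := E ∈ gr 0 ∧ ∀ i : ℤ, ∀ X ∈ gr i, ⁅E, X⁆ = (i : ℝ) • X

variable {gr} in
-- Invariance of the Killing form under `ad E` gives `(i + j) K(X, Y) = 0`.
theorem killingForm_eq_zero {E : L} (hE : IsGradingElement gr E) {i j : ℤ} (hij : i + j ≠ 0)
    {X Y : L} (hX : X ∈ gr i) (hY : Y ∈ gr j) : killingForm ℝ L X Y = 0 := by
  have h := LieModule.traceForm_apply_lie_apply ℝ L L X E Y
  rw [← lie_skew, hE.2 i X hX, hE.2 j Y hY] at h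
  have h1 : ((i : ℝ) + j) • killingForm ℝ L X Y = 0 := by
    simp only [killingForm, map_neg, map_smul, LinearMap.neg_apply, LinearMap.smul_apply] at h ⊢
    rw [add_smul, ← h]
    simp
  rcases smul_eq_zero.1 h1 with h2 | h2
  · exact absurd (by exact_mod_cast h2) hij
  · exact h2

variable [GradedLieAlgebra gr]

/-- The projection to the `i`-th component of a graded Lie algebra. -/
def gproj (i : ℤ) : L →ₗ[ℝ] L where
  toFun X := (DirectSum.decompose gr X i : gr i)
  map_add' X Y := by simp
  map_smul' c X := by rw [DirectSum.decompose_smul]; rfl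

theorem gproj_mem (i : ℤ) (X : L) : gproj gr i X ∈ gr i := (DirectSum.decompose gr X i).2

theorem gproj_same {i : ℤ} {X : L} (hX : X ∈ gr i) : gproj gr i X = X :=
  DirectSum.decompose_of_mem_same gr hX

theorem gproj_ne {i j : ℤ} {X : L} (hX : X ∈ gr i) (h : i ≠ j) : gproj gr j X = 0 :=
  DirectSum.decompose_of_mem_ne gr hX h

theorem ext_gproj {X Y : L} (h : ∀ i, gproj gr i X = gproj gr i Y) : X = Y := by
  apply (DirectSum.decompose gr).injective
  ext i
  exact h i

theorem graded_induction {p : L → Prop} (h0 : p 0) (hmem : ∀ i, ∀ X ∈ gr i, p X)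
    (hadd : ∀ X Y, p X → p Y → p (X + Y)) (X : L) : p X :=
  DirectSum.Decomposition.inductionOn gr h0 (fun {i} X => hmem i X X.2) hadd X

theorem gproj_lie {j : ℤ} {A : L} (hA : A ∈ gr j) (i : ℤ) (X : L) :
    gproj gr (j + i) ⁅A, X⁆ = ⁅A, gproj gr i X⁆ := by
  induction X using graded_induction gr with
  | h0 => simp
  | hmem k X hX =>
    have h := SetLike.GradedBracket.bracket_mem hA hX
    rcases eq_or_ne k i with rfl | hk
    · rw [gproj_same gr hX, gproj_same gr h]
    · rw [gproj_ne gr hX hk, gproj_ne gr h (by omega), lie_zero]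
  | hadd X Y hX hY => simp [hX, hY]

theorem gproj_of_mem_iSup {i j : ℤ} {X : L} (hX : X ∈ ⨆ k ≥ i, gr k) (hj : j < i) :
    gproj gr j X = 0 := by
  have h : ⨆ k ≥ i, gr k ≤ (gproj gr j).ker := by
    refine iSup₂_le fun k hk Y hY => ?_
    exact gproj_ne gr hY (by omega)
  exact h hX

variable {gr}

theorem IsGradingElement.gproj_lie {E : L} (hE : IsGradingElement gr E) (i : ℤ) (X : L) :
    gproj gr i ⁅E, X⁆ = (i : ℝ) • gproj gr i X := by
  have h := OneGraded.gproj_lie gr hE.1 i X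
  rw [zero_add] at h
  rw [h, hE.2 i _ (gproj_mem gr i X)]

/-- Comparing `j`-components gives `(i - j) X_j = 0`. Thus `𝔤ᵢ` is the full `i`-eigenspace of `ad
E`, and an automorphism fixing `E` preserves the grading. -/
theorem IsGradingElement.mem_of_lie {E : L} (hE : IsGradingElement gr E) {i : ℤ} {X : L}
    (h : ⁅E, X⁆ = (i : ℝ) • X) : X ∈ gr i := by
  have h1 : gproj gr i X = X := by
    apply ext_gproj gr
    intro j
    rcases eq_or_ne j i with rfl | hj
    · rw [gproj_same gr (gproj_mem gr j X)]
    · rw [gproj_ne gr (gproj_mem gr i X) hj.symm]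
      have h2 := hE.gproj_lie j X
      rw [h, map_smul, ← sub_eq_zero, ← sub_smul] at h2
      rcases smul_eq_zero.1 h2 with h3 | h3
      · exact absurd (by exact_mod_cast (sub_eq_zero.1 h3).symm) hj
      · exact h3.symm
  rw [← h1]
  exact gproj_mem gr i X

variable (gr) in
-- Multiplication by the degree is a derivation, and all derivations of a Killing Lie algebra are
-- inner.
theorem exists_gradingElement [FiniteDimensional ℝ L] [LieAlgebra.IsKilling ℝ L] :
    ∃ E : L, IsGradingElement gr E := by
  obtain ⟨E, hE⟩ := LieDerivation.IsKilling.exists_eq_ad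
    (LieDerivation.ofGrading gr (Int.castAddHom ℝ))
  have h1 : ∀ i : ℤ, ∀ X ∈ gr i, ⁅E, X⁆ = (i : ℝ) • X := by
    intro i X hX
    have h2 : ⁅E, X⁆ = LieDerivation.ofGrading gr (Int.castAddHom ℝ) X := by
      rw [← hE]; simp
    rw [h2, LieDerivation.ofGrading_apply_apply gr _ hX]
    rfl
  have h2 : ∀ (i : ℤ) (X : L), gproj gr i ⁅E, X⁆ = (i : ℝ) • gproj gr i X := by
    intro i X
    induction X using graded_induction gr with
    | h0 => simp
    | hmem k X hX =>
      rw [h1 k X hX, map_smul]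
      rcases eq_or_ne k i with rfl | hk
      · rfl
      · rw [gproj_ne gr hX hk, smul_zero, smul_zero]
    | hadd X Y hX hY => simp [hX, hY]
  refine ⟨E, ?_, h1⟩
  -- Since `[E, E] = 0`, the components of `E` satisfy `j E_j = 0`, so only degree zero survives.
  have h3 : gproj gr 0 E = E := by
    apply ext_gproj gr
    intro j
    rcases eq_or_ne j 0 with rfl | hj
    · rw [gproj_same gr (gproj_mem gr 0 E)]
    · rw [gproj_ne gr (gproj_mem gr 0 E) hj.symm]
      have h4 := h2 j E
      rw [lie_self, map_zero] at h4
      rcases smul_eq_zero.1 h4.symm with h5 | h5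
      · exact absurd (by exact_mod_cast h5) hj
      · exact h5.symm
  rw [← h3]
  exact gproj_mem gr 0 E

/-- An element of degree zero acting trivially is zero. -/
theorem eq_zero_of_lie_eq_zero [FiniteDimensional ℝ L] [LieAlgebra.IsKilling ℝ L] {A : L}
    (h : ∀ X : L, ⁅A, X⁆ = 0) : A = 0 := by
  have h2 : A ∈ LieAlgebra.center ℝ L := (LieModule.mem_maxTrivSubmodule ℝ L L A).2 fun X => by
    rw [← lie_skew, h X, neg_zero]
  rwa [LieAlgebra.center_eq_bot, LieSubmodule.mem_bot] at h2

/-- An automorphism preserving the filtration changes the grading element by an element of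
degree one. -/
theorem IsGradingElement.automorphism_sub_mem [FiniteDimensional ℝ L] [LieAlgebra.IsKilling ℝ L]
    (hgr : ∀ i : ℤ, 1 < |i| → gr i = ⊥) {E : L} (hE : IsGradingElement gr E)
    {θ θ' : L →ₗ[ℝ] L} (hθ : ∀ X Y, θ ⁅X, Y⁆ = ⁅θ X, θ Y⁆) (hinv : ∀ X, θ (θ' X) = X)
    (hf : ∀ i : ℤ, ∀ X ∈ ⨆ j ≥ i, gr j, θ X ∈ ⨆ j ≥ i, gr j)
    (hf' : ∀ i : ℤ, ∀ X ∈ ⨆ j ≥ i, gr j, θ' X ∈ ⨆ j ≥ i, gr j) :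
    θ E - E ∈ gr 1 := by
  set Z := θ E - E with hZ
  -- `ad E` acts by `i` on the `i`-th quotient of the filtration.
  have h1 : ∀ i : ℤ, ∀ X ∈ ⨆ j ≥ i, gr j, ⁅E, X⁆ - (i : ℝ) • X ∈ ⨆ j ≥ i + 1, gr j := by
    intro i
    let D : L →ₗ[ℝ] L := (LieAlgebra.ad ℝ L E : L →ₗ[ℝ] L) - (i : ℝ) • LinearMap.id
    suffices h : ⨆ j ≥ i, gr j ≤ (⨆ j ≥ i + 1, gr j).comap D from fun X hX => h hX
    refine iSup₂_le fun j hj X hX => ?_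
    have hD : D X = ((j : ℝ) - i) • X := by
      simp [D, hE.2 j X hX, sub_smul]
    rw [Submodule.mem_comap, hD]
    rcases eq_or_lt_of_le (show i ≤ j from hj) with rfl | hlt
    · simp
    · exact Submodule.smul_mem _ _ (mem_iSup_of_mem gr hX (by omega))
  have hanti : ∀ i : ℤ, ⨆ j ≥ i + 1, gr j ≤ ⨆ j ≥ i, gr j := fun i =>
    iSup₂_le fun j hj X hX => mem_iSup_of_mem gr hX (by omega)
  -- Conjugating by the filtration-preserving `θ`, also `ad (θ E)` acts by `i` on that quotient;
  -- hence the difference `Z` strictly raises the filtration degree.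
  have h2 : ∀ i : ℤ, ∀ X ∈ gr i, ⁅Z, X⁆ ∈ ⨆ j ≥ i + 1, gr j := by
    intro i X hX
    have hX' := hf' i X (mem_iSup_of_mem gr hX le_rfl)
    have h3 := hf (i + 1) _ (h1 i _ hX')
    rw [map_sub, map_smul, hθ, hinv] at h3
    rw [hZ, sub_lie, hE.2 i X hX]
    exact h3
  have hZ0 : Z ∈ ⨆ j ≥ (0 : ℤ), gr j :=
    Submodule.sub_mem _ (hf 0 _ (mem_iSup_of_mem gr hE.1 le_rfl)) (mem_iSup_of_mem gr hE.1 le_rfl)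
  have hZj : ∀ j : ℤ, j ≠ 0 → j ≠ 1 → gproj gr j Z = 0 := by
    intro j h0 h1
    rcases lt_or_ge j 0 with hj | hj
    · exact gproj_of_mem_iSup gr hZ0 hj
    · have h3 := gproj_mem gr j Z
      rw [hgr j (by rw [abs_of_nonneg hj]; omega)] at h3
      exact (Submodule.mem_bot ℝ).1 h3
  have hdec : Z = gproj gr 0 Z + gproj gr 1 Z := by
    apply ext_gproj gr
    intro j
    rw [map_add]
    rcases eq_or_ne j 0 with rfl | h0
    · rw [gproj_same gr (gproj_mem gr 0 Z), gproj_ne gr (gproj_mem gr 1 Z) one_ne_zero, add_zero]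
    rcases eq_or_ne j 1 with rfl | h1
    · rw [gproj_same gr (gproj_mem gr 1 Z), gproj_ne gr (gproj_mem gr 0 Z) zero_ne_one, zero_add]
    rw [hZj j h0 h1, gproj_ne gr (gproj_mem gr 0 Z) h0.symm,
      gproj_ne gr (gproj_mem gr 1 Z) h1.symm, add_zero]
  -- The degree-`i` part of `[Z, X]` is `[Z₀, X]`, so `Z₀` is central and vanishes.
  have hZ00 : gproj gr 0 Z = 0 := by
    apply eq_zero_of_lie_eq_zero
    intro X
    induction X using graded_induction gr with
    | h0 => simp
    | hmem i X hX =>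
      have h4 := gproj_of_mem_iSup gr (h2 i X hX) (show i < i + 1 by omega)
      rw [hdec, add_lie, map_add] at h4
      have m0 := SetLike.GradedBracket.bracket_mem (gproj_mem gr 0 Z) hX
      have m1 := SetLike.GradedBracket.bracket_mem (gproj_mem gr 1 Z) hX
      rw [zero_add] at m0
      rwa [gproj_same gr m0, gproj_ne gr m1 (by omega), add_zero] at h4
    | hadd X Y hX hY => rw [lie_add, hX, hY, add_zero]
  rw [hdec, hZ00, zero_add]
  exact gproj_mem gr 1 Z

/-- If the non-negative part contains no ideal, the degree zero part acts faithfully on the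
negative part. -/
theorem eq_zero_of_lie_negative_eq_zero [FiniteDimensional ℝ L] [LieAlgebra.IsKilling ℝ L]
    (hgr : ∀ i : ℤ, 1 < |i| → gr i = ⊥)
    (heff : ∀ J : LieIdeal ℝ L, (∀ X ∈ J, X ∈ gr 0 ⊔ gr 1) → J = ⊥)
    {A : L} (hA : A ∈ gr 0) (h : ∀ X ∈ gr (-1), ⁅A, X⁆ = 0) : A = 0 := by
  obtain ⟨E, hE⟩ := exists_gradingElement gr
  -- Annihilating `𝔤₋₁` implies annihilating `𝔤₁`, by the duality of the two under the Killing form: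
  -- `K([A, Z], W) = -K(Z, [A, W])`.
  have hpos : ∀ A ∈ gr 0, (∀ X ∈ gr (-1), ⁅A, X⁆ = 0) → ∀ Z ∈ gr 1, ⁅A, Z⁆ = 0 := by
    intro A hA h Z hZ
    apply LieAlgebra.IsKilling.killingForm_nondegenerate ℝ L |>.1
    intro W
    have hm := SetLike.GradedBracket.bracket_mem hA hZ
    rw [zero_add] at hm
    induction W using graded_induction gr with
    | h0 => simp
    | hmem j W hW =>
      rcases eq_or_ne j (-1) with rfl | hj
      · have h3 := LieModule.traceForm_apply_lie_apply ℝ L L Z A W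
        rw [h W hW, map_zero] at h3
        rw [← lie_skew, map_neg, LinearMap.neg_apply, killingForm, h3, neg_zero]
      · exact killingForm_eq_zero hE (by omega) hm hW
    | hadd X Y hX hY => rw [map_add, hX, hY, add_zero]
  -- The annihilator of `𝔤₋₁` in `𝔤₀` is an ideal: brackets with `𝔤₋₁` and `𝔤₁` are zero, and
  -- brackets with `𝔤₀` stay inside by the Jacobi identity. It lies in `𝔭`, so effectivity applies.
  let J : LieIdeal ℝ L :=
    { carrier := {A | A ∈ gr 0 ∧ ∀ X ∈ gr (-1), ⁅A, X⁆ = 0}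
      zero_mem' := ⟨zero_mem _, fun X _ => zero_lie X⟩
      add_mem' := fun {A B} hA hB => ⟨add_mem hA.1 hB.1, fun X hX => by
        rw [add_lie, hA.2 X hX, hB.2 X hX, add_zero]⟩
      smul_mem' := fun c A hA => ⟨Submodule.smul_mem _ c hA.1, fun X hX => by
        rw [smul_lie, hA.2 X hX, smul_zero]⟩
      lie_mem := by
        rintro x A ⟨hA, hA'⟩
        induction x using graded_induction gr with
        | h0 => simp
        | hmem i x hx =>
          rcases eq_or_ne i 0 with rfl | h0
          · refine ⟨by simpa using SetLike.GradedBracket.bracket_mem hx hA, fun X hX => ?_⟩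
            have hxX := SetLike.GradedBracket.bracket_mem hx hX
            rw [zero_add] at hxX
            rw [lie_lie, hA' X hX, hA' _ hxX, lie_zero, sub_zero]
          have hz : ⁅x, A⁆ = 0 := by
            rcases eq_or_ne i 1 with rfl | h1
            · rw [← lie_skew, hpos A hA hA' x hx, neg_zero]
            rcases eq_or_ne i (-1) with rfl | h2
            · rw [← lie_skew, hA' x hx, neg_zero]
            have h3 : 1 < |i| := by
              rcases abs_cases i with h | h <;> omega
            rw [hgr i h3, Submodule.mem_bot] at hx
            rw [hx, zero_lie]
          rw [hz]
          exact ⟨zero_mem _, fun X _ => zero_lie X⟩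
        | hadd X Y hX hY =>
          rw [add_lie]
          exact ⟨add_mem hX.1 hY.1, fun W hW => by rw [add_lie, hX.2 W hW, hY.2 W hW, add_zero]⟩ }
  have hJ : J = ⊥ := heff J fun X hX => Submodule.mem_sup_left hX.1
  have hAJ : A ∈ J := ⟨hA, h⟩
  rw [hJ] at hAJ
  exact (LieSubmodule.mem_bot A).1 hAJ

end GradedAlgebra

/-! ### One-parameter subgroups and the adjoint action along them. -/

section OneParameterSubgroups

variable {EP : Type*} [NormedAddCommGroup EP] [NormedSpace ℝ EP]
  {P : Type*} [TopologicalSpace P] [ChartedSpace EP P] [Group P] [LieGroup 𝓘(ℝ, EP) ∞ P]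

/-- Left translates of integral curves of a left-invariant field are again integral curves. This
serves both completeness of the field and the homomorphism property. -/
theorem hasMFDerivAt_lmul_of_invariant {c : ℝ → P} {s : Set ℝ} {t : ℝ} {A : Lie𝔤 (EG := EP) P}
    (h : HasMFDerivWithinAt 𝓘(ℝ, ℝ) 𝓘(ℝ, EP) c s t
      ((1 : ℝ →L[ℝ] ℝ).smulRight (mulInvariantVectorField A (c t) : EP))) (p : P) :
    HasMFDerivWithinAt 𝓘(ℝ, ℝ) 𝓘(ℝ, EP) (fun t => p * c t) s t
      ((1 : ℝ →L[ℝ] ℝ).smulRight (mulInvariantVectorField A (p * c t) : EP)) := by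
  have h1 := HasMFDerivAt.comp_hasMFDerivWithinAt t
    (((contMDiff_lmul (EG := EP) p).mdifferentiable (by simp) (c t)).hasMFDerivAt) h
  have h2 : (mfderiv 𝓘(ℝ, EP) 𝓘(ℝ, EP) (fun q : P => p * c t * q) 1 : EP → EP) A =
      (mfderiv 𝓘(ℝ, EP) 𝓘(ℝ, EP) (fun q : P => p * q) (c t) : EP → EP)
        ((mfderiv 𝓘(ℝ, EP) 𝓘(ℝ, EP) (fun q : P => c t * q) 1 : EP → EP) A) := by
    have e : (fun q : P => p * c t * q) = fun q => p * (c t * q) := by funext q; group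
    refine (congrArg (fun L : EP →L[ℝ] EP => L A) (mfderiv_congr_point e rfl)).trans ?_
    exact mfderiv_comp_vec (g := fun q : P => p * q)
      ((contMDiff_lmul (EG := EP) p).mdifferentiable (by simp) _)
      ((contMDiff_lmul (EG := EP) (c t)).mdifferentiable (by simp) _) (mul_one _) A
  have h3 : ((1 : ℝ →L[ℝ] ℝ).smulRight (mulInvariantVectorField A (p * c t) : EP)) =
      (mfderiv 𝓘(ℝ, EP) 𝓘(ℝ, EP) (fun q : P => p * q) (c t) : EP →L[ℝ] EP).comp
      ((1 : ℝ →L[ℝ] ℝ).smulRight (mulInvariantVectorField A (c t) : EP)) := by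
    refine ContinuousLinearMap.ext fun r => ?_
    refine (congrArg (fun z : EP => r • z) h2).trans ?_
    exact (map_smul (mfderiv 𝓘(ℝ, EP) 𝓘(ℝ, EP) (fun q : P => p * q) (c t) : EP →L[ℝ] EP) r _).symm
  rw [h3]
  exact h1

/-- A homomorphism from the reals to a Lie group that is differentiable at zero is smooth. -/
theorem contMDiff_of_hom_of_mdifferentiableAt {c : ℝ → P} (hc : Continuous c)
    (hom : ∀ s t, c (s + t) = c s * c t)
    (hd : MDifferentiableAt 𝓘(ℝ, ℝ) 𝓘(ℝ, EP) c 0) : ContMDiff 𝓘(ℝ, ℝ) 𝓘(ℝ, EP) ∞ c := by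
  have hc0 : c 0 = 1 := by
    have h := hom 0 0
    rw [add_zero] at h
    exact left_eq_mul.1 h
  set ψ := extChartAt 𝓘(ℝ, EP) (1 : P) with hψ
  set J := c ⁻¹' ψ.source with hJ
  have hJo : IsOpen J := (isOpen_extChartAt_source (1 : P)).preimage hc
  have hJ0 : (0 : ℝ) ∈ J := by
    change c 0 ∈ ψ.source
    rw [hc0]
    exact mem_extChartAt_source 1
  set m : EP → EP → EP := fun y z => ψ (ψ.symm y * ψ.symm z) with hm
  have hsymm : ∀ y ∈ ψ.target, ContMDiffAt 𝓘(ℝ, EP) 𝓘(ℝ, EP) ∞ ψ.symm y := fun y hy =>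
    (contMDiffOn_extChartAt_symm (1 : P)).contMDiffAt
      ((isOpen_extChartAt_target (1 : P)).mem_nhds hy)
  have h1t : ψ 1 ∈ ψ.target := mem_extChartAt_target 1
  have hψ1 : ψ.symm (ψ 1) = 1 := extChartAt_to_inv 1
  have hms : ∀ y ∈ ψ.target, ContDiffAt ℝ ∞ (Function.uncurry m) (y, ψ 1) := by
    intro y hy
    have e1 : ContMDiffAt 𝓘(ℝ, EP × EP) 𝓘(ℝ, EP) ∞ (fun z : EP × EP => ψ.symm z.1) (y, ψ 1) :=
      ContMDiffAt.comp (y, ψ 1) (g := ψ.symm) (f := Prod.fst) (hsymm y hy)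
        contDiff_fst.contMDiff.contMDiffAt
    have e2 : ContMDiffAt 𝓘(ℝ, EP × EP) 𝓘(ℝ, EP) ∞ (fun z : EP × EP => ψ.symm z.2) (y, ψ 1) :=
      ContMDiffAt.comp (y, ψ 1) (g := ψ.symm) (f := Prod.snd) (hsymm _ h1t)
        contDiff_snd.contMDiff.contMDiffAt
    have e3 : ContMDiffAt 𝓘(ℝ, EP) 𝓘(ℝ, EP) ∞ ψ (ψ.symm y * ψ.symm (ψ 1)) := by
      rw [hψ1, mul_one]
      refine contMDiffAt_extChartAt' ?_
      have := ψ.map_target hy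
      rwa [hψ, extChartAt_source] at this
    exact (ContMDiffAt.comp (y, ψ 1) (g := ψ) e3 (e1.mul e2)).contDiffAt
  set a : ℝ → EP := fun t => ψ (c t) with ha
  obtain ⟨A, hA⟩ : ∃ A, HasDerivAt a A 0 := by
    have h2 : MDifferentiableAt 𝓘(ℝ, ℝ) 𝓘(ℝ, EP) a 0 := by
      refine MDifferentiableAt.comp (0 : ℝ) (g := ψ) ?_ hd
      rw [hc0]
      exact mdifferentiableAt_extChartAt (mem_chart_source EP 1)
    exact ⟨_, (mdifferentiableAt_iff_differentiableAt.1 h2).hasDerivAt⟩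
  -- Differentiating `c(t + s) = c(t) c(s)` at `s = 0` in the chart gives an autonomous equation `a'
  -- = W(a)` with smooth right-hand side.
  set W : EP → EP := fun y => fderiv ℝ (m y) (ψ 1) A with hW
  have hWs : ∀ y ∈ ψ.target, ContDiffAt ℝ ∞ W y := fun y hy =>
    (ContDiffAt.fderiv (f := m) (g := fun _ => ψ 1) (hms y hy) contDiffAt_const
      (by simp)).clm_apply contDiffAt_const
  have hder : ∀ t ∈ J, HasDerivAt a (W (a t)) t := by
    intro t ht
    have hat : a t ∈ ψ.target := ψ.map_source ht
    have h1 : DifferentiableAt ℝ (m (a t)) (ψ 1) := by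
      have := (hms _ hat).differentiableAt (by simp)
      exact this.comp (ψ 1) (f := fun z => (a t, z))
        ((differentiableAt_const _).prodMk differentiableAt_id)
    have ha0 : a 0 = ψ 1 := by simp only [ha, hc0]
    rw [← ha0] at h1
    have h2 := h1.hasFDerivAt.comp_hasDerivAt (0 : ℝ) hA
    rw [ha0] at h2
    have h3 : (fun s => a (t + s)) =ᶠ[𝓝 0] m (a t) ∘ a := by
      filter_upwards [hJo.mem_nhds hJ0] with s hs
      simp only [Function.comp_apply, hm, ha]
      rw [ψ.left_inv ht, ψ.left_inv hs, hom]
    have h4 := h2.congr_of_eventuallyEq h3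
    have h5 : HasDerivAt (fun s => a (t + (s - t))) (W (a t)) t := by
      have h6 : HasDerivAt (fun s : ℝ => s - t) 1 t := (hasDerivAt_id t).sub_const t
      have h7 : HasDerivAt (fun s => a (t + s)) (W (a t)) (t - t) := by
        rw [sub_self]; exact h4
      simpa [Function.comp_def] using! HasDerivAt.scomp (h := fun s : ℝ => s - t) t h7 h6
    simpa using h5
  -- Bootstrapping: if `a` is `Cⁿ`, so is `a' = W ∘ a`, and `a` is `Cⁿ⁺¹`.
  have hsm : ∀ n : ℕ, ContDiffOn ℝ n a J := by
    intro n
    induction n with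
    | zero =>
      exact contDiffOn_zero.2 fun t ht => (hder t ht).continuousAt.continuousWithinAt
    | succ n ih =>
      rw [Nat.cast_succ, contDiffOn_succ_iff_deriv_of_isOpen hJo]
      refine ⟨fun t ht => (hder t ht).differentiableAt.differentiableWithinAt, by simp, ?_⟩
      have h1 : ContDiffOn ℝ n W ψ.target := fun y hy =>
        ((hWs y hy).of_le (mod_cast le_top)).contDiffWithinAt
      refine (h1.comp ih fun t ht => ψ.map_source ht).congr fun t ht => ?_
      exact (hder t ht).deriv
  have hJs : ContMDiffAt 𝓘(ℝ, ℝ) 𝓘(ℝ, EP) ∞ c 0 := by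
    have h1 : ContMDiffAt 𝓘(ℝ, ℝ) 𝓘(ℝ, EP) ∞ a 0 :=
      ((contDiffOn_infty.2 hsm).contDiffAt (hJo.mem_nhds hJ0)).contMDiffAt
    have h2 : ContMDiffAt 𝓘(ℝ, ℝ) 𝓘(ℝ, EP) ∞ (fun t => ψ.symm (a t)) 0 :=
      ContMDiffAt.comp (0 : ℝ) (g := ψ.symm) (hsymm _ (ψ.map_source hJ0)) h1
    refine h2.congr_of_eventuallyEq ?_
    filter_upwards [hJo.mem_nhds hJ0] with t ht
    exact (ψ.left_inv ht).symm
  -- Smoothness near zero spreads to every `t` through `c(s) = c(t) c(s - t)`.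
  intro t
  have h1 : ContMDiffAt 𝓘(ℝ, ℝ) 𝓘(ℝ, ℝ) ∞ (fun s : ℝ => s - t) t :=
    (contDiff_id.sub contDiff_const).contMDiff.contMDiffAt
  have h2 : ContMDiffAt 𝓘(ℝ, ℝ) 𝓘(ℝ, EP) ∞ c (t - t) := by rw [sub_self]; exact hJs
  have h3 : ContMDiffAt 𝓘(ℝ, ℝ) 𝓘(ℝ, EP) ∞ (fun s => c t * c (s - t)) t :=
    (contMDiff_lmul (EG := EP) (c t)).contMDiffAt.comp t
      (ContMDiffAt.comp t (g := c) (f := fun s : ℝ => s - t) h2 h1)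
  refine h3.congr_of_eventuallyEq (Eventually.of_forall fun s => ?_)
  change c s = c t * c (s - t)
  rw [← hom, add_sub_cancel]

/-- One-parameter subgroups exist for every element of the Lie algebra. -/
theorem exists_oneParameterSubgroup [CompleteSpace EP] [T2Space P] (A : Lie𝔤 (EG := EP) P) :
    ∃ c : ℝ → P, ContMDiff 𝓘(ℝ, ℝ) 𝓘(ℝ, EP) ∞ c ∧ (∀ s t, c (s + t) = c s * c t) ∧ c 0 = 1 ∧
      (mfderiv 𝓘(ℝ, ℝ) 𝓘(ℝ, EP) c 0 : ℝ → EP) 1 = A := by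
  have : IsManifold 𝓘(ℝ, EP) 1 P := .of_le (n := ∞) (by simp)
  have hv : ContMDiff 𝓘(ℝ, EP) 𝓘(ℝ, EP).tangent 1
      (fun p : P => (⟨p, mulInvariantVectorField A p⟩ : TangentBundle 𝓘(ℝ, EP) P)) :=
    (contMDiff_mulInvariantVectorField A).of_le (by simp [minSmoothness_of_isRCLikeNormedField])
  obtain ⟨γ, hγ0, hγ⟩ := exists_isMIntegralCurveAt_of_contMDiffAt_boundaryless (0 : ℝ)
    (hv.contMDiffAt (x := (1 : P)))
  obtain ⟨ε, hε, hγε⟩ := isMIntegralCurveAt_iff'.1 hγ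
  rw [Real.ball_eq_Ioo, zero_sub, zero_add] at hγε
  -- Translates of a single local solution exist on one and the same interval `(-ε, ε)` from every
  -- starting point; such a uniform existence time gives a global integral curve.
  obtain ⟨c, hc0, hc⟩ := exists_isMIntegralCurve_of_isMIntegralCurveOn hv hε
    (fun p => ⟨fun t => p * γ t, by simp [hγ0], fun t ht =>
      hasMFDerivAt_lmul_of_invariant (hγε t ht) p⟩) (1 : P)
  have hcont : Continuous c := hc.continuous
  have hom : ∀ s t, c (s + t) = c s * c t := by
    intro s t
    -- Both `t ↦ c(s + t)` and `t ↦ c(s) c(t)` are integral curves starting at `c(s)`; uniqueness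
    -- identifies them.
    have h1 : IsMIntegralCurve (fun t => c s * c t)
        (mulInvariantVectorField A : ∀ p : P, TangentSpace 𝓘(ℝ, EP) p) := fun t =>
      (hasMFDerivAt_lmul_of_invariant (hc t).hasMFDerivWithinAt (c s)).hasMFDerivAt
        Filter.univ_mem
    have h2 := hc.comp_add s
    have h3 := isMIntegralCurve_Ioo_eq_of_contMDiff_boundaryless (t₀ := (0 : ℝ)) hv h2 h1
      (by simp [hc0])
    have h4 := congrFun h3 t
    simpa [add_comm] using h4
  refine ⟨c, contMDiff_of_hom_of_mdifferentiableAt hcont hom (hc 0).mdifferentiableAt, hom, hc0, ?_⟩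
  have h5 := (hc 0).mfderiv
  refine (congrArg (fun L : ℝ →L[ℝ] EP => L 1) h5).trans ?_
  have h6 : (mfderiv 𝓘(ℝ, EP) 𝓘(ℝ, EP) (fun q : P => c 0 * q) 1 : EP → EP) A = A := by
    have e : (fun q : P => c 0 * q) = id := by funext q; simp [hc0]
    exact congrArg (fun L : EP →L[ℝ] EP => L A) ((mfderiv_congr_point e rfl).trans mfderiv_id)
  exact (one_smul ℝ _).trans h6

end OneParameterSubgroups

section AdLinear

variable {EG : Type*} [NormedAddCommGroup EG] [NormedSpace ℝ EG]
  {G : Type*} [TopologicalSpace G] [ChartedSpace EG G] [Group G]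

instance [FiniteDimensional ℝ EG] : FiniteDimensional ℝ (Lie𝔤 (EG := EG) G) :=
  inferInstanceAs (FiniteDimensional ℝ EG)

/-- The adjoint action as a linear map of the Lie algebra. -/
def AdLin (g : G) : Lie𝔤 (EG := EG) G →ₗ[ℝ] Lie𝔤 (EG := EG) G where
  toFun := Ad g
  map_add' X Y := map_add (AdL (EG := EG) g) X Y
  map_smul' c X := map_smul (AdL (EG := EG) g) c X

theorem AdLin_apply (g : G) (X : Lie𝔤 (EG := EG) G) : AdLin g X = Ad g X := rfl

variable [LieGroup 𝓘(ℝ, EG) ∞ G]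

theorem Ad_inv_apply_apply (g : G) (X : Lie𝔤 (EG := EG) G) : Ad g⁻¹ (Ad g X) = X :=
  AdL_inv_apply_apply (EG := EG) g X

theorem Ad_apply_inv_apply (g : G) (X : Lie𝔤 (EG := EG) G) : Ad g (Ad g⁻¹ X) = X :=
  AdL_apply_inv_apply (EG := EG) g X

theorem Ad_mul_apply (g h : G) (X : Lie𝔤 (EG := EG) G) : Ad (g * h) X = Ad g (Ad h X) :=
  congrArg (fun L : EG →L[ℝ] EG => L X) (AdL_mul (EG := EG) g h)

/-- Along a one-parameter subgroup with velocity `Z`, the adjoint action on `E` with `[E, Z] = Z`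
is affine. -/
theorem Ad_inv_oneParameterSubgroup [CompleteSpace EG] {c : ℝ → G}
    (hc : ContMDiff 𝓘(ℝ, ℝ) 𝓘(ℝ, EG) ∞ c)
    (hom : ∀ s t, c (s + t) = c s * c t) (hc0 : c 0 = 1) {Z E : Lie𝔤 (EG := EG) G}
    (hZ : (mfderiv 𝓘(ℝ, ℝ) 𝓘(ℝ, EG) c 0 : ℝ → EG) 1 = Z) (hE : ⁅E, Z⁆ = Z) :
    Ad (c 1)⁻¹ E = E + Z := by
  -- The factorization `c(s) = c(s - t) c(t)` moves the derivative at time zero to any time `t`.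
  have key : ∀ X Y : Lie𝔤 (EG := EG) G, -⁅Z, X⁆ = Y → ∀ t : ℝ,
      HasDerivAt (fun t => AdL (EG := EG) (c t)⁻¹ (toVec X))
        (AdL (EG := EG) (c t)⁻¹ (toVec Y)) t := by
    intro X Y hXY t
    have h0 := hasDerivAt_AdL_inv hc.contMDiffAt hc0 hZ X
    rw [hXY] at h0
    have h0' : HasDerivAt (fun t => AdL (EG := EG) (c t)⁻¹ (toVec X)) (toVec Y) (t - t) := by
      rw [sub_self]; exact h0
    have h1 := HasDerivAt.scomp (h := fun s : ℝ => s - t) t h0' ((hasDerivAt_id t).sub_const t)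
    rw [one_smul] at h1
    have h2 := (AdL (EG := EG) (c t)⁻¹).hasFDerivAt.comp_hasDerivAt t h1
    refine h2.congr_of_eventuallyEq (Eventually.of_forall fun s => ?_)
    have h3 : c s = c (s - t) * c t := by rw [← hom, sub_add_cancel]
    simp only [Function.comp_apply]
    rw [h3, mul_inv_rev, AdL_mul]
    rfl
  have hZc : ∀ t, AdL (EG := EG) (c t)⁻¹ (toVec Z) = toVec Z := by
    intro t
    have h1 : ∀ t, HasDerivAt (fun t => AdL (EG := EG) (c t)⁻¹ (toVec Z)) 0 t := by
      intro t
      have h2 := key Z 0 (by simp) t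
      have h3 : AdL (EG := EG) (c t)⁻¹ (toVec (0 : Lie𝔤 (EG := EG) G)) = 0 :=
        map_zero (AdL (EG := EG) (c t)⁻¹)
      rwa [h3] at h2
    have h2 := is_const_of_deriv_eq_zero (fun t => (h1 t).differentiableAt)
      (fun t => (h1 t).deriv) t 0
    simp only [hc0, inv_one, AdL_one] at h2
    exact h2
  -- Here `-[Z, E] = Z`, and `Z` is fixed by the action, so the velocity of `Ad(c(t)⁻¹) E` is
  -- constantly `Z`.
  have h1 : ∀ t, HasDerivAt (fun t : ℝ => AdL (EG := EG) (c t)⁻¹ (toVec E) - t • toVec Z) 0 t := by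
    intro t
    have h2 := (key E Z (by rw [lie_skew, hE]) t).sub ((hasDerivAt_id t).smul_const (toVec Z))
    rwa [hZc, one_smul, sub_self] at h2
  have h2 := is_const_of_deriv_eq_zero (fun t => (h1 t).differentiableAt)
    (fun t => (h1 t).deriv) 1 0
  simp only [hc0, inv_one, AdL_one, one_smul, zero_smul, sub_zero] at h2
  exact sub_eq_iff_eq_add.1 h2

end AdLinear

/-! ### The model pair: `P = G₀ P₊` and elements of `G₀` acting as reflections. -/

namespace ParabolicType

variable {EG : Type*} [NormedAddCommGroup EG] [NormedSpace ℝ EG] [FiniteDimensional ℝ EG]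
  {G : Type*} [TopologicalSpace G] [ChartedSpace EG G] [Group G] [LieGroup 𝓘(ℝ, EG) ∞ G]
  {EP : Type*} [NormedAddCommGroup EP] [NormedSpace ℝ EP] [FiniteDimensional ℝ EP]
  {P : Type*} [TopologicalSpace P] [ChartedSpace EP P] [Group P] [LieGroup 𝓘(ℝ, EP) ∞ P]
  (T : ParabolicType EG G EP P)

instance : GradedLieAlgebra T.gr := T.graded

theorem isKilling (T : ParabolicType EG G EP P) : LieAlgebra.IsKilling ℝ (Lie𝔤 (EG := EG) G) := by
  have := T.semisimple
  infer_instance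

/-- The velocity of the image of a curve under the inclusion. -/
theorem mfderiv_incl_comp {c : ℝ → P} (hc : MDifferentiableAt 𝓘(ℝ, ℝ) 𝓘(ℝ, EP) c 0)
    (hc0 : c 0 = 1) {A : Lie𝔤 (EG := EP) P}
    (hA : (mfderiv 𝓘(ℝ, ℝ) 𝓘(ℝ, EP) c 0 : ℝ → EP) 1 = A) :
    (mfderiv 𝓘(ℝ, ℝ) 𝓘(ℝ, EG) (fun t => T.incl (c t)) 0 : ℝ → EG) 1 = T.lieIncl A :=
  (mfderiv_comp_vec (g := T.incl) (T.incl_smooth.mdifferentiable (by simp) _) hc hc0 1).trans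
    (congrArg (mfderiv 𝓘(ℝ, EP) 𝓘(ℝ, EG) T.incl 1) hA)

theorem hasDerivAt_AdL_incl_inv {c : ℝ → P} (hc : ContMDiffAt 𝓘(ℝ, ℝ) 𝓘(ℝ, EP) ∞ c 0)
    (hc0 : c 0 = 1) {A : Lie𝔤 (EG := EP) P}
    (hA : (mfderiv 𝓘(ℝ, ℝ) 𝓘(ℝ, EP) c 0 : ℝ → EP) 1 = A) (X : Lie𝔤 (EG := EG) G) :
    HasDerivAt (fun t => AdL (EG := EG) (T.incl (c t))⁻¹ (toVec X))
      (toVec (-⁅T.lieIncl A, X⁆)) 0 := by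
  have : CompleteSpace EG := FiniteDimensional.complete ℝ EG
  exact hasDerivAt_AdL_inv (T.incl_smooth.contMDiffAt.comp (0 : ℝ) hc) (by simp [hc0])
    (T.mfderiv_incl_comp (hc.mdifferentiableAt (by simp)) hc0 hA) X

/-- The pieces `𝔤ᵢ` are the eigenspaces of `ad E`, and `Ad` respects the bracket. -/
theorem mem_G₀_of_Ad_gradingElement {E : Lie𝔤 (EG := EG) G} (hE : IsGradingElement T.gr E) {g : P}
    (hg : Ad (T.incl g) E = E) : g ∈ T.G₀ := by
  intro i X hX
  apply hE.mem_of_lie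
  have h := Ad_lie (T.incl g) E X
  rw [hg, hE.2 i X hX] at h
  rw [← h]
  exact map_smul (AdLin (T.incl g)) (i : ℝ) X

/-- Every element of `P` is a product of elements of `G₀` and `P₊`. -/
theorem exists_mul_mem_G₀_Pplus [T2Space P] (p : P) :
    ∃ g q : P, p = g * q ∧ g ∈ T.G₀ ∧ g⁻¹ ∈ T.G₀ ∧ q ∈ T.Pplus := by
  have := T.isKilling
  have : CompleteSpace EP := FiniteDimensional.complete ℝ EP
  have : CompleteSpace EG := FiniteDimensional.complete ℝ EG
  obtain ⟨E, hE⟩ := exists_gradingElement T.gr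
  -- `Z` measures the failure of `p⁻¹` to fix the grading element. It lies in `𝔤₁`, and `q = exp Z`
  -- corrects it: `Ad(q⁻¹) E = E + Z`, so `q p⁻¹` fixes `E`.
  set Z := Ad (T.incl p⁻¹) E - E with hZdef
  have hZ : Z ∈ T.gr 1 :=
    hE.automorphism_sub_mem T.gr_eq_bot (θ := AdLin (T.incl p⁻¹)) (θ' := AdLin (T.incl p))
      (fun X Y => Ad_lie _ X Y)
      (fun X => by rw [map_inv]; exact Ad_inv_apply_apply _ X)
      (fun i X hX => T.filtration p⁻¹ i X hX) (fun i X hX => T.filtration p i X hX)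
  obtain ⟨A, hA⟩ := (T.lie_range Z).2 (Submodule.mem_sup_right hZ)
  obtain ⟨c, hc, hom, hc0, hcA⟩ := exists_oneParameterSubgroup A
  have hq : c 1 ∈ T.expG₁ := by
    refine ⟨c, hc, hom, ?_, rfl⟩
    have h1 : T.lieIncl (mfderiv 𝓘(ℝ, ℝ) 𝓘(ℝ, EP) c 0 (1 : ℝ)) = Z :=
      (congrArg (mfderiv 𝓘(ℝ, EP) 𝓘(ℝ, EG) T.incl 1) hcA).trans hA
    rw [h1]
    exact hZ
  have h1 : Ad (T.incl (c 1))⁻¹ E = E + Z :=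
    Ad_inv_oneParameterSubgroup (c := fun t => T.incl (c t)) (T.incl_smooth.comp hc)
      (fun s t => by rw [hom, map_mul]) (by simp [hc0])
      ((T.mfderiv_incl_comp ((hc 0).mdifferentiableAt (by simp)) hc0 hcA).trans hA)
      (by rw [hE.2 1 Z hZ]; simp)
  have h2 : Ad (T.incl (c 1 * p⁻¹)) E = E := by
    rw [map_mul, Ad_mul_apply]
    have h3 : Ad (T.incl p⁻¹) E = E + Z := by rw [hZdef]; abel
    rw [h3, ← h1, Ad_apply_inv_apply]
  have h4 : Ad (T.incl (c 1 * p⁻¹)⁻¹) E = E := by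
    rw [map_inv]
    nth_rewrite 1 [← h2]
    exact Ad_inv_apply_apply _ _
  refine ⟨(c 1 * p⁻¹)⁻¹, c 1, by group, T.mem_G₀_of_Ad_gradingElement hE h4, ?_,
    Subgroup.subset_closure hq⟩
  rw [inv_inv]
  exact T.mem_G₀_of_Ad_gradingElement hE h2

theorem gproj_neg_one_eq_zero {X : Lie𝔤 (EG := EG) G} (hX : X ∈ T.gr 0 ⊔ T.gr 1) :
    gproj T.gr (-1) X = 0 := by
  obtain ⟨A, hA, Z, hZ, rfl⟩ := Submodule.mem_sup.1 hX
  rw [map_add, gproj_ne T.gr hA (by norm_num), gproj_ne T.gr hZ (by norm_num), add_zero]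

/-- An element of `G₀` acting by `-1` on `𝔤/𝔭` acts by `-1` on `𝔤₋₁`. -/
theorem Ad_eq_neg {g : P} (hg : g ∈ T.G₀)
    (h : ∀ X : Lie𝔤 (EG := EG) G, X + Ad (T.incl g) X ∈ T.gr 0 ⊔ T.gr 1)
    {X : Lie𝔤 (EG := EG) G} (hX : X ∈ T.gr (-1)) : Ad (T.incl g) X = -X := by
  have h1 := T.gproj_neg_one_eq_zero (h X)
  rw [gproj_same T.gr (add_mem hX (hg _ X hX))] at h1
  exact (neg_eq_of_add_eq_zero_right h1).symm

/-- An element of `G₀` acting by `-1` on `𝔤/𝔭` acts trivially on `𝔤₀`. -/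
theorem Ad_eq_self (hT : T.InfinitesimallyEffective) {g : P} (hg : g ∈ T.G₀)
    (h : ∀ X : Lie𝔤 (EG := EG) G, X + Ad (T.incl g) X ∈ T.gr 0 ⊔ T.gr 1)
    {A : Lie𝔤 (EG := EG) G} (hA : A ∈ T.gr 0) : Ad (T.incl g) A = A := by
  have := T.isKilling
  rw [← sub_eq_zero]
  -- For `X ∈ 𝔤₋₁`, expanding `Ad(g)[A, X] = -[A, X]` gives `[Ad(g) A, X] = [A, X]`, so the
  -- difference `Ad(g) A - A` annihilates `𝔤₋₁`.
  refine eq_zero_of_lie_negative_eq_zero T.gr_eq_bot hT (sub_mem (hg 0 A hA) hA) fun X hX => ?_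
  have h1 := SetLike.GradedBracket.bracket_mem hA hX
  rw [zero_add] at h1
  have h2 := T.Ad_eq_neg hg h h1
  have : CompleteSpace EG := FiniteDimensional.complete ℝ EG
  rw [Ad_lie, T.Ad_eq_neg hg h hX, lie_neg, neg_inj] at h2
  rw [sub_lie, h2, sub_self]

end ParabolicType

/-- The derivative of a map of manifolds, as a linear map of the model spaces. -/
def vecDeriv {EN : Type*} [NormedAddCommGroup EN] [NormedSpace ℝ EN]
    {N : Type*} [TopologicalSpace N] [ChartedSpace EN N]
    {EB : Type*} [NormedAddCommGroup EB] [NormedSpace ℝ EB]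
    {B : Type*} [TopologicalSpace B] [ChartedSpace EB B] (f : N → B) (x : N) : EN →L[ℝ] EB :=
  mfderiv 𝓘(ℝ, EN) 𝓘(ℝ, EB) f x

/-! ### The curvature function: horizontality, naturality, differentiability. -/

namespace Geometry

variable
  {EG : Type*} [NormedAddCommGroup EG] [NormedSpace ℝ EG] [FiniteDimensional ℝ EG]
  {G : Type*} [TopologicalSpace G] [ChartedSpace EG G] [Group G] [LieGroup 𝓘(ℝ, EG) ∞ G]
  {EP : Type*} [NormedAddCommGroup EP] [NormedSpace ℝ EP] [FiniteDimensional ℝ EP]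
  {P : Type*} [TopologicalSpace P] [ChartedSpace EP P] [Group P] [LieGroup 𝓘(ℝ, EP) ∞ P]
  {T : ParabolicType EG G EP P}
  {EB : Type*} [NormedAddCommGroup EB] [NormedSpace ℝ EB] [FiniteDimensional ℝ EB]
  {B : Type*} [TopologicalSpace B] [ChartedSpace EB B] [IsManifold 𝓘(ℝ, EB) ∞ B]
  {EM : Type*} [NormedAddCommGroup EM] [NormedSpace ℝ EM] [FiniteDimensional ℝ EM]
  {M : Type*} [TopologicalSpace M] [ChartedSpace EM M] [IsManifold 𝓘(ℝ, EM) ∞ M]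
  (C : Geometry T EB B EM M)

/-- The Cartan connection as a one-form. -/
def connForm (b : B) : TangentSpace 𝓘(ℝ, EB) b →L[ℝ] EG := (C.conn b).toContinuousLinearMap

/-- The Cartan connection at `b` as a linear isomorphism of the model spaces. -/
def connEquiv (b : B) : EB ≃L[ℝ] EG := C.conn b

/-- `conn_smooth` concerns the function on the tangent bundle; composing it with the tangent map of
the inverse chart on constant vectors gives smooth coefficients, which suffices in finite dimension.
-/
theorem smoothFormAt_connForm (u : B) : SmoothFormAt C.connForm u := by
  set ψ := extChartAt 𝓘(ℝ, EB) u with hψ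
  have hopen : IsOpen ψ.target := isOpen_extChartAt_target u
  have hmem : ψ u ∈ ψ.target := mem_extChartAt_target u
  have h : ContDiffOn ℝ ∞ (chartForm C.connForm u) ψ.target := by
    refine contDiffOn_clm_apply.2 fun w => ?_
    have hs : ContMDiffOn 𝓘(ℝ, EB).tangent 𝓘(ℝ, EB).tangent ∞
        (tangentMapWithin 𝓘(ℝ, EB) 𝓘(ℝ, EB) ψ.symm ψ.target)
        (Bundle.TotalSpace.proj ⁻¹' ψ.target) :=
      (contMDiffOn_extChartAt_symm (n := ∞) u).contMDiffOn_tangentMapWithin (by simp)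
        hopen.uniqueMDiffOn
    have hw : ContMDiff 𝓘(ℝ, EB) 𝓘(ℝ, EB).tangent ∞
        (fun y : EB => (⟨y, w⟩ : TangentBundle 𝓘(ℝ, EB) EB)) := fun y =>
      contMDiffAt_vectorSpace_iff_contDiffAt.2 contDiffAt_const
    have h1 := C.conn_smooth.comp_contMDiffOn (hs.comp hw.contMDiffOn (fun y hy => hy))
    refine (contMDiffOn_iff_contDiffOn.1 h1).congr fun y hy => ?_
    have h2 : (mfderivWithin 𝓘(ℝ, EB) 𝓘(ℝ, EB) ψ.symm ψ.target y : EB →L[ℝ] EB) =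
        mfderiv 𝓘(ℝ, EB) 𝓘(ℝ, EB) ψ.symm y := mfderivWithin_of_isOpen hopen hy
    exact congrArg (fun L : EB →L[ℝ] EB => (C.connEquiv (ψ.symm y)) (L w)) h2.symm
  exact h.contDiffAt (hopen.mem_nhds hmem)

/-- The Cartan connection at `b` as a linear isomorphism onto the Lie algebra. -/
def connLin (b : B) : EB ≃ₗ[ℝ] Lie𝔤 (EG := EG) G := (C.conn b).toLinearEquiv

theorem connForm_congr {b b' : B} (h : b = b') (v : EB) :
    formAt C.connForm b v = formAt C.connForm b' v := by
  subst h; rfl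

theorem connLin_congr {b b' : B} (h : b = b') (v : EB) : C.connLin b v = C.connLin b' v := by
  subst h; rfl

/-- The curvature form as a bilinear map. -/
def curvatureLin (u : B) : EB →ₗ[ℝ] EB →ₗ[ℝ] Lie𝔤 (EG := EG) G :=
  LinearMap.mk₂ ℝ (fun v w => ofVec (extDLin C.connForm u v w) + ⁅C.connLin u v, C.connLin u w⁆)
    (fun v v' w => by
      rw [map_add, map_add, add_lie]
      exact add_add_add_comm _ _ _ _)
    (fun r v w => by
      rw [map_smul, map_smul, smul_lie, smul_add]
      rfl)
    (fun v w w' => by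
      rw [map_add, map_add, lie_add]
      exact add_add_add_comm _ _ _ _)
    (fun r v w => by
      rw [map_smul, map_smul, lie_smul, smul_add]
      rfl)

theorem curvatureForm_eq (u : B) (v w : EB) : C.curvatureForm u v w = C.curvatureLin u v w :=
  congrArg (fun z : Lie𝔤 (EG := EG) G => z + ⁅C.connLin u v, C.connLin u w⁆)
    (extD_eq_extDLin (C.smoothFormAt_connForm u) v w)

theorem curvatureLin_skew (u : B) (v w : EB) : C.curvatureLin u v w = -C.curvatureLin u w v := by
  have h1 : extDLin C.connForm u v w = -extDLin C.connForm u w v := by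
    simp [extDLin]
  have h2 : (ofVec (extDLin C.connForm u v w) : Lie𝔤 (EG := EG) G) =
      -ofVec (extDLin C.connForm u w v) := congrArg ofVec h1
  change ofVec (extDLin C.connForm u v w) + ⁅C.connLin u v, C.connLin u w⁆ =
    -(ofVec (extDLin C.connForm u w v) + ⁅C.connLin u w, C.connLin u v⁆)
  rw [h2, ← lie_skew (C.connLin u v), neg_add]

/-- The curvature function as a bilinear map. -/
def kappa (u : B) : Lie𝔤 (EG := EG) G →ₗ[ℝ] Lie𝔤 (EG := EG) G →ₗ[ℝ] Lie𝔤 (EG := EG) G :=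
  (C.curvatureLin u).compl₁₂ (C.connLin u).symm.toLinearMap (C.connLin u).symm.toLinearMap

theorem curvature_eq (u : B) (X Y : Lie𝔤 (EG := EG) G) : C.curvature u X Y = C.kappa u X Y :=
  C.curvatureForm_eq u _ _

theorem kappa_connLin (u : B) (v w : EB) :
    C.kappa u (C.connLin u v) (C.connLin u w) = C.curvatureLin u v w := by
  simp [kappa]

theorem kappa_skew (u : B) (X Y : Lie𝔤 (EG := EG) G) : C.kappa u X Y = -C.kappa u Y X :=
  C.curvatureLin_skew u _ _

/-- The tangent map of the right translation. -/
def actDeriv (p : P) (u : B) : EB →L[ℝ] EB := mfderiv 𝓘(ℝ, EB) 𝓘(ℝ, EB) (fun b => C.act b p) u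

/-- The value of the fundamental vector field at `u`. -/
def fundamental (u : B) (A : Lie𝔤 (EG := EP) P) : EB :=
  mfderiv 𝓘(ℝ, EP) 𝓘(ℝ, EB) (fun p => C.act u p) 1 A

theorem connLin_fundamental (u : B) (A : Lie𝔤 (EG := EP) P) :
    C.connLin u (C.fundamental u A) = T.lieIncl A := C.conn_fundamental u A

theorem connLin_actDeriv (p : P) (u : B) (v : EB) :
    C.connLin (C.act u p) (C.actDeriv p u v) = Ad (T.incl p⁻¹) (C.connLin u v) :=
  C.conn_equivariant u p v

theorem contMDiff_act_left (p : P) : ContMDiff 𝓘(ℝ, EB) 𝓘(ℝ, EB) ∞ (fun b => C.act b p) :=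
  C.act_smooth.comp (contMDiff_id.prodMk contMDiff_const)

theorem contMDiff_act_right (u : B) : ContMDiff 𝓘(ℝ, EP) 𝓘(ℝ, EB) ∞ (fun p => C.act u p) :=
  C.act_smooth.comp (contMDiff_const.prodMk contMDiff_id)

/-- On the surface `γ(s)·c(t)`, `ω(∂ₜ)` is the constant image of `A` in `𝔤` along `t = 0`, and
`ω(∂ₛ) = Ad(c(t)⁻¹) ω(v)` along `s = 0` by equivariance. The derivative of the latter is `-[A,
ω(v)]`. -/
theorem extDLin_fundamental (u : B) (v : EB) (A : Lie𝔤 (EG := EP) P) :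
    extDLin C.connForm u v (C.fundamental u A) = toVec ⁅T.lieIncl A, C.connLin u v⁆ := by
  obtain ⟨γ, hγ, rfl, rfl⟩ := exists_curve u v
  obtain ⟨c, hc, hc0, rfl⟩ := exists_curve (EB := EP) (1 : P) A
  obtain ⟨a, b, ha, hb, hab⟩ := extD_two_parameters (F := C.act) C.act_smooth
    (C.smoothFormAt_connForm (C.act (γ 0) (c 0))) hγ hc
  set v : EB := (mfderiv 𝓘(ℝ, ℝ) 𝓘(ℝ, EB) γ 0 : ℝ → EB) 1 with hv
  set A : Lie𝔤 (EG := EP) P := (mfderiv 𝓘(ℝ, ℝ) 𝓘(ℝ, EP) c 0 : ℝ → EP) 1 with hA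
  have hA' : ∀ u : B, (mfderiv 𝓘(ℝ, EP) 𝓘(ℝ, EB) (fun q => C.act u q) (c 0) : EP → EB) A =
      C.fundamental u A := fun u =>
    congrArg (fun L : EP →L[ℝ] EB => L A) (mfderiv_congr_point rfl hc0)
  have hv' : (mfderiv 𝓘(ℝ, EB) 𝓘(ℝ, EB) (fun q => C.act q (c 0)) (γ 0) : EB → EB) v = v := by
    have e : (fun q => C.act q (c 0)) = id := by funext q; rw [hc0, C.act_one]; rfl
    exact congrArg (fun L : EB →L[ℝ] EB => L v) ((mfderiv_congr_point e rfl).trans mfderiv_id)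
  have ha' : HasDerivAt (fun _ : ℝ => toVec (T.lieIncl A)) a 0 := by
    refine ha.congr_of_eventuallyEq (Eventually.of_forall fun s => ?_)
    refine Eq.symm (((C.connForm_congr (by rw [hc0, C.act_one]) _).trans ?_))
    exact (congrArg (C.connLin (γ s)) (hA' _)).trans (C.connLin_fundamental _ _)
  have hb' : HasDerivAt (fun t => AdL (EG := EG) (T.incl (c t))⁻¹ (toVec (C.connLin (γ 0) v)))
      b 0 := by
    refine hb.congr_of_eventuallyEq (Eventually.of_forall fun t => ?_)
    refine Eq.symm ((C.connLin_actDeriv (c t) (γ 0) v).trans ?_)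
    rw [map_inv]
    rfl
  have ha0 : a = 0 := ha'.unique (hasDerivAt_const _ _)
  have hb0 : b = toVec (-⁅T.lieIncl A, C.connLin (γ 0) v⁆) :=
    hb'.unique (T.hasDerivAt_AdL_incl_inv hc hc0 rfl _)
  have h5 : ∀ (k k' : B), k = k' → ∀ a b a' b' : EB, a = a' → b = b' →
      extD (fun b z => C.connForm b z) k a b = extD (fun b z => C.connForm b z) k' a' b' := by
    rintro _ _ rfl _ _ _ _ rfl rfl; rfl
  refine (extD_eq_extDLin (C.smoothFormAt_connForm (γ 0)) v (C.fundamental (γ 0) A)).symm.trans ?_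
  refine (h5 _ _ (by rw [hc0, C.act_one]) _ _ _ _ hv'.symm (hA' (γ 0)).symm).trans
    (hab.trans ?_)
  rw [ha0, hb0, zero_sub]
  exact neg_neg (⁅T.lieIncl A, C.connLin (γ 0) v⁆ : Lie𝔤 (EG := EG) G)

theorem curvatureLin_fundamental (u : B) (v : EB) (A : Lie𝔤 (EG := EP) P) :
    C.curvatureLin u v (C.fundamental u A) = 0 := by
  change ofVec (extDLin C.connForm u v (C.fundamental u A)) +
    ⁅C.connLin u v, C.connLin u (C.fundamental u A)⁆ = 0
  rw [extDLin_fundamental, connLin_fundamental, ← lie_skew (C.connLin u v)]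
  exact add_neg_cancel (⁅T.lieIncl A, C.connLin u v⁆ : Lie𝔤 (EG := EG) G)

theorem symm_connLin_lieIncl (u : B) (A : Lie𝔤 (EG := EP) P) :
    (C.connLin u).symm (T.lieIncl A) = C.fundamental u A := by
  rw [← C.connLin_fundamental u A, LinearEquiv.symm_apply_apply]

/-- The curvature is horizontal. -/
theorem kappa_right_eq_zero (u : B) (X : Lie𝔤 (EG := EG) G) {Y : Lie𝔤 (EG := EG) G}
    (hY : Y ∈ T.gr 0 ⊔ T.gr 1) : C.kappa u X Y = 0 := by
  obtain ⟨A, rfl⟩ := (T.lie_range Y).2 hY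
  have h := C.curvatureLin_fundamental u ((C.connLin u).symm X) A
  rw [← C.symm_connLin_lieIncl] at h
  exact h

theorem kappa_left_eq_zero (u : B) {X : Lie𝔤 (EG := EG) G} (Y : Lie𝔤 (EG := EG) G)
    (hX : X ∈ T.gr 0 ⊔ T.gr 1) : C.kappa u X Y = 0 := by
  rw [kappa_skew, C.kappa_right_eq_zero u Y hX, neg_zero]

/-- Naturality of the curvature under maps that pull the Cartan connection back to its image under
an automorphism of the Lie algebra. -/
theorem kappa_of_pullback {f : B → B} (hf : ContMDiff 𝓘(ℝ, EB) 𝓘(ℝ, EB) ∞ f)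
    {θ : EG →L[ℝ] EG}
    (hlie : ∀ X Y : Lie𝔤 (EG := EG) G, (ofVec (θ (toVec ⁅X, Y⁆)) : Lie𝔤 (EG := EG) G) =
      ⁅(ofVec (θ (toVec X)) : Lie𝔤 (EG := EG) G), (ofVec (θ (toVec Y)) : Lie𝔤 (EG := EG) G)⁆)
    (hθ : ∀ (u : B) (v : EB), C.connLin (f u) (vecDeriv f u v) =
      ofVec (θ (toVec (C.connLin u v)))) (u : B) (X Y : Lie𝔤 (EG := EG) G) :
    C.kappa (f u) (ofVec (θ (toVec X))) (ofVec (θ (toVec Y))) =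
      ofVec (θ (toVec (C.kappa u X Y))) := by
  obtain ⟨v, rfl⟩ := (C.connLin u).surjective X
  obtain ⟨w, rfl⟩ := (C.connLin u).surjective Y
  rw [← hθ, ← hθ, kappa_connLin, kappa_connLin]
  -- The hypothesis says `f^*ω = θ ∘ ω`; applying `d` gives `f^*dω = θ ∘ dω`, and `θ` is compatible
  -- with the bracket term.
  have h2 : pullbackForm (EN := EB) f C.connForm = fun b => θ.comp (C.connForm b) := by
    funext b
    exact ContinuousLinearMap.ext fun v => hθ b v
  have h3 := extD_pullback (f := f) (x := u) (C.smoothFormAt_connForm (f u)) hf.contMDiffAt v w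
  rw [h2] at h3
  have h4 := (extD_clm_comp (C.smoothFormAt_connForm u) θ v w).symm.trans h3
  have h6 : (θ (extDLin C.connForm u v w)) = extDLin C.connForm (f u)
      (vecDeriv f u v)
      (vecDeriv f u w) :=
    (congrArg θ (extD_eq_extDLin (C.smoothFormAt_connForm u) v w).symm).trans
      (h4.trans (extD_eq_extDLin (C.smoothFormAt_connForm (f u)) (vecDeriv f u v) (vecDeriv f u w)))
  have h7 : ofVec (θ (toVec (C.curvatureLin u v w))) =
      (ofVec (θ (extDLin C.connForm u v w)) + ofVec (θ (toVec ⁅C.connLin u v, C.connLin u w⁆)) :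
        Lie𝔤 (EG := EG) G) := map_add θ _ _
  rw [h7, hlie, ← hθ, ← hθ, h6]
  rfl

/-- Equivariance under `P` is naturality with `θ = Ad(p⁻¹)`; invariance under automorphisms, next,
is the case `θ = id`. -/
theorem kappa_act (u : B) (p : P) (X Y : Lie𝔤 (EG := EG) G) :
    C.kappa (C.act u p) (Ad (T.incl p⁻¹) X) (Ad (T.incl p⁻¹) Y) =
      Ad (T.incl p⁻¹) (C.kappa u X Y) := by
  have : CompleteSpace EG := FiniteDimensional.complete ℝ EG
  exact C.kappa_of_pullback (C.contMDiff_act_left p) (θ := AdL (T.incl p⁻¹))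
    (fun X Y => Ad_lie _ X Y) (fun u v => C.connLin_actDeriv p u v) u X Y

theorem kappa_automorphism (φ : C.Automorphism) (u : B) (X Y : Lie𝔤 (EG := EG) G) :
    C.kappa (φ.toDiffeo u) X Y = C.kappa u X Y :=
  C.kappa_of_pullback φ.toDiffeo.contMDiff (θ := ContinuousLinearMap.id ℝ EG)
    (fun _ _ => rfl) (fun u v => φ.pullback_conn u v) u X Y

end Geometry

namespace Geometry

variable
  {EG : Type*} [NormedAddCommGroup EG] [NormedSpace ℝ EG] [FiniteDimensional ℝ EG]
  {G : Type*} [TopologicalSpace G] [ChartedSpace EG G] [Group G] [LieGroup 𝓘(ℝ, EG) ∞ G]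
  {EP : Type*} [NormedAddCommGroup EP] [NormedSpace ℝ EP] [FiniteDimensional ℝ EP]
  {P : Type*} [TopologicalSpace P] [ChartedSpace EP P] [Group P] [LieGroup 𝓘(ℝ, EP) ∞ P]
  {T : ParabolicType EG G EP P}
  {EB : Type*} [NormedAddCommGroup EB] [NormedSpace ℝ EB] [FiniteDimensional ℝ EB]
  {B : Type*} [TopologicalSpace B] [ChartedSpace EB B] [IsManifold 𝓘(ℝ, EB) ∞ B]
  {EM : Type*} [NormedAddCommGroup EM] [NormedSpace ℝ EM] [FiniteDimensional ℝ EM]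
  {M : Type*} [TopologicalSpace M] [ChartedSpace EM M] [IsManifold 𝓘(ℝ, EM) ∞ M]
  (C : Geometry T EB B EM M)

/-- The curvature in terms of the expression of the Cartan connection in a chart. -/
theorem kappa_chartForm (u : B) {y : EB} (hy : y ∈ (extChartAt 𝓘(ℝ, EB) u).target) (v w : EB) :
    C.kappa ((extChartAt 𝓘(ℝ, EB) u).symm y) (ofVec (chartForm C.connForm u y v))
        (ofVec (chartForm C.connForm u y w)) =
      ofVec (fderiv ℝ (chartForm C.connForm u) y v w - fderiv ℝ (chartForm C.connForm u) y w v) +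
        ⁅(ofVec (chartForm C.connForm u y v) : Lie𝔤 (EG := EG) G),
          (ofVec (chartForm C.connForm u y w) : Lie𝔤 (EG := EG) G)⁆ := by
  set ψ := extChartAt 𝓘(ℝ, EB) u with hψ
  have hs : ContMDiffAt 𝓘(ℝ, EB) 𝓘(ℝ, EB) ∞ ψ.symm y :=
    (contMDiffOn_extChartAt_symm u).contMDiffAt ((isOpen_extChartAt_target u).mem_nhds hy)
  have h0 := C.smoothFormAt_connForm (ψ.symm y)
  have h1 := extD_pullback h0 hs v w
  have h2 := extD_vectorSpace (h0.pullback hs) v w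
  have h3 := extD_eq_extDLin h0 (vecDeriv ψ.symm y v) (vecDeriv ψ.symm y w)
  have h4 : extDLin C.connForm (ψ.symm y) (vecDeriv ψ.symm y v) (vecDeriv ψ.symm y w) =
      fderiv ℝ (chartForm C.connForm u) y v w - fderiv ℝ (chartForm C.connForm u) y w v :=
    h3.symm.trans (h1.symm.trans h2)
  rw [← h4]
  exact C.kappa_connLin (ψ.symm y) (vecDeriv ψ.symm y v) (vecDeriv ψ.symm y w)

/-- In a chart, `κ(X, Y)` is expressed by the derivative of the local connection form `A` evaluated
on `A⁻¹ X` and `A⁻¹ Y`, and inversion is smooth on invertible linear maps. -/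
theorem mdifferentiable_kappa (X Y : Lie𝔤 (EG := EG) G) :
    MDifferentiable 𝓘(ℝ, EB) 𝓘(ℝ, EG) (fun b => toVec (C.kappa b X Y)) := by
  intro u
  have : CompleteSpace EB := FiniteDimensional.complete ℝ EB
  set ψ := extChartAt 𝓘(ℝ, EB) u with hψ
  set A := chartForm C.connForm u with hA
  have hAs : ContDiffAt ℝ ∞ A (ψ u) := C.smoothFormAt_connForm u
  have hA0 : A (ψ u) = (C.connEquiv u : EB →L[ℝ] EG) := chartForm_self _ u
  have hinv : ∀ᶠ y in 𝓝 (ψ u), ∃ e : EB ≃L[ℝ] EG, (e : EB →L[ℝ] EG) = A y := by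
    refine hAs.continuousAt.eventually
      (p := fun L => ∃ e : EB ≃L[ℝ] EG, (e : EB →L[ℝ] EG) = L) ?_
    rw [hA0]
    exact (C.connEquiv u).nhds
  have hI : ContDiffAt ℝ ∞ (fun y => (A y).inverse) (ψ u) := by
    refine ContDiffAt.comp (ψ u) (g := ContinuousLinearMap.inverse) ?_ hAs
    rw [hA0]
    exact contDiffAt_map_inverse _
  have hdA : DifferentiableAt ℝ (fderiv ℝ A) (ψ u) :=
    (hAs.fderiv_right (m := 1)
      (by rw [one_add_one_eq_two]; exact ENat.LEInfty.out)).differentiableAt (by simp)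
  have hId : DifferentiableAt ℝ (fun y => (A y).inverse) (ψ u) := hI.differentiableAt (by simp)
  set h : EB → EG := fun y =>
    fderiv ℝ A y ((A y).inverse (toVec X)) ((A y).inverse (toVec Y))
      - fderiv ℝ A y ((A y).inverse (toVec Y)) ((A y).inverse (toVec X)) + toVec ⁅X, Y⁆ with hh
  have hd : DifferentiableAt ℝ h (ψ u) := by
    have e1 : ∀ Z : Lie𝔤 (EG := EG) G,
        DifferentiableAt ℝ (fun y => (A y).inverse (toVec Z)) (ψ u) := fun Z =>
      hId.clm_apply (differentiableAt_const _)
    exact (((hdA.clm_apply (e1 X)).clm_apply (e1 Y)).sub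
      ((hdA.clm_apply (e1 Y)).clm_apply (e1 X))).add (differentiableAt_const _)
  have heq : ∀ᶠ y in 𝓝 (ψ u), toVec (C.kappa (ψ.symm y) X Y) = h y := by
    filter_upwards [hinv, extChartAt_target_mem_nhds (I := 𝓘(ℝ, EB)) u] with y ⟨e, he⟩ hy
    have h1 : ∀ Z : EG, A y ((A y).inverse Z) = Z := by
      intro Z
      rw [← he, ContinuousLinearMap.inverse_equiv]
      exact e.apply_symm_apply Z
    have h2 := C.kappa_chartForm u hy ((A y).inverse (toVec X)) ((A y).inverse (toVec Y))
    rw [← hA, h1, h1] at h2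
    exact h2
  have hψd : MDifferentiableAt 𝓘(ℝ, EB) 𝓘(ℝ, EB) ψ u :=
    mdifferentiableAt_extChartAt (mem_chart_source EB u)
  have hcomp : MDifferentiableAt 𝓘(ℝ, EB) 𝓘(ℝ, EG) (h ∘ ψ) u :=
    hd.mdifferentiableAt.comp u hψd
  refine hcomp.congr_of_eventuallyEq ?_
  filter_upwards [extChartAt_source_mem_nhds (I := 𝓘(ℝ, EB)) u,
    (continuousAt_extChartAt (I := 𝓘(ℝ, EB)) u).eventually heq] with b hb hb'
  rw [Function.comp_apply, ← hb', ψ.left_inv hb]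

end Geometry

/-! ### Chain and product rules. -/

section VecDeriv

variable {EN : Type*} [NormedAddCommGroup EN] [NormedSpace ℝ EN]
  {N : Type*} [TopologicalSpace N] [ChartedSpace EN N]
  {EB : Type*} [NormedAddCommGroup EB] [NormedSpace ℝ EB]
  {B : Type*} [TopologicalSpace B] [ChartedSpace EB B]
  {EC : Type*} [NormedAddCommGroup EC] [NormedSpace ℝ EC]
  {C : Type*} [TopologicalSpace C] [ChartedSpace EC C]
  {ED : Type*} [NormedAddCommGroup ED] [NormedSpace ℝ ED]
  {D : Type*} [TopologicalSpace D] [ChartedSpace ED D]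

theorem vecDeriv_comp {f : N → B} {g : B → C} {x : N}
    (hg : MDifferentiableAt 𝓘(ℝ, EB) 𝓘(ℝ, EC) g (f x))
    (hf : MDifferentiableAt 𝓘(ℝ, EN) 𝓘(ℝ, EB) f x) (v : EN) :
    (vecDeriv (fun z => g (f z)) x v : EC) = vecDeriv g (f x) (vecDeriv f x v : EB) :=
  mfderiv_comp_vec hg hf rfl v

theorem vecDeriv_congr_point (f : N → B) {x y : N} (h : x = y) :
    (vecDeriv f x : EN →L[ℝ] EB) = vecDeriv f y := by
  subst h; rfl

theorem vecDeriv_congr {f g : N → B} {x : N} (h : f =ᶠ[𝓝 x] g) :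
    (vecDeriv f x : EN →L[ℝ] EB) = vecDeriv g x := by
  refine ContinuousLinearMap.ext fun v => ?_
  have h1 := h.mfderiv_eq (I := 𝓘(ℝ, EN)) (I' := 𝓘(ℝ, EB))
  exact congrArg (fun L : EN →L[ℝ] EB => L v) h1

theorem vecDeriv_id (x : N) : (vecDeriv (fun y : N => y) x : EN →L[ℝ] EN) = .id ℝ EN :=
  mfderiv_id

theorem vecDeriv_comp₂ {F : B → C → D} {f : N → B} {g : N → C} {x : N}
    (hF : MDifferentiableAt (𝓘(ℝ, EB).prod 𝓘(ℝ, EC)) 𝓘(ℝ, ED) (fun z : B × C => F z.1 z.2)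
      (f x, g x))
    (hf : MDifferentiableAt 𝓘(ℝ, EN) 𝓘(ℝ, EB) f x)
    (hg : MDifferentiableAt 𝓘(ℝ, EN) 𝓘(ℝ, EC) g x) (v : EN) :
    (vecDeriv (fun z => F (f z) (g z)) x v : ED) =
      vecDeriv (fun b => F b (g x)) (f x) (vecDeriv f x v : EB)
        + vecDeriv (fun c => F (f x) c) (g x) (vecDeriv g x v : EC) := by
  have h1 := HasMFDerivAt.comp x hF.hasMFDerivAt (hf.hasMFDerivAt.prodMk hg.hasMFDerivAt)
  have h2 : (vecDeriv (fun z => F (f z) (g z)) x v : ED) =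
      mfderiv (𝓘(ℝ, EB).prod 𝓘(ℝ, EC)) 𝓘(ℝ, ED) (fun z : B × C => F z.1 z.2) (f x, g x)
        ((vecDeriv f x v : EB), (vecDeriv g x v : EC)) :=
    congrArg (fun L : EN →L[ℝ] ED => L v) h1.mfderiv
  exact h2.trans (mfderiv_prod_eq_add_apply hF)

theorem vecDeriv_eq_deriv {f : ℝ → EB} {f' : EB} {t : ℝ} (h : HasDerivAt f f' t) :
    (vecDeriv f t (1 : ℝ) : EB) = f' := by
  have h1 : (vecDeriv f t : ℝ →L[ℝ] EB) = fderiv ℝ f t := mfderiv_eq_fderiv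
  rw [h1]
  exact h.deriv

end VecDeriv

section LinearCurves

variable {E : Type*} [NormedAddCommGroup E] [NormedSpace ℝ E] [FiniteDimensional ℝ E]
  {V : Type*} [NormedAddCommGroup V] [NormedSpace ℝ V]

/-- The product rule for a curve of linear maps that is differentiable on each vector. -/
theorem hasDerivAt_linearMap_apply {f : ℝ → E →ₗ[ℝ] V} {f' : E →ₗ[ℝ] V} {t : ℝ}
    (hf : ∀ x, HasDerivAt (fun s => f s x) (f' x) t) {g : ℝ → E} {g' : E}
    (hg : HasDerivAt g g' t) : HasDerivAt (fun s => f s (g s)) (f' (g t) + f t g') t := by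
  set b := Module.finBasis ℝ E
  have hexp : ∀ (l : E →ₗ[ℝ] V) (x : E), l x = ∑ i, b.repr x i • l (b i) := by
    intro l x
    conv_lhs => rw [← b.sum_repr x, map_sum]
    simp
  have hc : ∀ i, HasDerivAt (fun s => b.repr (g s) i) (b.repr g' i) t := fun i =>
    (LinearMap.toContinuousLinearMap (b.coord i)).hasFDerivAt.comp_hasDerivAt t hg
  have h := HasDerivAt.fun_sum (u := Finset.univ) fun i _ => (hc i).smul (hf (b i))
  have h1 : (fun s => f s (g s)) = fun s => ∑ i, b.repr (g s) i • f s (b i) := by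
    funext s
    exact hexp _ _
  rw [h1, hexp f', hexp (f t) g', ← Finset.sum_add_distrib]
  exact h

end LinearCurves

/-! ### Components of brackets by degree. -/

namespace ParabolicType

variable {EG : Type*} [NormedAddCommGroup EG] [NormedSpace ℝ EG] [FiniteDimensional ℝ EG]
  {G : Type*} [TopologicalSpace G] [ChartedSpace EG G] [Group G] [LieGroup 𝓘(ℝ, EG) ∞ G]
  {EP : Type*} [NormedAddCommGroup EP] [NormedSpace ℝ EP] [FiniteDimensional ℝ EP]
  {P : Type*} [TopologicalSpace P] [ChartedSpace EP P] [Group P] [LieGroup 𝓘(ℝ, EP) ∞ P]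
  (T : ParabolicType EG G EP P)

theorem gproj_eq_zero {i : ℤ} (hi : 1 < |i|) (X : Lie𝔤 (EG := EG) G) : gproj T.gr i X = 0 := by
  have h := gproj_mem T.gr i X
  rw [T.gr_eq_bot i hi] at h
  exact h

theorem gproj_decomposition (X : Lie𝔤 (EG := EG) G) :
    X = gproj T.gr (-1) X + (gproj T.gr 0 X + gproj T.gr 1 X) := by
  induction X using graded_induction T.gr with
  | h0 => simp
  | hmem i X hX =>
    by_cases hi : 1 < |i|
    · rw [T.gr_eq_bot i hi, Submodule.mem_bot] at hX
      simp [hX]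
    · have h : i = -1 ∨ i = 0 ∨ i = 1 := by
        rw [not_lt, abs_le] at hi
        omega
      rcases h with rfl | rfl | rfl
      · rw [gproj_same _ hX, gproj_ne _ hX (by norm_num), gproj_ne _ hX (by norm_num)]; simp
      · rw [gproj_same _ hX, gproj_ne _ hX (by norm_num), gproj_ne _ hX (by norm_num)]; simp
      · rw [gproj_same _ hX, gproj_ne _ hX (by norm_num), gproj_ne _ hX (by norm_num)]; simp
  | hadd X Y hX hY =>
    nth_rewrite 1 [hX, hY]
    simp only [map_add]
    abel

theorem gproj_add_gproj_mem (X : Lie𝔤 (EG := EG) G) :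
    gproj T.gr 0 X + gproj T.gr 1 X ∈ T.gr 0 ⊔ T.gr 1 :=
  Submodule.add_mem_sup (gproj_mem _ _ _) (gproj_mem _ _ _)

/-- Only the degree pairs `(0, -1)` and `(-1, 0)` contribute, because `𝔤₋₂ = 0`. -/
theorem gproj_neg_one_lie (X Y : Lie𝔤 (EG := EG) G) :
    gproj T.gr (-1) ⁅X, Y⁆ =
      ⁅gproj T.gr 0 X, gproj T.gr (-1) Y⁆ - ⁅gproj T.gr 0 Y, gproj T.gr (-1) X⁆ := by
  have h1 := gproj_lie T.gr (gproj_mem T.gr (-1) X) 0 Y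
  have h2 := gproj_lie T.gr (gproj_mem T.gr 0 X) (-1) Y
  have h3 := gproj_lie T.gr (gproj_mem T.gr 1 X) (-2) Y
  rw [T.gproj_eq_zero (i := -2) (by norm_num), lie_zero] at h3
  norm_num at h1 h2 h3
  nth_rewrite 1 [T.gproj_decomposition X]
  rw [add_lie, add_lie, map_add, map_add, h1, h2, h3, ← lie_skew]
  abel

/-- The possible extra term `[A₁, X₋₁]` is excluded by the hypothesis on `X`. For `X` a curvature
value this hypothesis is the vanishing of the torsion. -/
theorem gproj_zero_lie_of_mem {A X : Lie𝔤 (EG := EG) G} (hX : gproj T.gr (-1) X = 0)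
    (hA : A ∈ T.gr 0 ⊔ T.gr 1) :
    gproj T.gr 0 ⁅A, X⁆ = ⁅gproj T.gr 0 A, gproj T.gr 0 X⁆ := by
  have h2 := gproj_lie T.gr (gproj_mem T.gr 0 A) 0 X
  have h3 := gproj_lie T.gr (gproj_mem T.gr 1 A) (-1) X
  rw [hX, lie_zero] at h3
  norm_num at h2 h3
  nth_rewrite 1 [T.gproj_decomposition A]
  rw [T.gproj_neg_one_eq_zero hA, zero_add, add_lie, map_add, h2, h3, add_zero]

theorem gproj_Ad {g : P} (hg : g ∈ T.G₀) (i : ℤ) (X : Lie𝔤 (EG := EG) G) :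
    gproj T.gr i (Ad (T.incl g) X) = Ad (T.incl g) (gproj T.gr i X) := by
  rw [← AdLin_apply, ← AdLin_apply]
  induction X using graded_induction T.gr with
  | h0 => simp
  | hmem j X hX =>
    have h : AdLin (T.incl g) X ∈ T.gr j := hg j X hX
    rcases eq_or_ne j i with rfl | hj
    · rw [gproj_same _ hX, gproj_same _ h]
    · rw [gproj_ne _ hX hj, gproj_ne _ h hj, map_zero]
  | hadd X Y hX hY => simp only [map_add, hX, hY]

end ParabolicType

/-! ### Fibers and vertical vectors. -/

namespace Geometry

variable
  {EG : Type*} [NormedAddCommGroup EG] [NormedSpace ℝ EG] [FiniteDimensional ℝ EG]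
  {G : Type*} [TopologicalSpace G] [ChartedSpace EG G] [Group G] [LieGroup 𝓘(ℝ, EG) ∞ G]
  {EP : Type*} [NormedAddCommGroup EP] [NormedSpace ℝ EP] [FiniteDimensional ℝ EP]
  {P : Type*} [TopologicalSpace P] [ChartedSpace EP P] [Group P] [LieGroup 𝓘(ℝ, EP) ∞ P]
  {T : ParabolicType EG G EP P}
  {EB : Type*} [NormedAddCommGroup EB] [NormedSpace ℝ EB] [FiniteDimensional ℝ EB]
  {B : Type*} [TopologicalSpace B] [ChartedSpace EB B] [IsManifold 𝓘(ℝ, EB) ∞ B]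
  {EM : Type*} [NormedAddCommGroup EM] [NormedSpace ℝ EM] [FiniteDimensional ℝ EM]
  {M : Type*} [TopologicalSpace M] [ChartedSpace EM M] [IsManifold 𝓘(ℝ, EM) ∞ M]
  (C : Geometry T EB B EM M)

theorem exists_act_eq {u u' : B} (h : C.proj u = C.proj u') : ∃ p, C.act u p = u' := by
  obtain ⟨U, hU, hx, s, k, -, -, -, hsk⟩ := C.locally_trivial (C.proj u)
  have h1 := hsk u hx
  have h2 := hsk u' (by rw [Set.mem_preimage, ← h]; exact hx)
  refine ⟨(k u)⁻¹ * k u', ?_⟩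
  rw [← h] at h2
  nth_rewrite 1 [← h1]
  rw [← C.act_mul, mul_inv_cancel_left, h2]

/-- A vector tangent to the fiber is the value of a fundamental vector field. -/
theorem exists_fundamental_eq {u : B} {v : EB} (hv : (vecDeriv C.proj u v : EM) = 0) :
    ∃ A : Lie𝔤 (EG := EP) P, C.fundamental u A = v := by
  obtain ⟨U, hU, hx, s, k, hs, hk, -, hsk⟩ := C.locally_trivial (C.proj u)
  have hUo : C.proj ⁻¹' U ∈ 𝓝 u := (hU.preimage C.proj_smooth.continuous).mem_nhds hx
  have hsd : MDifferentiableAt 𝓘(ℝ, EM) 𝓘(ℝ, EB) s (C.proj u) :=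
    (hs.contMDiffAt (hU.mem_nhds hx)).mdifferentiableAt (by simp)
  have hkd : MDifferentiableAt 𝓘(ℝ, EB) 𝓘(ℝ, EP) k u :=
    (hk.contMDiffAt hUo).mdifferentiableAt (by simp)
  have hpd : MDifferentiableAt 𝓘(ℝ, EB) 𝓘(ℝ, EM) C.proj u :=
    C.proj_smooth.mdifferentiable (by simp) _
  have h1 : (vecDeriv (fun b => C.act (s (C.proj b)) (k b)) u : EB →L[ℝ] EB) = .id ℝ EB :=
    (vecDeriv_congr (g := fun b => b) (by filter_upwards [hUo] with b hb using hsk b hb)).trans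
      (vecDeriv_id u)
  -- The identity `b = s(π(b))·k(b)` is differentiated at `u`; for vertical `v` only the derivative
  -- in the group variable remains, which is then moved to `1` by a left translation.
  have h2 : v = (vecDeriv (fun b => C.act (s (C.proj b)) (k b)) u v : EB) := by
    rw [h1]; rfl
  rw [vecDeriv_comp₂ (EB := EB) (EC := EP) (F := C.act) (f := fun b => s (C.proj b))
    (C.act_smooth.mdifferentiable (by simp) _)
    (hsd.comp u hpd) hkd, vecDeriv_comp (EB := EM) hsd hpd, hv, map_zero, map_zero, zero_add] at h2
  have h3 : (fun c => C.act (s (C.proj u)) c) = fun c => C.act u ((k u)⁻¹ * c) := by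
    funext c
    nth_rewrite 2 [← hsk u hx]
    rw [← C.act_mul, mul_inv_cancel_left]
  rw [h3, vecDeriv_comp (EB := EP) (f := fun c => (k u)⁻¹ * c)
    ((C.contMDiff_act_right u).mdifferentiable (by simp) _)
    ((contMDiff_lmul (EG := EP) (k u)⁻¹).mdifferentiable (by simp) _),
    vecDeriv_congr_point _ (inv_mul_cancel (k u))] at h2
  exact ⟨_, h2.symm⟩

theorem connLin_mem_of_vecDeriv_proj {u : B} {v : EB} (hv : (vecDeriv C.proj u v : EM) = 0) :
    C.connLin u v ∈ T.gr 0 ⊔ T.gr 1 := by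
  obtain ⟨A, rfl⟩ := C.exists_fundamental_eq hv
  rw [C.connLin_fundamental]
  exact (T.lie_range _).1 ⟨A, rfl⟩

end Geometry

/-! ### Symmetries as reflections at the points of the Weyl section. -/

namespace Geometry

variable
  {EG : Type*} [NormedAddCommGroup EG] [NormedSpace ℝ EG] [FiniteDimensional ℝ EG]
  {G : Type*} [TopologicalSpace G] [ChartedSpace EG G] [Group G] [LieGroup 𝓘(ℝ, EG) ∞ G]
  {EP : Type*} [NormedAddCommGroup EP] [NormedSpace ℝ EP] [FiniteDimensional ℝ EP]
  {P : Type*} [TopologicalSpace P] [ChartedSpace EP P] [Group P] [LieGroup 𝓘(ℝ, EP) ∞ P]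
  {T : ParabolicType EG G EP P}
  {EB : Type*} [NormedAddCommGroup EB] [NormedSpace ℝ EB] [FiniteDimensional ℝ EB]
  {B : Type*} [TopologicalSpace B] [ChartedSpace EB B] [IsManifold 𝓘(ℝ, EB) ∞ B]
  {EM : Type*} [NormedAddCommGroup EM] [NormedSpace ℝ EM] [FiniteDimensional ℝ EM]
  {M : Type*} [TopologicalSpace M] [ChartedSpace EM M] [IsManifold 𝓘(ℝ, EM) ∞ M]
  (C : Geometry T EB B EM M)


theorem kappa_gproj_left (u : B) (X Y : Lie𝔤 (EG := EG) G) :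
    C.kappa u X Y = C.kappa u (gproj T.gr (-1) X) Y := by
  nth_rewrite 1 [T.gproj_decomposition X]
  rw [map_add, LinearMap.add_apply, C.kappa_left_eq_zero u Y (T.gproj_add_gproj_mem X), add_zero]

theorem kappa_gproj_right (u : B) (X Y : Lie𝔤 (EG := EG) G) :
    C.kappa u X Y = C.kappa u X (gproj T.gr (-1) Y) := by
  rw [kappa_skew, kappa_gproj_left, ← kappa_skew]

section FiberwiseInvariant

variable {C}

theorem toB₀_eq_iff {u v : B} : C.toB₀ u = C.toB₀ v ↔ ∃ q ∈ T.Pplus, C.act u q = v :=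
  Quotient.eq (r := C.orbitSetoid)

variable {S : C.SymmetrySystem} {σ : C.B₀ → B}

namespace IsFiberwiseInvariantWeylStructure

variable (hσ : C.IsFiberwiseInvariantWeylStructure S σ)
include hσ

theorem toB₀_apply (u : B) : C.toB₀ (σ (C.toB₀ u)) = C.toB₀ u := by
  obtain ⟨τ, hτ, -, h⟩ := hσ.fiberwise (C.proj u)
  rw [h u rfl, hτ.isSection]

/-- Values of `σ` are the points `u` fixed by `σ ∘ π`, the form in which the pointwise argument
takes them. -/
theorem idempotent (u : B) : σ (C.toB₀ (σ (C.toB₀ u))) = σ (C.toB₀ u) := by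
  rw [hσ.toB₀_apply]

/-- At a point in the image of `σ`, the symmetry agrees with the action of an element of `G₀`. -/
theorem exists_mem_G₀ [T2Space P] {u : B} (hu : σ (C.toB₀ u) = u) :
    ∃ (φ : C.Automorphism) (g : P), φ.Covers (S.s (C.proj u)) ∧ φ.toDiffeo u = C.act u g ∧
      g ∈ T.G₀ ∧ g⁻¹ ∈ T.G₀ := by
  obtain ⟨τ, hτ, ⟨φ, hφ, hinv⟩, h⟩ := hσ.fiberwise (C.proj u)
  have h0 : τ (C.toB₀ u) = u := by rw [← h u rfl, hu]
  have h1 : φ.toDiffeo u = τ (C.toB₀ (φ.toDiffeo u)) := by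
    have := hinv u rfl
    rw [h0] at this
    exact this
  obtain ⟨p, hp⟩ := C.exists_act_eq (u := u) (u' := φ.toDiffeo u)
    (by rw [hφ u, (S.isSymmetry _).fixes])
  obtain ⟨g, q, rfl, hg, hg', hq⟩ := T.exists_mul_mem_G₀_Pplus p
  refine ⟨φ, g, hφ, ?_, hg, hg'⟩
  -- The factor `q ∈ P₊` is invisible in the orbit space, so equivariance of `τ` under `g`
  -- determines `φ(u)` itself and not only its orbit.
  have h2 : C.toB₀ (φ.toDiffeo u) = C.toB₀ (C.act u g) := by
    rw [eq_comm, toB₀_eq_iff]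
    exact ⟨q, hq, by rw [← hp, C.act_mul]⟩
  rw [h1, h2, hτ.equivariant u g hg, h0]

end IsFiberwiseInvariantWeylStructure

/-- For `X = ω(v)`, the vectors `Tφ(v)` and `Tr_p(v)` at `φ(u) = u·p` project to opposite vectors of
the base. Their sum is vertical, and `ω` takes it to `X + Ad(p⁻¹) X`. -/
theorem IsSymmetryAt.add_Ad_mem {x : M} {s : M ≃ₘ⟮𝓘(ℝ, EM), 𝓘(ℝ, EM)⟯ M} (hs : C.IsSymmetryAt x s)
    {φ : C.Automorphism} (hφ : φ.Covers s) {u : B} (hu : C.proj u = x) {p : P}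
    (hp : φ.toDiffeo u = C.act u p) (X : Lie𝔤 (EG := EG) G) :
    X + Ad (T.incl p⁻¹) X ∈ T.gr 0 ⊔ T.gr 1 := by
  subst hu
  obtain ⟨v, rfl⟩ := (C.connLin u).surjective X
  have hπ : MDifferentiable 𝓘(ℝ, EB) 𝓘(ℝ, EM) C.proj := C.proj_smooth.mdifferentiable (by simp)
  have h1 : (vecDeriv C.proj (C.act u p) (C.actDeriv p u v) : EM) = vecDeriv C.proj u v := by
    have h := vecDeriv_comp (EN := EB) (EB := EB) (EC := EM) (f := fun b => C.act b p)
      (hπ (C.act u p)) ((C.contMDiff_act_left p).mdifferentiable (by simp) u) v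
    refine h.symm.trans ?_
    have e : (fun z => C.proj (C.act z p)) = C.proj := by funext z; exact C.proj_act z p
    rw [e]
  have h2 : (vecDeriv C.proj (φ.toDiffeo u) (vecDeriv φ.toDiffeo u v : EB) : EM) =
      -vecDeriv C.proj u v := by
    have h := vecDeriv_comp (EN := EB) (EB := EB) (EC := EM) (f := φ.toDiffeo)
      (hπ (φ.toDiffeo u)) (φ.toDiffeo.contMDiff.mdifferentiable (by simp) u) v
    refine h.symm.trans ?_
    have e : (fun z => C.proj (φ.toDiffeo z)) = fun z => s (C.proj z) := by funext z; exact hφ z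
    rw [e, vecDeriv_comp (EB := EM) (s.contMDiff.mdifferentiable (by simp) _) (hπ u)]
    exact hs.tangent _
  rw [vecDeriv_congr_point C.proj hp] at h2
  have h3 := C.connLin_mem_of_vecDeriv_proj (u := C.act u p)
    (v := (vecDeriv φ.toDiffeo u v : EB) + C.actDeriv p u v)
    (by rw [map_add, h1, h2, neg_add_cancel])
  rw [map_add, C.connLin_actDeriv, C.connLin_congr hp.symm] at h3
  have h4 : C.connLin (φ.toDiffeo u) (vecDeriv φ.toDiffeo u v : EB) = C.connLin u v :=
    φ.pullback_conn u v
  rwa [h4] at h3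

/-- An automorphism that acts at the point `u` as an element `g` of `G₀` with `Ad g = -1` on `𝔤₋₁`
and `Ad g = 1` on `𝔤₀`. -/
structure ReflectsAt (φ : C.Automorphism) (u : B) (g : P) : Prop where
  eq_act : φ.toDiffeo u = C.act u g
  inv_mem : g⁻¹ ∈ T.G₀
  neg : ∀ X ∈ T.gr (-1), Ad (T.incl g⁻¹) X = -X
  fix : ∀ A ∈ T.gr 0, Ad (T.incl g⁻¹) A = A

/-- All that the symmetries contribute to the conclusions is contained in this statement;
effectivity enters only through the triviality of the action on `𝔤₀`. -/
theorem IsFiberwiseInvariantWeylStructure.exists_reflectsAt [T2Space P]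
    (hT : T.InfinitesimallyEffective) (hσ : C.IsFiberwiseInvariantWeylStructure S σ) {u : B}
    (hu : σ (C.toB₀ u) = u) : ∃ (φ : C.Automorphism) (g : P), ReflectsAt φ u g := by
  obtain ⟨φ, g, hφ, hg, -, hg'⟩ := hσ.exists_mem_G₀ hu
  have h := (S.isSymmetry _).add_Ad_mem hφ rfl hg
  exact ⟨φ, g, hg, hg', fun X hX => T.Ad_eq_neg hg' h hX, fun A hA => T.Ad_eq_self hT hg' h hA⟩

namespace ReflectsAt

variable {φ : C.Automorphism} {u : B} {g : P} (h : ReflectsAt φ u g)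
include h

/-- The signs of the two arguments cancel and that of the value remains, so the component equals its
negative. -/
theorem gproj_neg_one_kappa_of_mem {X Y : Lie𝔤 (EG := EG) G} (hX : X ∈ T.gr (-1))
    (hY : Y ∈ T.gr (-1)) : gproj T.gr (-1) (C.kappa u X Y) = 0 := by
  have h1 := C.kappa_act u g X Y
  rw [← h.eq_act, C.kappa_automorphism, h.neg X hX, h.neg Y hY, map_neg, map_neg,
    LinearMap.neg_apply, neg_neg] at h1
  have h2 := congrArg (gproj T.gr (-1)) h1
  rw [T.gproj_Ad h.inv_mem, h.neg _ (gproj_mem _ _ _)] at h2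
  have h3 : (2 : ℝ) • gproj T.gr (-1) (C.kappa u X Y) = 0 := by
    rw [two_smul]
    nth_rewrite 1 [h2]
    exact neg_add_cancel _
  exact (smul_eq_zero.1 h3).resolve_left two_ne_zero

theorem gproj_neg_one_kappa (X Y : Lie𝔤 (EG := EG) G) :
    gproj T.gr (-1) (C.kappa u X Y) = 0 := by
  rw [C.kappa_gproj_left, C.kappa_gproj_right]
  exact h.gproj_neg_one_kappa_of_mem (gproj_mem _ _ _) (gproj_mem _ _ _)

end ReflectsAt

end FiberwiseInvariant

end Geometry

/-! ### Derivatives of the curvature in vertical and in `𝔤₋₁`-directions. -/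

namespace Geometry

variable
  {EG : Type*} [NormedAddCommGroup EG] [NormedSpace ℝ EG] [FiniteDimensional ℝ EG]
  {G : Type*} [TopologicalSpace G] [ChartedSpace EG G] [Group G] [LieGroup 𝓘(ℝ, EG) ∞ G]
  {EP : Type*} [NormedAddCommGroup EP] [NormedSpace ℝ EP] [FiniteDimensional ℝ EP]
  {P : Type*} [TopologicalSpace P] [ChartedSpace EP P] [Group P] [LieGroup 𝓘(ℝ, EP) ∞ P]
  {T : ParabolicType EG G EP P}
  {EB : Type*} [NormedAddCommGroup EB] [NormedSpace ℝ EB] [FiniteDimensional ℝ EB]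
  {B : Type*} [TopologicalSpace B] [ChartedSpace EB B] [IsManifold 𝓘(ℝ, EB) ∞ B]
  {EM : Type*} [NormedAddCommGroup EM] [NormedSpace ℝ EM] [FiniteDimensional ℝ EM]
  {M : Type*} [TopologicalSpace M] [ChartedSpace EM M] [IsManifold 𝓘(ℝ, EM) ∞ M]
  (C : Geometry T EB B EM M)



/-- The projection to `𝔤ᵢ` as a continuous linear map of the model space. -/
def gprojL (T : ParabolicType EG G EP P) (i : ℤ) : EG →L[ℝ] EG :=
  LinearMap.toContinuousLinearMap (gproj T.gr i : EG →ₗ[ℝ] EG)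

/-- The derivative of the curvature in vertical directions. -/
theorem vecDeriv_kappa_fundamental [T2Space P] (u : B) (A : Lie𝔤 (EG := EP) P)
    (X Y : Lie𝔤 (EG := EG) G) :
    (vecDeriv (fun b => toVec (C.kappa b X Y)) u (C.fundamental u A) : EG) =
      toVec (-⁅T.lieIncl A, C.kappa u X Y⁆ +
        (C.kappa u ⁅T.lieIncl A, X⁆ Y + C.kappa u X ⁅T.lieIncl A, Y⁆)) := by
  have : CompleteSpace EP := FiniteDimensional.complete ℝ EP
  obtain ⟨c, hc, hom, hc0, hcA⟩ := exists_oneParameterSubgroup A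
  -- The derivative is known for `Ad(c(t)⁻¹)`; the substitution `c(t) = c(-t)⁻¹` changes its sign.
  have hAd : ∀ Z : Lie𝔤 (EG := EG) G,
      HasDerivAt (fun t => toVec (Ad (T.incl (c t)) Z)) (toVec ⁅T.lieIncl A, Z⁆) 0 := by
    intro Z
    have h0 := T.hasDerivAt_AdL_incl_inv hc.contMDiffAt hc0 hcA Z
    rw [← neg_zero (G := ℝ)] at h0
    have h1 := HasDerivAt.scomp (h := fun s : ℝ => -s) (0 : ℝ) h0 (hasDerivAt_neg (0 : ℝ))
    have h2 : (-1 : ℝ) • toVec (-⁅T.lieIncl A, Z⁆) = toVec ⁅T.lieIncl A, Z⁆ := by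
      rw [neg_one_smul]
      exact neg_neg (⁅T.lieIncl A, Z⁆ : Lie𝔤 (EG := EG) G)
    rw [h2] at h1
    refine h1.congr_of_eventuallyEq (Eventually.of_forall fun t => ?_)
    have h3 : c t = (c (-t))⁻¹ := by
      rw [eq_inv_iff_mul_eq_one, ← hom, add_neg_cancel, hc0]
    change toVec (Ad (T.incl (c t)) Z) = toVec (Ad (T.incl (c (-t)))⁻¹ Z)
    rw [h3, map_inv]
  have hAd0 : ∀ Z : Lie𝔤 (EG := EG) G, Ad (T.incl (c 0)) Z = Z := by
    intro Z
    rw [hc0, map_one]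
    exact congrArg (fun L : EG →L[ℝ] EG => L Z) AdL_one
  have h1 : HasDerivAt (fun t => toVec (C.kappa u (Ad (T.incl (c t)) X) (Ad (T.incl (c t)) Y)))
      (toVec (C.kappa u ⁅T.lieIncl A, X⁆ Y + C.kappa u X ⁅T.lieIncl A, Y⁆)) 0 := by
    have h2 := hasDerivAt_linearMap_apply (E := EG) (V := EG)
      (f := fun t => C.kappa u (Ad (T.incl (c t)) X)) (f' := C.kappa u ⁅T.lieIncl A, X⁆)
      (fun Z => (LinearMap.toContinuousLinearMap (E := EG) (F' := EG)
        (show EG →ₗ[ℝ] EG from (C.kappa u).flip (ofVec Z))).hasFDerivAt.comp_hasDerivAt (0 : ℝ)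
          (hAd X))
      (hAd Y)
    have h3 : toVec (C.kappa u ⁅T.lieIncl A, X⁆ Y + C.kappa u X ⁅T.lieIncl A, Y⁆) =
        toVec (C.kappa u ⁅T.lieIncl A, X⁆ (Ad (T.incl (c 0)) Y) +
          C.kappa u (Ad (T.incl (c 0)) X) ⁅T.lieIncl A, Y⁆) := by rw [hAd0, hAd0]
    rw [h3]
    exact h2
  -- Product rule for `κ(u·c(t))(X, Y) = Ad(c(t)⁻¹) κ(u)(Ad(c(t)) X, Ad(c(t)) Y)`.
  have h4 := hasDerivAt_linearMap_apply (E := EG) (V := EG)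
    (f := fun t => AdLin (T.incl (c t))⁻¹)
    (f' := -(LieAlgebra.ad ℝ (Lie𝔤 (EG := EG) G) (T.lieIncl A)))
    (fun Z => T.hasDerivAt_AdL_incl_inv hc.contMDiffAt hc0 hcA (ofVec Z)) h1
  have h5 : HasDerivAt (fun t => toVec (C.kappa (C.act u (c t)) X Y))
      (toVec (-⁅T.lieIncl A, C.kappa u X Y⁆ +
        (C.kappa u ⁅T.lieIncl A, X⁆ Y + C.kappa u X ⁅T.lieIncl A, Y⁆))) 0 := by
    have h6 : toVec (-⁅T.lieIncl A, C.kappa u X Y⁆ +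
        (C.kappa u ⁅T.lieIncl A, X⁆ Y + C.kappa u X ⁅T.lieIncl A, Y⁆)) =
        toVec (-⁅T.lieIncl A, C.kappa u (Ad (T.incl (c 0)) X) (Ad (T.incl (c 0)) Y)⁆ +
          Ad (T.incl (c 0))⁻¹
            (C.kappa u ⁅T.lieIncl A, X⁆ Y + C.kappa u X ⁅T.lieIncl A, Y⁆)) := by
      rw [hAd0, hAd0, ← hAd0 (Ad (T.incl (c 0))⁻¹ _), Ad_apply_inv_apply]
    rw [h6]
    refine h4.congr_of_eventuallyEq (Eventually.of_forall fun t => ?_)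
    have h7 := C.kappa_act u (c t) (Ad (T.incl (c t)) X) (Ad (T.incl (c t)) Y)
    rw [map_inv, Ad_inv_apply_apply, Ad_inv_apply_apply] at h7
    exact congrArg toVec h7
  have hac : MDifferentiable 𝓘(ℝ, EP) 𝓘(ℝ, EB) (fun p => C.act u p) :=
    (C.contMDiff_act_right u).mdifferentiable (by simp)
  have hcd : MDifferentiable 𝓘(ℝ, ℝ) 𝓘(ℝ, EP) c := hc.mdifferentiable (by simp)
  have h8 := vecDeriv_comp (EN := ℝ) (EB := EB) (EC := EG) (f := fun t => C.act u (c t))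
    (C.mdifferentiable_kappa X Y (C.act u (c 0))) ((hac _).comp (0 : ℝ) (hcd 0)) 1
  rw [vecDeriv_eq_deriv h5, vecDeriv_comp (EB := EP) (hac _) (hcd 0)] at h8
  have h9 : (vecDeriv (fun p => C.act u p) (c 0) (vecDeriv c 0 (1 : ℝ) : EP) : EB) =
      C.fundamental u A := by
    rw [vecDeriv_congr_point _ hc0]
    exact congrArg (vecDeriv (fun p => C.act u p) 1 : EP →L[ℝ] EB) hcA
  rw [h9, vecDeriv_congr_point _ (show C.act u (c 0) = u by rw [hc0, C.act_one])] at h8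
  exact h8.symm

/-- The component of the curvature function in `𝔤₀`. -/
def kappaZero (X Y : Lie𝔤 (EG := EG) G) (b : B) : EG := toVec (gproj T.gr 0 (C.kappa b X Y))

theorem mdifferentiable_kappaZero (X Y : Lie𝔤 (EG := EG) G) :
    MDifferentiable 𝓘(ℝ, EB) 𝓘(ℝ, EG) (C.kappaZero X Y) :=
  (gprojL T 0).differentiable.mdifferentiable.comp (C.mdifferentiable_kappa X Y)

theorem vecDeriv_kappaZero (X Y : Lie𝔤 (EG := EG) G) (u : B) (v : EB) :
    (vecDeriv (C.kappaZero X Y) u v : EG) =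
      gprojL T 0 (vecDeriv (fun b => toVec (C.kappa b X Y)) u v) := by
  have h := vecDeriv_comp (EN := EB) (EB := EG) (EC := EG) (g := gprojL T 0)
    ((gprojL T 0).differentiable.mdifferentiable _) (C.mdifferentiable_kappa X Y u) v
  refine h.trans ?_
  have h1 : ∀ z : EG, (vecDeriv (gprojL T 0) z : EG →L[ℝ] EG) = gprojL T 0 := fun z =>
    mfderiv_eq_fderiv.trans (gprojL T 0).fderiv
  rw [h1]

namespace ReflectsAt

variable {C} {φ : C.Automorphism} {u : B} {g : P} (h : ReflectsAt φ u g)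
include h

/-- The reflection conditions concern only `g`, so equivariance gives invariance at every point `b`;
the function can then be differentiated at `u`. -/
theorem kappaZero_act {X Y : Lie𝔤 (EG := EG) G} (hX : X ∈ T.gr (-1)) (hY : Y ∈ T.gr (-1)) (b : B) :
    C.kappaZero X Y (C.act b g) = C.kappaZero X Y b := by
  have h1 := C.kappa_act b g X Y
  rw [h.neg X hX, h.neg Y hY, map_neg, map_neg, LinearMap.neg_apply, neg_neg] at h1
  rw [kappaZero, h1, T.gproj_Ad h.inv_mem, h.fix _ (gproj_mem _ _ _)]
  rfl

/-- `κ₀(X, Y)` is invariant under `φ` and under right translation by `g`, but these send `ω_u⁻¹(Z)`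
to vectors at `u·g` with `ω`-values `Z` and `-Z`. The derivative equals its negative. -/
theorem vecDeriv_kappaZero_eq_zero {X Y Z : Lie𝔤 (EG := EG) G} (hX : X ∈ T.gr (-1))
    (hY : Y ∈ T.gr (-1)) (hZ : Z ∈ T.gr (-1)) :
    (vecDeriv (C.kappaZero X Y) u ((C.connLin u).symm Z) : EG) = 0 := by
  set z := (C.connLin u).symm Z with hz
  have hzZ : C.connLin u z = Z := (C.connLin u).apply_symm_apply Z
  have hk := C.mdifferentiable_kappaZero X Y
  have h1 : (vecDeriv (C.kappaZero X Y) (C.act u g) (C.actDeriv g u z) : EG) =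
      vecDeriv (C.kappaZero X Y) u z := by
    have e := vecDeriv_comp (EN := EB) (EB := EB) (EC := EG) (f := fun b => C.act b g)
      (hk (C.act u g)) ((C.contMDiff_act_left g).mdifferentiable (by simp) u) z
    refine e.symm.trans ?_
    have e : (fun b => C.kappaZero X Y (C.act b g)) = C.kappaZero X Y := by
      funext b
      exact h.kappaZero_act hX hY b
    rw [e]
  have h2 : (vecDeriv (C.kappaZero X Y) (φ.toDiffeo u) (vecDeriv φ.toDiffeo u z : EB) : EG) =
      vecDeriv (C.kappaZero X Y) u z := by
    have e := vecDeriv_comp (EN := EB) (EB := EB) (EC := EG) (f := φ.toDiffeo)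
      (hk (φ.toDiffeo u)) (φ.toDiffeo.contMDiff.mdifferentiable (by simp) u) z
    refine e.symm.trans ?_
    have e : (fun b => C.kappaZero X Y (φ.toDiffeo b)) = C.kappaZero X Y := by
      funext b
      rw [kappaZero, C.kappa_automorphism]
      rfl
    rw [e]
  have h3 : C.actDeriv g u z = -(vecDeriv φ.toDiffeo u z : EB) := by
    apply (C.connLin (C.act u g)).injective
    rw [map_neg, C.connLin_actDeriv, hzZ, h.neg Z hZ, C.connLin_congr h.eq_act.symm]
    have h4 : C.connLin (φ.toDiffeo u) (vecDeriv φ.toDiffeo u z : EB) = C.connLin u z :=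
      φ.pullback_conn u z
    rw [h4, hzZ]
  rw [vecDeriv_congr_point _ h.eq_act] at h2
  rw [h3, map_neg, h2] at h1
  have h3 : (2 : ℝ) • (vecDeriv (C.kappaZero X Y) u z : EG) = 0 := by
    rw [two_smul]
    nth_rewrite 1 [← h1]
    exact neg_add_cancel _
  exact (smul_eq_zero.1 h3).resolve_left two_ne_zero

/-- The `𝔤₀`-component of the curvature is constant up to the action of the `𝔤₀`-component of the
Cartan connection. -/
theorem vecDeriv_kappaZero_add [T2Space P] {X Y : Lie𝔤 (EG := EG) G} (hX : X ∈ T.gr (-1))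
    (hY : Y ∈ T.gr (-1)) (v : EB) {A : Lie𝔤 (EG := EG) G} (hA : A = gproj T.gr 0 (C.connLin u v)) :
    ofVec (EG := EG) (G := G) (vecDeriv (C.kappaZero X Y) u v : EG) +
      (⁅A, gproj T.gr 0 (C.kappa u X Y)⁆ - gproj T.gr 0 (C.kappa u ⁅A, X⁆ Y)
        - gproj T.gr 0 (C.kappa u X ⁅A, Y⁆)) = 0 := by
  set Z := gproj T.gr (-1) (C.connLin u v) with hZ
  set Q := gproj T.gr 0 (C.connLin u v) + gproj T.gr 1 (C.connLin u v) with hQ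
  have hQm : Q ∈ T.gr 0 ⊔ T.gr 1 := T.gproj_add_gproj_mem _
  obtain ⟨A', hA'⟩ := (T.lie_range Q).2 hQm
  have hA'' : T.lieIncl A' = Q := hA'
  have hQ0 : gproj T.gr 0 Q = A := by
    rw [hA, hQ, map_add, gproj_same _ (gproj_mem _ _ _),
      gproj_ne _ (gproj_mem T.gr 1 _) (by norm_num), add_zero]
  -- The `𝔭`-part `Q` of `ω(v)` is realized by a fundamental vector, so `v` splits into a
  -- `𝔤₋₁`-direction, which contributes zero, and a vertical one.
  have hv : v = (C.connLin u).symm Z + C.fundamental u A' := by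
    apply (C.connLin u).injective
    rw [map_add, LinearEquiv.apply_symm_apply, C.connLin_fundamental, hA'']
    exact T.gproj_decomposition _
  -- The `𝔤₁`-part of `Q` sends `X` into `𝔤₀`, where the horizontal `κ` does not see it.
  have hbr : ∀ X ∈ T.gr (-1), gproj T.gr (-1) ⁅Q, X⁆ = ⁅A, X⁆ := by
    intro X hX
    rw [T.gproj_neg_one_lie, hQ0, T.gproj_neg_one_eq_zero hQm, lie_zero, sub_zero,
      gproj_same _ hX]
  -- Here `T = 0` is used: the `𝔤₁`-part of `Q` could reach `𝔤₀` only by bracketing with the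
  -- torsion.
  have hb := T.gproj_zero_lie_of_mem (h.gproj_neg_one_kappa X Y) hQm
  rw [hQ0] at hb
  have h1 : (vecDeriv (C.kappaZero X Y) u v : EG) =
      toVec (-⁅A, gproj T.gr 0 (C.kappa u X Y)⁆ + (gproj T.gr 0 (C.kappa u ⁅A, X⁆ Y) +
        gproj T.gr 0 (C.kappa u X ⁅A, Y⁆))) := by
    rw [hv, map_add, h.vecDeriv_kappaZero_eq_zero hX hY (gproj_mem _ _ _), zero_add,
      vecDeriv_kappaZero, vecDeriv_kappa_fundamental, hA'', C.kappa_gproj_left u ⁅Q, X⁆,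
      C.kappa_gproj_right u X ⁅Q, Y⁆, hbr X hX, hbr Y hY,
      ← hb]
    have : ∀ Z : Lie𝔤 (EG := EG) G, gprojL T 0 (toVec Z) = toVec (gproj T.gr 0 Z) := fun _ => rfl
    rw [this, map_add, map_add, map_neg]
  rw [h1]
  change (-⁅A, gproj T.gr 0 (C.kappa u X Y)⁆ + (gproj T.gr 0 (C.kappa u ⁅A, X⁆ Y) +
        gproj T.gr 0 (C.kappa u X ⁅A, Y⁆)) : Lie𝔤 (EG := EG) G) + _ = 0
  abel

end ReflectsAt

end Geometry

/-! ### The three conclusions. -/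

namespace Geometry

variable
  {EG : Type*} [NormedAddCommGroup EG] [NormedSpace ℝ EG] [FiniteDimensional ℝ EG]
  {G : Type*} [TopologicalSpace G] [ChartedSpace EG G] [Group G] [LieGroup 𝓘(ℝ, EG) ∞ G]
  {EP : Type*} [NormedAddCommGroup EP] [NormedSpace ℝ EP] [FiniteDimensional ℝ EP]
  {P : Type*} [TopologicalSpace P] [ChartedSpace EP P] [Group P] [LieGroup 𝓘(ℝ, EP) ∞ P]
  {T : ParabolicType EG G EP P}
  {EB : Type*} [NormedAddCommGroup EB] [NormedSpace ℝ EB] [FiniteDimensional ℝ EB]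
  {B : Type*} [TopologicalSpace B] [ChartedSpace EB B] [IsManifold 𝓘(ℝ, EB) ∞ B]
  {EM : Type*} [NormedAddCommGroup EM] [NormedSpace ℝ EM] [FiniteDimensional ℝ EM]
  {M : Type*} [TopologicalSpace M] [ChartedSpace EM M] [IsManifold 𝓘(ℝ, EM) ∞ M]
  (C : Geometry T EB B EM M)




/-- The exterior derivative of the `𝔤₋₁`-component of `F^*ω`, by the structure equation. -/
theorem extD_gprojL_pullback {F : B → B} (hF : ContMDiff 𝓘(ℝ, EB) 𝓘(ℝ, EB) ∞ F) (u : B)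
    (v w : EB) :
    (ofVec (extD (fun b z => (gprojL T (-1)).comp (pullbackForm (EN := EB) F C.connForm b) z)
        u v w) : Lie𝔤 (EG := EG) G) =
      gproj T.gr (-1) (C.curvatureLin (F u) (vecDeriv F u v) (vecDeriv F u w)
        - ⁅C.connLin (F u) (vecDeriv F u v), C.connLin (F u) (vecDeriv F u w)⁆) := by
  have h0 := C.smoothFormAt_connForm (F u)
  have h1 := extD_clm_comp (h0.pullback hF.contMDiffAt) (gprojL T (-1)) v w
  have h2 := (extD_pullback h0 hF.contMDiffAt v w).trans
    (extD_eq_extDLin h0 (vecDeriv F u v) (vecDeriv F u w))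
  have h3 : (C.curvatureLin (F u) (vecDeriv F u v) (vecDeriv F u w)
        - ⁅C.connLin (F u) (vecDeriv F u v), C.connLin (F u) (vecDeriv F u w)⁆ :
        Lie𝔤 (EG := EG) G) =
      ofVec (extDLin C.connForm (F u) (vecDeriv F u v) (vecDeriv F u w)) :=
    add_sub_cancel_right (ofVec (extDLin C.connForm (F u) (vecDeriv F u v) (vecDeriv F u w)))
      ⁅C.connLin (F u) (vecDeriv F u v), C.connLin (F u) (vecDeriv F u w)⁆
  rw [h3]
  exact h1.trans (congrArg (gprojL T (-1)) h2)

variable {C} {S : C.SymmetrySystem} {σ : C.B₀ → B}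

namespace IsFiberwiseInvariantWeylStructure

theorem torsionPart_eq_zero [T2Space P] (hT : T.InfinitesimallyEffective)
    (hσ : C.IsFiberwiseInvariantWeylStructure S σ) (u : B) (X Y : Lie𝔤 (EG := EG) G) :
    C.torsionPart σ u X Y = 0 := by
  obtain ⟨φ, g, h⟩ := hσ.exists_reflectsAt hT (hσ.idempotent u)
  rw [torsionPart, curvature_eq]
  exact h.gproj_neg_one_kappa X Y

/-- The structure equation gives `dθ = T - [σ^*ω, σ^*ω]₋₁` on pairs of vectors. With `T = 0` the
bracket component consists exactly of the `γ`-terms of the torsion form. -/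
theorem weylTorsionFree [T2Space P] (hT : T.InfinitesimallyEffective)
    (hσ : C.IsFiberwiseInvariantWeylStructure S σ) : C.WeylTorsionFree σ := by
  intro u (v : EB) (w : EB)
  obtain ⟨φ, g, h⟩ := hσ.exists_reflectsAt hT (hσ.idempotent u)
  have h1 := C.extD_gprojL_pullback hσ.smooth u v w
  set F : B → B := fun b => σ (C.toB₀ b) with hF
  set a := C.connLin (F u) (vecDeriv F u v) with ha
  set b := C.connLin (F u) (vecDeriv F u w) with hb
  rw [← C.kappa_connLin, map_sub, h.gproj_neg_one_kappa, zero_sub, T.gproj_neg_one_lie] at h1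
  have h2 : (ofVec (extD (fun b z => toVec (C.soldering σ b z)) u v w) : Lie𝔤 (EG := EG) G) =
      -(⁅gproj T.gr 0 a, gproj T.gr (-1) b⁆ - ⁅gproj T.gr 0 b, gproj T.gr (-1) a⁆) := h1
  have h3 : ofVec (extD (fun b z => toVec (C.soldering σ b z)) u v w) +
      ⁅gproj T.gr 0 a, gproj T.gr (-1) b⁆ - ⁅gproj T.gr 0 b, gproj T.gr (-1) a⁆ = 0 := by
    rw [h2]; abel
  exact h3

/-- `W` is `κ₀` composed with `σ ∘ π`, so `vecDeriv_kappaZero_add` at `σ(π(u))`, applied to the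
image of `v`, is the claim after the chain rule. -/
theorem weylCurvatureParallel [T2Space P] (hT : T.InfinitesimallyEffective)
    (hσ : C.IsFiberwiseInvariantWeylStructure S σ) : C.WeylCurvatureParallel σ := by
  intro X hX Y hY
  have hW : ∀ X Y : Lie𝔤 (EG := EG) G, (fun b => toVec (C.weylCurvature σ b X Y)) =
      fun b => C.kappaZero X Y (σ (C.toB₀ b)) := by
    intro X Y
    funext b
    rw [weylCurvature, curvature_eq]
    rfl
  have hF : MDifferentiable 𝓘(ℝ, EB) 𝓘(ℝ, EB) (fun b => σ (C.toB₀ b)) :=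
    hσ.smooth.mdifferentiable (by simp)
  refine ⟨by rw [hW]; exact (C.mdifferentiable_kappaZero X Y).comp hF, fun u (v : EB) => ?_⟩
  obtain ⟨φ, g, h⟩ := hσ.exists_reflectsAt hT (hσ.idempotent u)
  have h1 := h.vecDeriv_kappaZero_add hX hY (vecDeriv (fun b => σ (C.toB₀ b)) u v) rfl
  have h2 := vecDeriv_comp (EN := EB) (EB := EB) (EC := EG) (f := fun b => σ (C.toB₀ b))
    (C.mdifferentiable_kappaZero X Y _) (hF u) v
  rw [← hW] at h2
  rw [← h2] at h1
  simp only [← curvature_eq] at h1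
  exact h1

end IsFiberwiseInvariantWeylStructure

end Geometry

end OneGraded

end

theorem mainTheorem7
    {EG : Type*} [NormedAddCommGroup EG] [NormedSpace ℝ EG] [FiniteDimensional ℝ EG]
    {G : Type*} [TopologicalSpace G] [T2Space G] [ChartedSpace EG G] [Group G]
    [LieGroup 𝓘(ℝ, EG) ∞ G]
    {EP : Type*} [NormedAddCommGroup EP] [NormedSpace ℝ EP] [FiniteDimensional ℝ EP]
    {P : Type*} [TopologicalSpace P] [T2Space P] [ChartedSpace EP P] [Group P]
    [LieGroup 𝓘(ℝ, EP) ∞ P]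
    (T : OneGraded.ParabolicType EG G EP P) (hT : T.InfinitesimallyEffective)
    {EB : Type*} [NormedAddCommGroup EB] [NormedSpace ℝ EB] [FiniteDimensional ℝ EB]
    {B : Type*} [TopologicalSpace B] [T2Space B] [ChartedSpace EB B] [IsManifold 𝓘(ℝ, EB) ∞ B]
    {EM : Type*} [NormedAddCommGroup EM] [NormedSpace ℝ EM] [FiniteDimensional ℝ EM]
    {M : Type*} [TopologicalSpace M] [T2Space M] [ChartedSpace EM M] [IsManifold 𝓘(ℝ, EM) ∞ M]
    (C : OneGraded.Geometry T EB B EM M) (S : C.SymmetrySystem)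
    (σ : C.B₀ → B) (hσ : C.IsFiberwiseInvariantWeylStructure S σ) :
    (∀ u : B, ∀ X ∈ T.gr (-1), ∀ Y ∈ T.gr (-1), C.torsionPart σ u X Y = 0) ∧
      C.WeylTorsionFree σ ∧ C.WeylCurvatureParallel σ := by
  exact ⟨fun u X _ Y _ => hσ.torsionPart_eq_zero hT u X Y, hσ.weylTorsionFree hT,
    hσ.weylCurvatureParallel hT⟩
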